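/- Let $\mathbb K$ be a field and $q\in\mathbb K$. **Tridendriform bialgebras.** A $q$-tridendriform algebra is a $\mathbb K$-vector space $A$ with bilinear operations $\prec,\cdot,\succ$ such that, with $a*b:=a\prec b+q\,a\cdot b+a\succ b$, $$(a\prec b)\prec c=a\prec(b*c),\quad (a\succ b)\prec c=a\succ(b\prec c),\quad (a*b)\succ c=a\succ(b\succ c),\quad (a\cdot b)\cdot c=a\cdot(b\cdot c),$$ $$(a\succ b)\cdot c=a\succ(b\cdot c),\quad (a\prec b)\cdot c=a\cdot(b\succ c),\quad (a\cdot b)\prec c=a\cdot(b\prec c).$$ On $A_+=A\oplus\mathbb K$, with projection $\varepsilon:A_+\to\mathbb K$, put $x\succ1=x\cdot1=1\cdot x=1\prec x=0$, $1\succ x=x=x\prec1$ for $x\in A$, and extend $*$ with unit $1$. A $q$-tridendriform bialgebra is a $q$-tridendriform algebra $H$ with a coassociative linear map $\Delta:H_+\to H_+\otimes H_+$, $\Delta(x)=\sum x_{(1)}\otimes x_{(2)}$, with counit $\varepsilon$, such that $\Delta(1)=1\otimes1$ and $\Delta(x\circ y)=\sum(x_{(1)}*y_{(1)})\otimes(x_{(2)}\circ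 y_{(2)})$ for $x,y\in H$ and $\circ\in\{\prec,\cdot,\succ\}$, where $(x*y)\otimes(1\circ1):=(x\circ y)\otimes1$. Let $\mathrm{Prim}(H)=\{x\in H:\Delta(x)=x\otimes1+1\otimes x\}$, $\bar\Delta(x)=\Delta(x)-x\otimes1-1\otimes x$, $F_1=\mathrm{Prim}(H)$ and $F_n=\{x\in H:\bar\Delta(x)\in F_{n-1}\otimes F_{n-1}\}$ for $n\ge2$; $H$ is connected if $H=\bigcup_{n\ge1}F_n$. Morphisms are the linear maps that preserve $\prec,\cdot,\succ$ and (after extension by $1\mapsto1$) $\Delta$. **$GV_q$ algebras.** A $GV_q$ algebra is a vector space $B$ with an associative bilinear product $\cdot$ and multilinear operations $M_{1n}:B\otimes B^{\otimes n}\to B$ ($n\ge0$) such that $M_{10}=\mathrm{Id}$, $$M_{1m}(M_{1n}(x;y_1,\dots,y_n);z_1,\dots,z_m)=\sum_{0\le i_1\le j_1\le\dots\le i_n\le j_n\le m}M_{1r}(x;z_1,\dots,z_{i_1},M_{1l_1}(y_1;z_{i_1+1},\dots,z_{j_1}),z_{j_1+1},\dots,M_{1l_n}(y_n;z_{i_n+1},\dots,z_{j_n}),z_{j_n+1},\dots,z_m)$$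 with $l_k=j_k-i_k$, $r=n+m-\sum_kl_k$, and $$M_{1n}(x\cdot y;z_1,\dots,z_n)=\sum_{0\le i\le j\le n}q^{j-i}M_{1i}(x;z_1,\dots,z_i)\cdot z_{i+1}\cdots z_j\cdot M_{1(n-j)}(y;z_{j+1},\dots,z_n).$$ Morphisms are the linear maps that preserve $\cdot$ and all $M_{1n}$. In a $q$-tridendriform algebra $A$, let $a\,\tilde\succ\,b=q\,a\cdot b+a\succ b$ and $$M_{1n}(x;y_1,\dots,y_n)=\sum_{i=0}^n(-1)^{i}\,\omega_\prec(y_1,\dots,y_i)\,\tilde\succ\,x\prec\omega_{\tilde\succ}(y_{i+1},\dots,y_n),$$ where $\omega_\prec(y_1,\dots,y_i)=y_1\prec(y_2\prec\cdots(y_{i-1}\prec y_i))$, $\omega_{\tilde\succ}(y_1,\dots,y_k)=((y_1\tilde\succ y_2)\tilde\succ\cdots)\tilde\succ y_k$ and the empty $\omega$'s are $1$. **Enveloping algebra.** For a $GV_q$ algebra $B$ with operations $\tilde M_{1n}$ and $\cdot_B$, let $U_{qGV}(B)=\mathrm{Tridend}_q(B)/\mathcal I$, where $\mathrm{Tridend}_q(B)$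 is the free $q$-tridendriform algebra on the vector space $B$ and $\mathcal I$ is the tridendriform ideal generated by all $\tilde M_{1n}(x;y_1,\dots,y_n)-M_{1n}(x;y_1,\dots,y_n)$ and all $x\cdot_By-x\cdot y$, $x,y,y_i\in B$. Let $\iota:B\to U_{qGV}(B)$ be the canonical map. **Theorem.** For every $q$-tridendriform bialgebra $H$, the subspace $\mathrm{Prim}(H)$ is stable under $\cdot$ and all $M_{1n}$, and is a $GV_q$ algebra under these operations. For every $GV_q$ algebra $B$ there is exactly one coproduct that makes $U_{qGV}(B)$ a $q$-tridendriform bialgebra in which all elements of $\iota(B)$ are primitive, and with it $U_{qGV}(B)$ is connected. Moreover: 1. If $H$ is a connected $q$-tridendriform bialgebra, then $H$ and $U_{qGV}(\mathrm{Prim}(H))$ are isomorphic as $q$-tridendriform bialgebras, by an isomorphism that sends $x\in\mathrm{Prim}(H)$ to $\iota(x)$. 2. If $B$ is a $GV_q$ algebra, then $\iota$ is an isomorphism of $GV_q$ algebras from $B$ onto $\mathrm{Prim}(U_{qGV}(B))$. 3. $\mathrm{Prim}$ and $U_{qGV}$ are mutually quasi-inverse equivalences between the category of connected $q$-tridendriform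 bialgebras and the category of $GV_q$ algebras. -/

import Mathlib

open scoped TensorProduct
open CategoryTheory

universe u v w

noncomputable section

/-! ## Three bilinear operations and `q`-tridendriform algebras -/

/-- Three bilinear operations `≺`, `·`, `≻` on a vector space, with no axioms. -/
@[ext]
structure TriOps (K : Type u) (A : Type v) [Field K] [AddCommGroup A] [Module K A] where
  prec : A →ₗ[K] A →ₗ[K] A
  dot : A →ₗ[K] A →ₗ[K] A
  succ : A →ₗ[K] A →ₗ[K] A

namespace TriOps

variable {K : Type u} {A : Type v} [Field K] [AddCommGroup A] [Module K A]

/-- The product `* = ≺ + q · + ≻`. -/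
def star (o : TriOps K A) (q : K) : A →ₗ[K] A →ₗ[K] A :=
  o.prec + q • o.dot + o.succ

/-- The axioms of a `q`-tridendriform algebra. -/
structure IsTridend (o : TriOps K A) (q : K) : Prop where
  prec_prec : ∀ a b c, o.prec (o.prec a b) c =
    o.prec a (o.prec b c + o.succ b c + q • o.dot b c)
  succ_prec : ∀ a b c, o.prec (o.succ a b) c = o.succ a (o.prec b c)
  succ_succ : ∀ a b c, o.succ (o.prec a b + o.succ a b + q • o.dot a b) c =
    o.succ a (o.succ b c)
  dot_dot : ∀ a b c, o.dot (o.dot a b) c = o.dot a (o.dot b c)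
  succ_dot : ∀ a b c, o.dot (o.succ a b) c = o.succ a (o.dot b c)
  prec_dot : ∀ a b c, o.dot (o.prec a b) c = o.dot a (o.succ b c)
  dot_prec : ∀ a b c, o.prec (o.dot a b) c = o.dot a (o.prec b c)

/-! ### The space `A₊ = A ⊕ K` -/

/-- The inclusion of `A` in `A₊ = A ⊕ K`. -/
def incl (K : Type u) (A : Type v) [Field K] [AddCommGroup A] [Module K A] : A →ₗ[K] A × K :=
  LinearMap.inl K A K

/-- The projection `ε : A₊ → K`. -/
def aug (K : Type u) (A : Type v) [Field K] [AddCommGroup A] [Module K A] : A × K →ₗ[K] K :=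
  LinearMap.snd K A K

/-- The unit `1` of `A₊`. -/
def one (K : Type u) (A : Type v) [Field K] [AddCommGroup A] [Module K A] : A × K := (0, 1)

/-- Extension of `≺` to `A₊`: `x ≺ 1 = x` and `1 ≺ x = 0` for `x ∈ A`.  The value of `1 ≺ 1`,
which is left undefined in the theory, is `0` here; see `tensorOp`. -/
def plusPrec (o : TriOps K A) : (A × K) →ₗ[K] (A × K) →ₗ[K] (A × K) :=
  LinearMap.mk₂ K (fun x y => (o.prec x.1 y.1 + y.2 • x.1, 0))
    (by intro x x' y; ext <;> simp; abel)
    (by intro c x y; ext <;> simp [smul_comm c])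
    (by intro x y y'; ext <;> simp [add_smul]; abel)
    (by intro c x y; ext <;> simp [mul_smul])

/-- Extension of `·` to `A₊`: `x · 1 = 1 · x = 0` for `x ∈ A` (and `1 · 1 = 0`, see `tensorOp`). -/
def plusDot (o : TriOps K A) : (A × K) →ₗ[K] (A × K) →ₗ[K] (A × K) :=
  LinearMap.mk₂ K (fun x y => (o.dot x.1 y.1, 0))
    (by intro x x' y; ext <;> simp)
    (by intro c x y; ext <;> simp)
    (by intro x y y'; ext <;> simp)
    (by intro c x y; ext <;> simp)

/-- Extension of `≻` to `A₊`: `1 ≻ x = x` and `x ≻ 1 = 0` for `x ∈ A` (and `1 ≻ 1 = 0`,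
see `tensorOp`). -/
def plusSucc (o : TriOps K A) : (A × K) →ₗ[K] (A × K) →ₗ[K] (A × K) :=
  LinearMap.mk₂ K (fun x y => (o.succ x.1 y.1 + x.2 • y.1, 0))
    (by intro x x' y; ext <;> simp [add_smul]; abel)
    (by intro c x y; ext <;> simp [mul_smul])
    (by intro x y y'; ext <;> simp; abel)
    (by intro c x y; ext <;> simp [smul_comm c])

/-- The unital product `*` on `A₊`. -/
def plusStar (o : TriOps K A) (q : K) : (A × K) →ₗ[K] (A × K) →ₗ[K] (A × K) :=
  LinearMap.mk₂ K (fun x y => (o.star q x.1 y.1 + x.2 • y.1 + y.2 • x.1, x.2 * y.2))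
    (by intro x x' y; ext <;> simp [add_smul, add_mul]; abel)
    (by intro c x y; ext <;> simp [mul_smul, smul_comm c, mul_assoc])
    (by intro x y y'; ext <;> simp [add_smul, mul_add]; abel)
    (by intro c x y; ext <;> simp [mul_smul, smul_comm c, mul_left_comm])

/-- `(b, b') ↦ ε(b) ε(b') 1`. -/
def augProd (K : Type u) (A : Type v) [Field K] [AddCommGroup A] [Module K A] :
    (A × K) →ₗ[K] (A × K) →ₗ[K] (A × K) :=
  LinearMap.mk₂ K (fun x y => (0, x.2 * y.2))
    (by intro x x' y; ext <;> simp [add_mul])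
    (by intro c x y; ext <;> simp [mul_assoc])
    (by intro x y y'; ext <;> simp [mul_add])
    (by intro c x y; ext <;> simp [mul_left_comm])

/-- For `op` one of the extended operations `≺`, `·`, `≻` on `A₊`, the operation
`(a ⊗ b) ∘ (a' ⊗ b') = (a * a') ⊗ (b ∘ b')` on `A₊ ⊗ A₊`, with the convention
`(a * a') ⊗ (1 ∘ 1) := (a ∘ a') ⊗ 1`.  As `1 ∘ 1 = 0` in `op`, the convention is the additional
summand `(a ∘ a') ⊗ ε(b) ε(b') 1`. -/
def tensorOp (o : TriOps K A) (q : K) (op : (A × K) →ₗ[K] (A × K) →ₗ[K] (A × K)) :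
    ((A × K) ⊗[K] (A × K)) →ₗ[K] ((A × K) ⊗[K] (A × K)) →ₗ[K] ((A × K) ⊗[K] (A × K)) :=
  TensorProduct.map₂ (o.plusStar q) op + TensorProduct.map₂ op (augProd K A)

/-! ### Coproducts -/

/-- `Δ : A₊ → A₊ ⊗ A₊` is a coassociative coproduct with counit `ε` that makes `(A, ≺, ·, ≻)` a
`q`-tridendriform bialgebra. -/
structure IsBialgebra (o : TriOps K A) (q : K) (Δ : (A × K) →ₗ[K] (A × K) ⊗[K] (A × K)) :
    Prop where
  coassoc : TensorProduct.assoc K (A × K) (A × K) (A × K) ∘ₗ Δ.rTensor (A × K) ∘ₗ Δ =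
    Δ.lTensor (A × K) ∘ₗ Δ
  comul_one : Δ (one K A) = one K A ⊗ₜ[K] one K A
  counit_left : ∀ x : A, (aug K A).rTensor (A × K) (Δ (incl K A x)) = (1 : K) ⊗ₜ[K] incl K A x
  counit_right : ∀ x : A, (aug K A).lTensor (A × K) (Δ (incl K A x)) = incl K A x ⊗ₜ[K] (1 : K)
  comul_succ : ∀ x y : A, Δ (incl K A (o.succ x y)) =
    o.tensorOp q o.plusSucc (Δ (incl K A x)) (Δ (incl K A y))
  comul_dot : ∀ x y : A, Δ (incl K A (o.dot x y)) =
    o.tensorOp q o.plusDot (Δ (incl K A x)) (Δ (incl K A y))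
  comul_prec : ∀ x y : A, Δ (incl K A (o.prec x y)) =
    o.tensorOp q o.plusPrec (Δ (incl K A x)) (Δ (incl K A y))

/-! ### The brace operations of a tridendriform algebra -/

/-- The extension to `A₊` of the dendriform operation `≻~ = q · + ≻`. -/
def plusTsucc (o : TriOps K A) (q : K) : (A × K) →ₗ[K] (A × K) →ₗ[K] (A × K) :=
  q • o.plusDot + o.plusSucc

/-- `ω_≺(y₁, …, yₙ) = y₁ ≺ (y₂ ≺ (⋯ (yₙ₋₁ ≺ yₙ)))`, with `ω_≺(∅) = 1`. -/
def omegaPrec (o : TriOps K A) (ys : List A) : A × K :=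
  ys.foldr (fun y z => o.plusPrec (incl K A y) z) (one K A)

/-- `ω_≻~(y₁, …, yₙ) = ((y₁ ≻~ y₂) ≻~ ⋯) ≻~ yₙ`, with `ω_≻~(∅) = 1`. -/
def omegaTsucc (o : TriOps K A) (q : K) (ys : List A) : A × K :=
  ys.foldl (fun z y => o.plusTsucc q z (incl K A y)) (one K A)

/-- `M_{1n}(x; y₁, …, yₙ) = ∑ᵢ (-1)ⁱ ω_≺(y₁, …, yᵢ) ≻~ x ≺ ω_≻~(yᵢ₊₁, …, yₙ)`. -/
def brace (o : TriOps K A) (q : K) (x : A) (ys : List A) : A :=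
  ∑ i ∈ Finset.range (ys.length + 1), (-1 : K) ^ i •
    (o.plusPrec (o.plusTsucc q (o.omegaPrec (ys.take i)) (incl K A x))
      (o.omegaTsucc q (ys.drop i))).1

/-! ### Ideals and quotients -/

/-- A subspace that is a two-sided ideal for each of the three operations. -/
def IsIdeal (o : TriOps K A) (I : Submodule K A) : Prop :=
  ∀ x ∈ I, ∀ y, o.prec x y ∈ I ∧ o.prec y x ∈ I ∧ o.dot x y ∈ I ∧ o.dot y x ∈ I ∧
    o.succ x y ∈ I ∧ o.succ y x ∈ I

/-- The ideal generated by a set. -/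
def idealSpan (o : TriOps K A) (S : Set A) : Submodule K A :=
  sInf {I : Submodule K A | S ⊆ I ∧ o.IsIdeal I}

theorem subset_idealSpan (o : TriOps K A) (S : Set A) : S ⊆ o.idealSpan S := by
  intro x hx
  simp only [idealSpan, SetLike.mem_coe, Submodule.mem_sInf]
  exact fun I hI => hI.1 hx

theorem isIdeal_idealSpan (o : TriOps K A) (S : Set A) : o.IsIdeal (o.idealSpan S) := by
  intro x hx y
  simp only [idealSpan, Submodule.mem_sInf] at hx ⊢
  exact ⟨fun I hI => (hI.2 x (hx I hI) y).1, fun I hI => (hI.2 x (hx I hI) y).2.1,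
    fun I hI => (hI.2 x (hx I hI) y).2.2.1, fun I hI => (hI.2 x (hx I hI) y).2.2.2.1,
    fun I hI => (hI.2 x (hx I hI) y).2.2.2.2.1, fun I hI => (hI.2 x (hx I hI) y).2.2.2.2.2⟩

/-- A bilinear operation descends to the quotient by a subspace that is an ideal for it. -/
def quotOp (f : A →ₗ[K] A →ₗ[K] A) (I : Submodule K A)
    (h : ∀ x ∈ I, ∀ y, f x y ∈ I ∧ f y x ∈ I) : (A ⧸ I) →ₗ[K] (A ⧸ I) →ₗ[K] (A ⧸ I) :=
  I.liftQ
    { toFun := fun x => I.mapQ I (f x) (fun y hy => (h y hy x).2)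
      map_add' := by
        intro x x'
        refine Submodule.linearMap_qext _ ?_
        ext y
        simp
      map_smul' := by
        intro c x
        refine Submodule.linearMap_qext _ ?_
        ext y
        simp }
    (by
      intro x hx
      rw [LinearMap.mem_ker]
      refine Submodule.linearMap_qext _ ?_
      ext y
      simpa using (h x hx y).1)

/-- The operations on the quotient by an ideal. -/
def quot (o : TriOps K A) (I : Submodule K A) (h : o.IsIdeal I) : TriOps K (A ⧸ I) where
  prec := quotOp o.prec I (fun x hx y => ⟨(h x hx y).1, (h x hx y).2.1⟩)
  dot := quotOp o.dot I (fun x hx y => ⟨(h x hx y).2.2.1, (h x hx y).2.2.2.1⟩)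
  succ := quotOp o.succ I (fun x hx y => ⟨(h x hx y).2.2.2.2.1, (h x hx y).2.2.2.2.2⟩)

@[simp] theorem quot_prec (o : TriOps K A) (I : Submodule K A) (h : o.IsIdeal I) (x y : A) :
    (o.quot I h).prec (I.mkQ x) (I.mkQ y) = I.mkQ (o.prec x y) := rfl

@[simp] theorem quot_dot (o : TriOps K A) (I : Submodule K A) (h : o.IsIdeal I) (x y : A) :
    (o.quot I h).dot (I.mkQ x) (I.mkQ y) = I.mkQ (o.dot x y) := rfl

@[simp] theorem quot_succ (o : TriOps K A) (I : Submodule K A) (h : o.IsIdeal I) (x y : A) :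
    (o.quot I h).succ (I.mkQ x) (I.mkQ y) = I.mkQ (o.succ x y) := rfl

theorem IsTridend.quot {o : TriOps K A} {q : K} (ho : o.IsTridend q) (I : Submodule K A)
    (h : o.IsIdeal I) : (o.quot I h).IsTridend q := by
  constructor <;> intro a b c <;> obtain ⟨a, rfl⟩ := I.mkQ_surjective a <;>
    obtain ⟨b, rfl⟩ := I.mkQ_surjective b <;> obtain ⟨c, rfl⟩ := I.mkQ_surjective c <;>
    simp only [quot_prec, quot_dot, quot_succ, ← map_smul I.mkQ, ← map_add I.mkQ]
  · rw [ho.prec_prec]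
  · rw [ho.succ_prec]
  · rw [ho.succ_succ]
  · rw [ho.dot_dot]
  · rw [ho.succ_dot]
  · rw [ho.prec_dot]
  · rw [ho.dot_prec]

end TriOps

/-- A `q`-tridendriform algebra. -/
structure TriAlg (K : Type u) [Field K] (q : K) where
  carrier : Type v
  [addCommGroup : AddCommGroup carrier]
  [module : Module K carrier]
  ops : TriOps K carrier
  isTridend : ops.IsTridend q

attribute [instance] TriAlg.addCommGroup TriAlg.module

instance {K : Type u} [Field K] {q : K} : CoeSort (TriAlg.{u, v} K q) (Type v) :=
  ⟨TriAlg.carrier⟩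

/-! ## `GV_q` algebras -/

/-- For a family of operations `N y [z₁, …, z_l] = N_{1l}(y; z₁, …, z_l)` and a function `F` of
lists, `braceSum N F [y₁, …, yₙ] [z₁, …, zₘ]` is the sum over
`0 ≤ i₁ ≤ j₁ ≤ i₂ ≤ j₂ ≤ ⋯ ≤ iₙ ≤ jₙ ≤ m` of the values of `F` at the lists
`z₁, …, z_{i₁}, N(y₁; z_{i₁+1}, …, z_{j₁}), z_{j₁+1}, …, z_{iₙ}, N(yₙ; z_{iₙ+1}, …, z_{jₙ}),
z_{jₙ+1}, …, zₘ`. -/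
def braceSum {B : Type v} [AddCommMonoid B] (N : B → List B → B) :
    (List B → B) → List B → List B → B
  | F, [], zs => F zs
  | F, y :: ys, zs =>
      ∑ i ∈ Finset.range (zs.length + 1), ∑ j ∈ Finset.Icc i zs.length,
        braceSum N (fun t => F (zs.take i ++ N y ((zs.drop i).take (j - i)) :: t)) ys (zs.drop j)

/-- The axioms of a `GV_q` algebra: `brace x [y₁, …, yₙ] = M_{1n}(x; y₁, …, yₙ)` is linear in each
argument and satisfies the brace identities, and `mul` is an associative product which satisfies
the distributive relation with the braces. -/
structure IsGV {K : Type u} [Field K] (q : K) {B : Type v} [AddCommGroup B] [Module K B]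
    (mul : B →ₗ[K] B →ₗ[K] B) (brace : B → List B → B) : Prop where
  brace_add_left : ∀ x x' ys, brace (x + x') ys = brace x ys + brace x' ys
  brace_smul_left : ∀ (c : K) x ys, brace (c • x) ys = c • brace x ys
  brace_add : ∀ x l y y' r, brace x (l ++ (y + y') :: r) =
    brace x (l ++ y :: r) + brace x (l ++ y' :: r)
  brace_smul : ∀ x l (c : K) y r, brace x (l ++ (c • y) :: r) = c • brace x (l ++ y :: r)
  brace_nil : ∀ x, brace x [] = x
  brace_brace : ∀ x ys zs, brace (brace x ys) zs = braceSum brace (brace x) ys zs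
  mul_assoc : ∀ x y z, mul (mul x y) z = mul x (mul y z)
  brace_mul : ∀ x y zs, brace (mul x y) zs =
    ∑ i ∈ Finset.range (zs.length + 1), ∑ j ∈ Finset.Icc i zs.length, q ^ (j - i) •
      mul (((zs.drop i).take (j - i)).foldl (fun a z => mul a z) (brace x (zs.take i)))
        (brace y (zs.drop j))

/-- A `q`-Gerstenhaber–Voronov algebra. -/
structure GVAlg (K : Type u) [Field K] (q : K) where
  carrier : Type v
  [addCommGroup : AddCommGroup carrier]
  [module : Module K carrier]
  mul : carrier →ₗ[K] carrier →ₗ[K] carrier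
  brace : carrier → List carrier → carrier
  isGV : IsGV q mul brace

attribute [instance] GVAlg.addCommGroup GVAlg.module

instance {K : Type u} [Field K] {q : K} : CoeSort (GVAlg.{u, v} K q) (Type v) :=
  ⟨GVAlg.carrier⟩

/-- Morphisms of `GV_q` algebras. -/
@[ext]
structure GVAlg.Hom {K : Type u} [Field K] {q : K} (B : GVAlg.{u, v} K q)
    (B' : GVAlg.{u, v} K q) where
  toLin : B →ₗ[K] B'
  map_mul : ∀ x y, toLin (B.mul x y) = B'.mul (toLin x) (toLin y)
  map_brace : ∀ x ys, toLin (B.brace x ys) = B'.brace (toLin x) (ys.map toLin)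

instance {K : Type u} [Field K] {q : K} : Category (GVAlg.{u, v} K q) where
  Hom := GVAlg.Hom
  id B := ⟨LinearMap.id, by simp, by simp⟩
  comp f g := ⟨g.toLin ∘ₗ f.toLin, by simp [f.map_mul, g.map_mul],
    by simp [f.map_brace, g.map_brace]⟩

/-! ## `q`-tridendriform bialgebras -/

/-- A `q`-tridendriform bialgebra. -/
structure TriBialg (K : Type u) [Field K] (q : K) extends TriAlg.{u, v} K q where
  comul : (carrier × K) →ₗ[K] (carrier × K) ⊗[K] (carrier × K)
  isBialgebra : ops.IsBialgebra q comul

instance {K : Type u} [Field K] {q : K} : CoeSort (TriBialg.{u, v} K q) (Type v) :=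
  ⟨fun H => H.carrier⟩

/-- Morphisms of `q`-tridendriform bialgebras: linear maps that preserve the three operations and
whose unital extension `f₊ = f ⊕ id : H₊ → H'₊` preserves the coproduct. -/
@[ext]
structure TriBialg.Hom {K : Type u} [Field K] {q : K} (H : TriBialg.{u, v} K q)
    (H' : TriBialg.{u, v} K q) where
  toLin : H →ₗ[K] H'
  map_prec : ∀ x y, toLin (H.ops.prec x y) = H'.ops.prec (toLin x) (toLin y)
  map_dot : ∀ x y, toLin (H.ops.dot x y) = H'.ops.dot (toLin x) (toLin y)
  map_succ : ∀ x y, toLin (H.ops.succ x y) = H'.ops.succ (toLin x) (toLin y)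
  map_comul : ∀ x, H'.comul (toLin.prodMap LinearMap.id x) =
    TensorProduct.map (toLin.prodMap LinearMap.id) (toLin.prodMap LinearMap.id) (H.comul x)

instance {K : Type u} [Field K] {q : K} : Category (TriBialg.{u, v} K q) where
  Hom := TriBialg.Hom
  id H := ⟨LinearMap.id, by simp, by simp, by simp, by simp⟩
  comp f g := ⟨g.toLin ∘ₗ f.toLin, by simp [f.map_prec, g.map_prec],
    by simp [f.map_dot, g.map_dot], by simp [f.map_succ, g.map_succ], by
      intro x
      have h : (g.toLin ∘ₗ f.toLin).prodMap LinearMap.id =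
          g.toLin.prodMap (LinearMap.id : _ →ₗ[K] K) ∘ₗ f.toLin.prodMap LinearMap.id := by
        ext <;> simp
      rw [h, TensorProduct.map_comp, LinearMap.comp_apply, LinearMap.comp_apply, g.map_comul,
        f.map_comul]⟩

namespace TriBialg

variable {K : Type u} [Field K] {q : K}

/-- `x ↦ Δ(x) - 1 ⊗ x - x ⊗ 1` on `H`. -/
def redComul (H : TriBialg.{u, v} K q) : H →ₗ[K] (H × K) ⊗[K] (H × K) :=
  H.comul ∘ₗ TriOps.incl K H
    - TensorProduct.mk K (H × K) (H × K) (TriOps.one K H) ∘ₗ TriOps.incl K H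
    - (TensorProduct.mk K (H × K) (H × K)).flip (TriOps.one K H) ∘ₗ TriOps.incl K H

/-- The primitive elements: `Δ(x) = x ⊗ 1 + 1 ⊗ x`.  (Primitive elements of `H₊` lie in `H`.) -/
def prim (H : TriBialg.{u, v} K q) : Submodule K H := LinearMap.ker H.redComul

theorem mem_prim (H : TriBialg.{u, v} K q) (x : H) : x ∈ H.prim ↔
    H.comul (TriOps.incl K H x) = TriOps.incl K H x ⊗ₜ[K] TriOps.one K H +
      TriOps.one K H ⊗ₜ[K] TriOps.incl K H x := by
  rw [prim, LinearMap.mem_ker, redComul]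
  simp only [LinearMap.sub_apply, LinearMap.comp_apply, TensorProduct.mk_apply,
    LinearMap.flip_apply]
  rw [sub_sub, sub_eq_zero, add_comm]

/-- `H.filt n` is the `(n+1)`-st term of the primitive filtration: the first term is `Prim(H)`, and
`x` lies in the next term after `F` if its reduced coproduct lies in the subspace `F ⊗ F`. -/
def filt (H : TriBialg.{u, v} K q) : ℕ → Submodule K H
  | 0 => H.prim
  | n + 1 => (LinearMap.range (TensorProduct.map
      (TriOps.incl K H ∘ₗ (H.filt n).subtype)
      (TriOps.incl K H ∘ₗ (H.filt n).subtype))).comap H.redComul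

/-- `H` is connected if it is the union of its primitive filtration. -/
def Connected (H : TriBialg.{u, v} K q) : Prop := ∀ x : H, ∃ n, x ∈ H.filt n

/-- `Prim(H)` is stable under `·` and under the operations `M_{1n}` of `H`. -/
structure PrimClosed (H : TriBialg.{u, v} K q) : Prop where
  dot_mem : ∀ x ∈ H.prim, ∀ y ∈ H.prim, H.ops.dot x y ∈ H.prim
  brace_mem : ∀ x ∈ H.prim, ∀ ys : List H, (∀ y ∈ ys, y ∈ H.prim) → H.ops.brace q x ys ∈ H.prim

/-- The restriction of `·` to `Prim(H)`. -/
def primMul (H : TriBialg.{u, v} K q) (h : H.PrimClosed) : H.prim →ₗ[K] H.prim →ₗ[K] H.prim :=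
  LinearMap.mk₂ K (fun x y => ⟨H.ops.dot x y, h.dot_mem x x.2 y y.2⟩)
    (by intro x x' y; ext; simp) (by intro c x y; ext; simp)
    (by intro x y y'; ext; simp) (by intro c x y; ext; simp)

/-- The restriction of the operations `M_{1n}` to `Prim(H)`. -/
def primBrace (H : TriBialg.{u, v} K q) (h : H.PrimClosed) (x : H.prim) (ys : List H.prim) :
    H.prim :=
  ⟨H.ops.brace q x (ys.map Subtype.val), h.brace_mem x x.2 _ (by
    intro y hy
    obtain ⟨z, -, rfl⟩ := List.mem_map.1 hy
    exact z.2)⟩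

/-- `Prim(H)` is a `GV_q` algebra under the restrictions of the operations of `H`. -/
def PrimIsGV (H : TriBialg.{u, v} K q) : Prop :=
  ∃ h : H.PrimClosed, IsGV q (H.primMul h) (H.primBrace h)

/-- The `GV_q` algebra `Prim(H)`. -/
abbrev primGV (H : TriBialg.{u, v} K q) (h : H.PrimIsGV) : GVAlg.{u, v} K q where
  carrier := H.prim
  mul := H.primMul h.1
  brace := H.primBrace h.1
  isGV := h.2

end TriBialg

/-- The category of connected `q`-tridendriform bialgebras, full in all bialgebras. -/
structure ConnTriBialg (K : Type u) [Field K] (q : K) extends TriBialg.{u, v} K q where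
  connected : toTriBialg.Connected

instance {K : Type u} [Field K] {q : K} : Category (ConnTriBialg.{u, v} K q) where
  Hom H H' := H.toTriBialg ⟶ H'.toTriBialg
  id H := 𝟙 H.toTriBialg
  comp {H H' H''} f g := CategoryStruct.comp (X := H.toTriBialg) (Y := H'.toTriBialg)
    (Z := H''.toTriBialg) f g

section PrimFunctor

variable {K : Type u} [Field K] {q : K}

theorem TriBialg.Hom.map_prim {H H' : TriBialg.{u, v} K q} (f : TriBialg.Hom H H') (x : H)
    (hx : x ∈ H.prim) : f.toLin x ∈ H'.prim := by
  rw [TriBialg.mem_prim] at hx ⊢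
  have h := f.map_comul (TriOps.incl K H x)
  rw [hx] at h
  simpa [TriOps.incl, TriOps.one] using h

theorem TriBialg.Hom.map_brace {H H' : TriBialg.{u, v} K q} (f : TriBialg.Hom H H') (x : H)
    (ys : List H) : f.toLin (H.ops.brace q x ys) = H'.ops.brace q (f.toLin x) (ys.map f.toLin) := by
  set g : (H × K) →ₗ[K] (H' × K) := f.toLin.prodMap LinearMap.id with hg
  have hp : ∀ a b, g (H.ops.plusPrec a b) = H'.ops.plusPrec (g a) (g b) := by
    intro a b; simp [hg, TriOps.plusPrec, f.map_prec]
  have hs : ∀ a b, g (H.ops.plusTsucc q a b) = H'.ops.plusTsucc q (g a) (g b) := by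
    intro a b; simp [hg, TriOps.plusTsucc, TriOps.plusDot, TriOps.plusSucc, f.map_dot, f.map_succ]
  have hi : ∀ a, g (TriOps.incl K H a) = TriOps.incl K H' (f.toLin a) := by
    intro a; simp [hg, TriOps.incl]
  have h1 : g (TriOps.one K H) = TriOps.one K H' := by simp [hg, TriOps.one]
  have hop : ∀ l : List H, g (H.ops.omegaPrec l) = H'.ops.omegaPrec (l.map f.toLin) := by
    intro l
    induction l with
    | nil => exact h1
    | cons y l ih =>
      simp only [TriOps.omegaPrec, List.foldr_cons, List.map_cons] at ih ⊢
      rw [hp, hi, ih]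
  have hot' : ∀ (l : List H) (a : H × K),
      g (l.foldl (fun z y => H.ops.plusTsucc q z (TriOps.incl K H y)) a) =
        (l.map f.toLin).foldl (fun z y => H'.ops.plusTsucc q z (TriOps.incl K H' y)) (g a) := by
    intro l
    induction l with
    | nil => intro a; rfl
    | cons y l ih => intro a; simp only [List.foldl_cons, List.map_cons]; rw [ih, hs, hi]
  have hot : ∀ l : List H, g (H.ops.omegaTsucc q l) = H'.ops.omegaTsucc q (l.map f.toLin) := by
    intro l
    have h := hot' l (TriOps.one K H)
    rwa [h1] at h
  have hfst : ∀ a : H × K, f.toLin a.1 = (g a).1 := by intro a; simp [hg]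
  simp only [TriOps.brace, map_sum, map_smul, List.length_map, hfst, hp, hs, hi, hop, hot,
    List.map_take, List.map_drop]

/-- The functor `Prim` from connected `q`-tridendriform bialgebras to `GV_q` algebras. -/
def primFunctor (h : ∀ H : TriBialg.{u, v} K q, H.PrimIsGV) :
    ConnTriBialg.{u, v} K q ⥤ GVAlg.{u, v} K q where
  obj H := H.primGV (h H.toTriBialg)
  map {H H'} f := GVAlg.Hom.mk
    (LinearMap.restrict (p := H.prim) (q := H'.prim) (TriBialg.Hom.toLin f)
      (TriBialg.Hom.map_prim f))
    (by intro x y; exact Subtype.ext (TriBialg.Hom.map_dot f x.1 y.1))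
    (by
      intro x ys
      refine Subtype.ext ((TriBialg.Hom.map_brace f x.1 _).trans ?_)
      refine congrArg (H'.ops.brace q (TriBialg.Hom.toLin f x.1)) ?_
      have hl : ∀ l : List H.prim, (l.map Subtype.val).map (TriBialg.Hom.toLin f) =
          (l.map (LinearMap.restrict (p := H.prim) (q := H'.prim) (TriBialg.Hom.toLin f)
            (TriBialg.Hom.map_prim f))).map Subtype.val := by
        intro l
        rw [List.map_map, List.map_map]
        rfl
      exact hl ys)
  map_id _ := rfl
  map_comp _ _ := rfl

end PrimFunctor

/-! ## The free `q`-tridendriform algebra and the enveloping algebra -/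

/-- Formal expressions in three binary operations with leaves in `V`. -/
inductive TriTerm (V : Type v) : Type v
  | leaf : V → TriTerm V
  | prec : TriTerm V → TriTerm V → TriTerm V
  | dot : TriTerm V → TriTerm V → TriTerm V
  | succ : TriTerm V → TriTerm V → TriTerm V

/-- The bilinear extension of a binary operation on `X` to the vector space with basis `X`. -/
def freeOp (K : Type u) [Field K] {X : Type v} (m : X → X → X) :
    (X →₀ K) →ₗ[K] (X →₀ K) →ₗ[K] (X →₀ K) :=
  Finsupp.lift ((X →₀ K) →ₗ[K] (X →₀ K)) K X (fun s => Finsupp.lmapDomain K K (m s))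

/-- The three operations on the vector space spanned by the formal expressions. -/
def termOps (K : Type u) [Field K] (V : Type v) : TriOps K (TriTerm V →₀ K) where
  prec := freeOp K TriTerm.prec
  dot := freeOp K TriTerm.dot
  succ := freeOp K TriTerm.succ

/-- The relations of the free `q`-tridendriform algebra on `V`: linearity of `V → Tridend_q(V)`
and the seven tridendriform relations. -/
inductive TridendRel {K : Type u} [Field K] (q : K) (V : Type v) [AddCommGroup V] [Module K V] :
    (TriTerm V →₀ K) → Prop
  | add (v w : V) : TridendRel q V (Finsupp.single (.leaf (v + w)) 1 -
      (Finsupp.single (.leaf v) 1 + Finsupp.single (.leaf w) 1))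
  | smul (c : K) (v : V) : TridendRel q V (Finsupp.single (.leaf (c • v)) 1 -
      c • Finsupp.single (.leaf v) 1)
  | prec_prec (a b c) : TridendRel q V ((termOps K V).prec ((termOps K V).prec a b) c -
      (termOps K V).prec a ((termOps K V).prec b c + (termOps K V).succ b c +
        q • (termOps K V).dot b c))
  | succ_prec (a b c) : TridendRel q V ((termOps K V).prec ((termOps K V).succ a b) c -
      (termOps K V).succ a ((termOps K V).prec b c))
  | succ_succ (a b c) : TridendRel q V ((termOps K V).succ ((termOps K V).prec a b +
      (termOps K V).succ a b + q • (termOps K V).dot a b) c -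
      (termOps K V).succ a ((termOps K V).succ b c))
  | dot_dot (a b c) : TridendRel q V ((termOps K V).dot ((termOps K V).dot a b) c -
      (termOps K V).dot a ((termOps K V).dot b c))
  | succ_dot (a b c) : TridendRel q V ((termOps K V).dot ((termOps K V).succ a b) c -
      (termOps K V).succ a ((termOps K V).dot b c))
  | prec_dot (a b c) : TridendRel q V ((termOps K V).dot ((termOps K V).prec a b) c -
      (termOps K V).dot a ((termOps K V).succ b c))
  | dot_prec (a b c) : TridendRel q V ((termOps K V).prec ((termOps K V).dot a b) c -
      (termOps K V).dot a ((termOps K V).prec b c))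

section Free

variable {K : Type u} [Field K] (q : K) (V : Type v) [AddCommGroup V] [Module K V]

/-- The ideal generated by the relations of the free `q`-tridendriform algebra. -/
abbrev tridendIdeal : Submodule K (TriTerm V →₀ K) :=
  (termOps K V).idealSpan {a | TridendRel q V a}

theorem isTridend_tridendFree : ((termOps K V).quot (tridendIdeal q V)
    (TriOps.isIdeal_idealSpan _ _)).IsTridend q := by
  have key : ∀ {a b : TriTerm V →₀ K}, TridendRel q V (a - b) →
      (tridendIdeal q V).mkQ a = (tridendIdeal q V).mkQ b := fun h =>
    (Submodule.Quotient.eq _).2 (TriOps.subset_idealSpan _ _ h)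
  constructor <;> intro a b c <;>
    obtain ⟨a, rfl⟩ := (tridendIdeal q V).mkQ_surjective a <;>
    obtain ⟨b, rfl⟩ := (tridendIdeal q V).mkQ_surjective b <;>
    obtain ⟨c, rfl⟩ := (tridendIdeal q V).mkQ_surjective c <;>
    simp only [TriOps.quot_prec, TriOps.quot_dot, TriOps.quot_succ,
      ← map_smul (tridendIdeal q V).mkQ, ← map_add (tridendIdeal q V).mkQ]
  · exact key (.prec_prec a b c)
  · exact key (.succ_prec a b c)
  · exact key (.succ_succ a b c)
  · exact key (.dot_dot a b c)
  · exact key (.succ_dot a b c)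
  · exact key (.prec_dot a b c)
  · exact key (.dot_prec a b c)

/-- The free `q`-tridendriform algebra `Tridend_q(V)` on a vector space `V`. -/
abbrev tridendFree : TriAlg.{u, max u v} K q where
  carrier := (TriTerm V →₀ K) ⧸ tridendIdeal q V
  ops := (termOps K V).quot (tridendIdeal q V) (TriOps.isIdeal_idealSpan _ _)
  isTridend := isTridend_tridendFree q V

/-- The inclusion of generators `V → Tridend_q(V)`. -/
def tridendOf : V →ₗ[K] tridendFree q V where
  toFun v := (tridendIdeal q V).mkQ (Finsupp.single (.leaf v) 1)
  map_add' v w := by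
    rw [← map_add]
    exact (Submodule.Quotient.eq _).2 (TriOps.subset_idealSpan _ _ (TridendRel.add v w))
  map_smul' c v := by
    rw [RingHom.id_apply, ← map_smul]
    exact (Submodule.Quotient.eq _).2 (TriOps.subset_idealSpan _ _ (TridendRel.smul c v))

end Free

section Enveloping

variable {K : Type u} [Field K] {q : K}

/-- The relations of the enveloping algebra of a `GV_q` algebra `B`: the braces and the product of
`B` are identified with those of the free `q`-tridendriform algebra on `B`. -/
inductive EnvRel (B : GVAlg.{u, v} K q) : tridendFree q B → Prop
  | brace (x : B) (ys : List B) : EnvRel B (tridendOf q B (B.brace x ys) -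
      (tridendFree q B).ops.brace q (tridendOf q B x) (ys.map (tridendOf q B)))
  | mul (x y : B) : EnvRel B (tridendOf q B (B.mul x y) -
      (tridendFree q B).ops.dot (tridendOf q B x) (tridendOf q B y))

/-- The tridendriform ideal of `Tridend_q(B)` generated by the relations `EnvRel`. -/
abbrev envIdeal (B : GVAlg.{u, v} K q) : Submodule K (tridendFree q B) :=
  (tridendFree q B).ops.idealSpan {a | EnvRel B a}

/-- The enveloping `q`-tridendriform algebra `U_qGV(B)`. -/
abbrev env (B : GVAlg.{u, v} K q) : TriAlg.{u, max u v} K q where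
  carrier := tridendFree q B ⧸ envIdeal B
  ops := (tridendFree q B).ops.quot (envIdeal B) (TriOps.isIdeal_idealSpan _ _)
  isTridend := (tridendFree q B).isTridend.quot _ _

/-- The canonical map `B → U_qGV(B)`. -/
def envOf (B : GVAlg.{u, v} K q) : B →ₗ[K] env B := (envIdeal B).mkQ ∘ₗ tridendOf q B

/-- `Δ` is a coproduct making `U_qGV(B)` a `q`-tridendriform bialgebra in which the elements of
(the image of) `B` are primitive. -/
structure IsEnvCoproduct (B : GVAlg.{u, v} K q)
    (Δ : (env B × K) →ₗ[K] (env B × K) ⊗[K] (env B × K)) : Prop where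
  isBialgebra : (env B).ops.IsBialgebra q Δ
  primitive : ∀ b : B, Δ (TriOps.incl K (env B) (envOf B b)) =
    TriOps.incl K (env B) (envOf B b) ⊗ₜ[K] TriOps.one K (env B) +
      TriOps.one K (env B) ⊗ₜ[K] TriOps.incl K (env B) (envOf B b)

/-- The `q`-tridendriform bialgebra `(U_qGV(B), Δ)`. -/
abbrev envBialg (B : GVAlg.{u, v} K q) (Δ : (env B × K) →ₗ[K] (env B × K) ⊗[K] (env B × K))
    (h : IsEnvCoproduct B Δ) : TriBialg.{u, max u v} K q where
  toTriAlg := env B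
  comul := Δ
  isBialgebra := h.isBialgebra

end Enveloping

end

/-!
The proof shows that both the enveloping algebra of a `GV_q` algebra and a connected
`q`-tridendriform bialgebra look like the space of words with the deconcatenation coproduct.

*Words.* Let `B` be a `GV_q` algebra and `T` the tensor algebra of `B`, with the deconcatenation
coproduct `decon`. The braces define a product `star` on `T`: a word `y₁ ⋯ yₙ` acts on `v` by
inserting braces `M(yₖ; -)` on consecutive subwords of `v`. It splits according to the origin of
the last letter into `prec` (a brace of the left factor) and `tsucc` (a letter of the right
factor); a third operation `dot` is given by `r · (v z) = (r ≺ v + q r · v) · z`, where the letter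
`z` is multiplied to the last letter of a word by the product of `B`. The brace identities say that
`star` is associative, and together with the distributive relation they give the tridendriform
axioms for `prec`, `dot` and `succ = tsucc - q dot` on words of positive length
(`GVAlg.isTridend_posOps`). Deconcatenation is compatible with these operations (`Words.decon_prec`,
`Words.decon_tsucc`, `Words.decon_dot`).

*Words in a tridendriform algebra.* For a linear map `i` from `B` to a tridendriform algebra `A`,
`TriOps.wordMap` is the map `T → A₊` given by `y₁ ⋯ yₙ ↦ ((i y₁ ≻~ i y₂) ≻~ ⋯) ≻~ i yₙ`. It is
invertible for convolution, its inverse being `y₁ ⋯ yₙ ↦ (-1)ⁿ i y₁ ≺ (⋯ ≺ i yₙ)`, so that the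
definition of the braces of `A` amounts to the implicit formula
`x ≺ ω(v) = ∑ ω(v₁) ≻~ M(x; v₂)` for `ω = wordMap` (`TriOps.plusPrec_wordMap`). As convolution
with `ω` is injective, all identities between braces can be checked after convolution with `ω`,
where they are consequences of the tridendriform axioms; in this way `A` is a `GV_q` algebra
(`TriOps.isGV`), and in a bialgebra braces of primitive elements are primitive
(`TriOps.comul_braceMap`). If `i` preserves braces and products, then `ω` carries the operations
on words to those of `A`, and if `i` takes primitive values in a bialgebra, then `ω` is a morphism
of coalgebras (`TriOps.comul_wordMap`).

*The enveloping algebra.* For `A = U_qGV(B)`, the image of `ω` is closed under the operations and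
contains the generators, so `ω` is surjective; it is injective because the universal property
gives a morphism from `U_qGV(B)` back to the words (`env_wordMap_surjective`,
`env_wordMap_injective`). Deconcatenation is thus transported to the
unique coproduct on `U_qGV(B)` in which `B` is primitive. It is connected, since a word of length
`n + 1` lies in the term of index `n` of the primitive filtration, and its primitive elements are
the letters.

*Connected bialgebras.* For a connected bialgebra `H`, the morphism `U_qGV(Prim(H)) → H` is
injective because it is so on primitive elements (`TriBialg.injective_of_prim`). It is surjective
by induction on the filtration: the reduced coproduct of `x` is the image of a tensor `s` of words,
coassociativity makes `s` a cocycle, cocycles of the word coalgebra are reduced coproducts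
(`Words.exists_decon_eq`), and so `x` differs from the image of some word by a primitive element
(`TriBialg.wordMap_surjective`). Both canonical maps are natural, which gives the equivalence of
categories.
-/

noncomputable section

/-! ### Words: the tensor algebra with deconcatenation -/

namespace Words

open TensorAlgebra

variable {K : Type*} {B : Type*} {X Y Z : Type*} {X' Y' Z' : Type*} [Field K]
  [AddCommGroup B] [Module K B] [AddCommGroup X] [Module K X] [AddCommGroup Y] [Module K Y]
  [AddCommGroup Z] [Module K Z] [AddCommGroup X'] [Module K X'] [AddCommGroup Y'] [Module K Y']
  [AddCommGroup Z'] [Module K Z']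

/-- Induction on the length of a word, adding letters on the right. -/
theorem snoc_induction {p : TensorAlgebra K B → Prop} (add : ∀ a b, p a → p b → p (a + b))
    (smul : ∀ (c : K) a, p a → p (c • a)) (one : p 1) (snoc : ∀ u y, p u → p (u * ι K y))
    (t : TensorAlgebra K B) : p t := by
  suffices h : ∀ u, p u → p (u * t) by simpa using h 1 one
  induction t using TensorAlgebra.induction with
  | algebraMap r =>
    intro u hu
    rw [← Algebra.commutes, ← Algebra.smul_def]
    exact smul r u hu
  | ι y => exact fun u hu => snoc u y hu
  | mul a b ha hb => exact fun u hu => by rw [← mul_assoc]; exact hb _ (ha u hu)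
  | add a b ha hb => exact fun u hu => by rw [mul_add]; exact add _ _ (ha u hu) (hb u hu)

/-- Induction on the length of a word, adding letters on the left. -/
theorem cons_induction {p : TensorAlgebra K B → Prop} (add : ∀ a b, p a → p b → p (a + b))
    (smul : ∀ (c : K) a, p a → p (c • a)) (one : p 1) (cons : ∀ y u, p u → p (ι K y * u))
    (t : TensorAlgebra K B) : p t := by
  suffices h : ∀ u, p u → p (t * u) by simpa using h 1 one
  induction t using TensorAlgebra.induction with
  | algebraMap r =>
    intro u hu
    rw [← Algebra.smul_def]
    exact smul r u hu
  | ι y => exact fun u hu => cons y u hu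
  | mul a b ha hb => exact fun u hu => by rw [mul_assoc]; exact ha _ (hb u hu)
  | add a b ha hb => exact fun u hu => by rw [add_mul]; exact add _ _ (ha u hu) (hb u hu)

theorem ext_snoc {f g : TensorAlgebra K B →ₗ[K] X} (one : f 1 = g 1)
    (snoc : ∀ u y, f u = g u → f (u * ι K y) = g (u * ι K y)) : f = g := by
  ext t
  induction t using snoc_induction with
  | add a b ha hb => simp [ha, hb]
  | smul c a ha => simp [ha]
  | one => exact one
  | snoc u y h => exact snoc u y h

/-- The word with the letters of a list. -/
def word (l : List B) : TensorAlgebra K B := (l.map (ι K)).prod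

@[simp] theorem word_nil : word (K := K) ([] : List B) = 1 := rfl

@[simp] theorem word_cons (y : B) (l : List B) : word (K := K) (y :: l) = ι K y * word l := by
  simp [word]

@[simp] theorem word_append (l l' : List B) :
    word (K := K) (l ++ l') = word l * word l' := by
  simp [word]

/-- The words span the tensor algebra. -/
theorem word_induction {p : TensorAlgebra K B → Prop} (add : ∀ a b, p a → p b → p (a + b))
    (smul : ∀ (c : K) a, p a → p (c • a)) (word : ∀ l, p (word l)) (t : TensorAlgebra K B) :
    p t := by
  have h : t ∈ Submodule.span K (Set.range (Words.word (K := K) (B := B))) := by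
    induction t using snoc_induction with
    | add a b ha hb => exact add_mem ha hb
    | smul c a ha => exact Submodule.smul_mem _ _ ha
    | one => exact Submodule.subset_span ⟨[], rfl⟩
    | snoc u y h =>
      induction h using Submodule.span_induction with
      | mem x hx =>
        obtain ⟨l, rfl⟩ := hx
        exact Submodule.subset_span ⟨l ++ [y], by simp⟩
      | zero => simp
      | add a b _ _ ha hb => rw [add_mul]; exact add_mem ha hb
      | smul c a _ ha => rw [smul_mul_assoc]; exact Submodule.smul_mem _ _ ha
  induction h using Submodule.span_induction with
  | mem x hx => obtain ⟨l, rfl⟩ := hx; exact word l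
  | zero => simpa using smul 0 _ (word [])
  | add a b _ _ ha hb => exact add _ _ ha hb
  | smul c a _ ha => exact smul _ _ ha

theorem ext_word {f g : TensorAlgebra K B →ₗ[K] X} (h : ∀ l, f (word l) = g (word l)) :
    f = g := by
  ext t
  induction t using word_induction with
  | add a b ha hb => simp [ha, hb]
  | smul c a ha => simp [ha]
  | word l => exact h l

/-! #### Linear maps defined by recursion -/

/-- The linear map on words given by the recursion `1 ↦ x₀`, `u y ↦ f (fold u) y`. Letters are
read from the left, so this is the action of the words on `X` through the opposite of the
endomorphism algebra. -/
def fold (x₀ : X) (f : X →ₗ[K] B →ₗ[K] X) : TensorAlgebra K B →ₗ[K] X :=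
  LinearMap.applyₗ (R := K) x₀ ∘ₗ (MulOpposite.opLinearEquiv K).symm.toLinearMap ∘ₗ
    (TensorAlgebra.lift K ((MulOpposite.opLinearEquiv K).toLinearMap ∘ₗ f.flip :
      B →ₗ[K] (Module.End K X)ᵐᵒᵖ)).toLinearMap

@[simp] theorem fold_one (x₀ : X) (f : X →ₗ[K] B →ₗ[K] X) : fold x₀ f 1 = x₀ := by
  simp [fold]

@[simp] theorem fold_snoc (x₀ : X) (f : X →ₗ[K] B →ₗ[K] X) (u : TensorAlgebra K B) (y : B) :
    fold x₀ f (u * ι K y) = f (fold x₀ f u) y := by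
  simp [fold]

/-- A recursion that carries along the word itself. -/
theorem fst_fold (x₀ : X) (f : (TensorAlgebra K B × X) →ₗ[K] B →ₗ[K] (TensorAlgebra K B × X))
    (hf : ∀ p y, (f p y).1 = p.1 * ι K y) (t : TensorAlgebra K B) :
    (fold (1, x₀) f t).1 = t := by
  have h : LinearMap.fst K _ _ ∘ₗ fold (1, x₀) f = LinearMap.id := by
    apply ext_snoc
    · simp
    · intro u y ih
      simp only [LinearMap.comp_apply, LinearMap.fst_apply, LinearMap.id_apply] at ih
      simp [hf, ih]
  exact LinearMap.congr_fun h t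

/-- The linear map on words given by the recursion `1 ↦ x₀`, `y u ↦ f y (foldr u)`. -/
def foldr (x₀ : X) (f : B →ₗ[K] X →ₗ[K] X) : TensorAlgebra K B →ₗ[K] X :=
  LinearMap.applyₗ (R := K) x₀ ∘ₗ
    (TensorAlgebra.lift K (f : B →ₗ[K] Module.End K X)).toLinearMap

@[simp] theorem foldr_one (x₀ : X) (f : B →ₗ[K] X →ₗ[K] X) : foldr x₀ f 1 = x₀ := by
  simp [foldr]

@[simp] theorem foldr_cons (x₀ : X) (f : B →ₗ[K] X →ₗ[K] X) (y : B) (u : TensorAlgebra K B) :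
    foldr x₀ f (ι K y * u) = f y (foldr x₀ f u) := by
  simp [foldr]

/-- The functions of lists that are linear in every entry. -/
def listMultilinear (K B X : Type*) [Field K] [AddCommGroup B] [Module K B] [AddCommGroup X]
    [Module K X] : Submodule K (List B → X) where
  carrier := {F | (∀ l y y' r, F (l ++ (y + y') :: r) = F (l ++ y :: r) + F (l ++ y' :: r)) ∧
    ∀ l (c : K) y r, F (l ++ (c • y) :: r) = c • F (l ++ y :: r)}
  add_mem' := by
    intro F G hF hG
    refine ⟨fun l y y' r => ?_, fun l c y r => ?_⟩
    · simp only [Pi.add_apply, hF.1, hG.1]; abel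
    · simp only [Pi.add_apply, hF.2, hG.2, smul_add]
  zero_mem' := by simp
  smul_mem' := by
    intro c F hF
    refine ⟨fun l y y' r => ?_, fun l d y r => ?_⟩
    · simp only [Pi.smul_apply, hF.1, smul_add]
    · simp only [Pi.smul_apply, hF.2, smul_comm c]

/-- Evaluating with an additional last entry. -/
def listSnoc : listMultilinear K B X →ₗ[K] B →ₗ[K] listMultilinear K B X :=
  LinearMap.mk₂ K (fun F y => ⟨fun l => F.1 (l ++ [y]), by
      refine ⟨fun l z z' r => ?_, fun l c z r => ?_⟩
      · simpa using F.2.1 l z z' (r ++ [y])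
      · simpa using F.2.2 l c z (r ++ [y])⟩)
    (by intro F G y; rfl) (by intro c F y; rfl)
    (by intro F y y'; ext l; exact F.2.1 l y y' [])
    (by intro c F y; ext l; exact F.2.2 l c y [])

/-- The linear map on words defined by a function of lists that is linear in every entry. The words
act on such functions by appending letters to the argument. -/
def ofList (F : List B → X) (hF : F ∈ listMultilinear K B X) : TensorAlgebra K B →ₗ[K] X :=
  (LinearMap.proj [] ∘ₗ (listMultilinear K B X).subtype) ∘ₗ
    LinearMap.applyₗ (R := K) (⟨F, hF⟩ : listMultilinear K B X) ∘ₗ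
      (TensorAlgebra.lift K
        (listSnoc.flip : B →ₗ[K] Module.End K (listMultilinear K B X))).toLinearMap

@[simp] theorem ofList_word (F : List B → X) (hF : F ∈ listMultilinear K B X) (l : List B) :
    ofList F hF (word l) = F l := by
  have h : ∀ (l : List B) (G : listMultilinear K B X) (l' : List B),
      ((TensorAlgebra.lift K
        (listSnoc.flip : B →ₗ[K] Module.End K (listMultilinear K B X)) (word l)) G).1 l' =
        G.1 (l' ++ l) := by
    intro l
    induction l with
    | nil => intro G l'; simp
    | cons y l ih =>
      intro G l'
      rw [word_cons, map_mul, TensorAlgebra.lift_ι_apply, Module.End.mul_apply]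
      refine (ih G (l' ++ [y])).trans ?_
      simp
  exact (h l ⟨F, hF⟩ []).trans (by simp)

/-- Splitting off the last letter: `1 ↦ 0`, `u y ↦ u ⊗ y`. -/
def last : TensorAlgebra K B →ₗ[K] TensorAlgebra K B ⊗[K] B :=
  LinearMap.snd K _ _ ∘ₗ fold (X := TensorAlgebra K B × (TensorAlgebra K B ⊗[K] B)) (1, 0)
    (LinearMap.mk₂ K (fun p y => (p.1 * ι K y, p.1 ⊗ₜ y))
      (by intro p p' y; ext <;> simp [add_mul, TensorProduct.add_tmul])
      (by intro c p y; ext <;> simp [TensorProduct.smul_tmul'])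
      (by intro p y y'; ext <;> simp [mul_add, TensorProduct.tmul_add])
      (by intro c p y; ext <;> simp))

@[simp] theorem last_one : last (1 : TensorAlgebra K B) = 0 := by
  simp [last]

@[simp] theorem last_snoc (u : TensorAlgebra K B) (y : B) : last (u * ι K y) = u ⊗ₜ y := by
  simp only [last, LinearMap.comp_apply, fold_snoc, LinearMap.snd_apply, LinearMap.mk₂_apply]
  congr 1
  exact fst_fold _ _ (by intro p y; rfl) u

/-- The linear map on words given by `1 ↦ 0`, `u y ↦ f u y`. -/
def onLast (f : TensorAlgebra K B →ₗ[K] B →ₗ[K] X) : TensorAlgebra K B →ₗ[K] X :=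
  TensorProduct.lift f ∘ₗ last

@[simp] theorem onLast_one (f : TensorAlgebra K B →ₗ[K] B →ₗ[K] X) : onLast f 1 = 0 := by
  simp [onLast]

@[simp] theorem onLast_snoc (f : TensorAlgebra K B →ₗ[K] B →ₗ[K] X) (u : TensorAlgebra K B)
    (y : B) : onLast f (u * ι K y) = f u y := by
  simp [onLast]

/-- The bilinear map `(u, y) ↦ u y`. -/
def snoc : TensorAlgebra K B →ₗ[K] B →ₗ[K] TensorAlgebra K B :=
  (LinearMap.mul K (TensorAlgebra K B)).compl₂ (ι K)

@[simp] theorem snoc_apply (u : TensorAlgebra K B) (y : B) : snoc u y = u * ι K y := rfl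

/-- The counit: the coefficient of the empty word. -/
def eps : TensorAlgebra K B →ₗ[K] K := (TensorAlgebra.algebraMapInv).toLinearMap

@[simp] theorem eps_one : eps (1 : TensorAlgebra K B) = 1 := by simp [eps]

@[simp] theorem eps_snoc (u : TensorAlgebra K B) (y : B) : eps (u * ι K y) = 0 := by
  simp [eps, TensorAlgebra.algebraMapInv]

@[simp] theorem eps_cons (u : TensorAlgebra K B) (y : B) : eps (ι K y * u) = 0 := by
  simp [eps, TensorAlgebra.algebraMapInv]

theorem onLast_snoc_eq (t : TensorAlgebra K B) : onLast snoc t = t - eps t • 1 := by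
  induction t using snoc_induction with
  | add a b ha hb => rw [map_add, ha, hb, map_add, add_smul]; abel
  | smul c a ha => rw [map_smul, ha, map_smul, smul_sub, smul_assoc]
  | one => simp
  | snoc u y _ => simp

/-! #### Deconcatenation -/

/-- The deconcatenation coproduct on words. -/
def decon : TensorAlgebra K B →ₗ[K] TensorAlgebra K B ⊗[K] TensorAlgebra K B :=
  LinearMap.snd K _ _ ∘ₗ
    fold (X := TensorAlgebra K B × (TensorAlgebra K B ⊗[K] TensorAlgebra K B)) (1, 1 ⊗ₜ 1)
    (LinearMap.mk₂ K (fun p y => (p.1 * ι K y, (p.1 * ι K y) ⊗ₜ 1 +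
        (LinearMap.mulRight K (ι K y)).lTensor _ p.2))
      (by intro p p' y; ext <;> simp [add_mul, TensorProduct.add_tmul]; abel)
      (by intro c p y; ext <;> simp [TensorProduct.smul_tmul'])
      (by
        intro p y y'
        have : LinearMap.mulRight K (ι K (y + y')) = LinearMap.mulRight K (ι K y) +
          LinearMap.mulRight K (ι K y') := by ext; simp [mul_add]
        rw [this]
        ext <;> simp [mul_add, TensorProduct.add_tmul]
        abel)
      (by
        intro c p y
        have : LinearMap.mulRight K (ι K (c • y)) = c • LinearMap.mulRight K (ι K y) := by
          ext; simp
        rw [this]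
        ext <;> simp [TensorProduct.smul_tmul']))

@[simp] theorem decon_one : decon (1 : TensorAlgebra K B) = 1 ⊗ₜ 1 := by
  simp [decon]

theorem decon_snoc (u : TensorAlgebra K B) (y : B) : decon (u * ι K y) =
    (u * ι K y) ⊗ₜ 1 + (LinearMap.mulRight K (ι K y)).lTensor _ (decon u) := by
  simp only [decon, LinearMap.comp_apply, fold_snoc, LinearMap.snd_apply, LinearMap.mk₂_apply]
  congr 2
  exact congrArg (· * ι K y) (fst_fold _ _ (by intro p y; rfl) u)

theorem decon_cons (u : TensorAlgebra K B) (y : B) : decon (ι K y * u) =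
    1 ⊗ₜ (ι K y * u) + (LinearMap.mulLeft K (ι K y)).rTensor _ (decon u) := by
  induction u using snoc_induction with
  | add a b ha hb => rw [mul_add, map_add, ha, hb]; simp [TensorProduct.tmul_add]; abel
  | smul c a ha => rw [mul_smul_comm, map_smul, ha]; simp
  | one =>
    have := decon_snoc (K := K) 1 y
    rw [one_mul] at this
    rw [mul_one, this]
    simp [add_comm]
  | snoc u z ih =>
    rw [← mul_assoc, decon_snoc, ih, decon_snoc]
    have h : ∀ X : TensorAlgebra K B ⊗[K] TensorAlgebra K B,
        (LinearMap.mulRight K (ι K z)).lTensor _ ((LinearMap.mulLeft K (ι K y)).rTensor _ X) =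
        (LinearMap.mulLeft K (ι K y)).rTensor _ ((LinearMap.mulRight K (ι K z)).lTensor _ X) := by
      intro X
      rw [← LinearMap.comp_apply, ← LinearMap.comp_apply, LinearMap.lTensor_comp_rTensor,
        LinearMap.rTensor_comp_lTensor]
    simp only [map_add, LinearMap.lTensor_tmul, LinearMap.rTensor_tmul, LinearMap.mulRight_apply,
      LinearMap.mulLeft_apply, h, mul_assoc]
    abel

theorem decon_word (l : List B) : decon (word (K := K) l) =
    ∑ i ∈ Finset.range (l.length + 1), word (l.take i) ⊗ₜ word (l.drop i) := by
  induction l with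
  | nil => simp
  | cons y l ih =>
    rw [word_cons, decon_cons, ih, List.length_cons, Finset.sum_range_succ' _ (l.length + 1),
      map_sum, add_comm]
    simp

theorem decon_coassoc (t : TensorAlgebra K B) :
    TensorProduct.assoc K _ _ _ (decon.rTensor _ (decon t)) = decon.lTensor _ (decon t) := by
  have key : ∀ (y : B) (X : TensorAlgebra K B ⊗[K] TensorAlgebra K B),
      decon.rTensor _ ((LinearMap.mulRight K (ι K y)).lTensor (TensorAlgebra K B) X) =
        (LinearMap.mulRight K (ι K y)).lTensor _ (decon.rTensor _ X) := by
    intro y X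
    simp only [← LinearMap.comp_apply, LinearMap.lTensor_comp_rTensor,
      LinearMap.rTensor_comp_lTensor]
  have key2 : ∀ (y : B) (X : (TensorAlgebra K B ⊗[K] TensorAlgebra K B) ⊗[K] TensorAlgebra K B),
      TensorProduct.assoc K _ _ _ ((LinearMap.mulRight K (ι K y)).lTensor _ X) =
        ((LinearMap.mulRight K (ι K y)).lTensor _).lTensor _ (TensorProduct.assoc K _ _ _ X) := by
    intro y X
    induction X with
    | zero => simp
    | add a b ha hb => simp [ha, hb]
    | tmul a b => induction a with
      | zero => simp
      | add a b ha hb => simp only [TensorProduct.add_tmul, map_add, ha, hb]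
      | tmul a c => simp
  induction t using snoc_induction with
  | add a b ha hb => simp only [map_add, ha, hb]
  | smul c a ha => simp only [map_smul, ha]
  | one => simp
  | snoc u y ih =>
    rw [decon_snoc, map_add, map_add, LinearMap.rTensor_tmul, decon_snoc, map_add, key, key2, ih,
      LinearMap.lTensor_tmul, decon_one, TensorProduct.add_tmul, map_add]
    have h : ∀ X : TensorAlgebra K B ⊗[K] TensorAlgebra K B,
        TensorProduct.assoc K _ _ _ (((LinearMap.mulRight K (ι K y)).lTensor _ X) ⊗ₜ[K]
            (1 : TensorAlgebra K B)) +
          ((LinearMap.mulRight K (ι K y)).lTensor _).lTensor _ (decon.lTensor _ X) =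
          decon.lTensor _ ((LinearMap.mulRight K (ι K y)).lTensor _ X) := by
      intro X
      induction X with
      | zero => simp
      | add a b ha hb =>
        simp only [map_add, TensorProduct.add_tmul, ← ha, ← hb]; abel
      | tmul a b => simp [decon_snoc, TensorProduct.tmul_add]
    rw [add_assoc, h]
    simp

theorem decon_counit_left (t : TensorAlgebra K B) : eps.rTensor _ (decon t) = 1 ⊗ₜ t := by
  induction t using snoc_induction with
  | add a b ha hb => simp only [map_add, ha, hb, TensorProduct.tmul_add]
  | smul c a ha => simp only [map_smul, ha, TensorProduct.tmul_smul]
  | one => simp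
  | snoc u y ih =>
    rw [decon_snoc, map_add, LinearMap.rTensor_tmul, eps_snoc, TensorProduct.zero_tmul, zero_add,
      ← LinearMap.comp_apply, LinearMap.rTensor_comp_lTensor, ← LinearMap.lTensor_comp_rTensor,
      LinearMap.comp_apply, ih]
    simp

theorem decon_counit_right (t : TensorAlgebra K B) : eps.lTensor _ (decon t) = t ⊗ₜ 1 := by
  have h : ∀ y : B, eps ∘ₗ LinearMap.mulRight K (ι K y) = 0 := by
    intro y; ext; simp
  induction t using snoc_induction with
  | add a b ha hb => simp only [map_add, ha, hb, TensorProduct.add_tmul]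
  | smul c a ha => simp only [map_smul, ha, TensorProduct.smul_tmul']
  | one => simp
  | snoc u y ih =>
    rw [decon_snoc, map_add, ← LinearMap.comp_apply, ← LinearMap.comp_apply,
      ← LinearMap.lTensor_comp, h]
    simp

/-! #### Convolution -/

/-- The convolution `t ↦ ∑ β (f t₁) (g t₂)` along a bilinear map `β`, where `∑ t₁ ⊗ t₂` is the
deconcatenation of `t`. -/
def conv (β : X →ₗ[K] Y →ₗ[K] Z) (f : TensorAlgebra K B →ₗ[K] X) (g : TensorAlgebra K B →ₗ[K] Y) :
    TensorAlgebra K B →ₗ[K] Z :=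
  TensorProduct.lift β ∘ₗ TensorProduct.map f g ∘ₗ decon

theorem conv_apply (β : X →ₗ[K] Y →ₗ[K] Z) (f : TensorAlgebra K B →ₗ[K] X)
    (g : TensorAlgebra K B →ₗ[K] Y) (t : TensorAlgebra K B) :
    conv β f g t = TensorProduct.lift β (TensorProduct.map f g (decon t)) := rfl

@[simp] theorem conv_one (β : X →ₗ[K] Y →ₗ[K] Z) (f : TensorAlgebra K B →ₗ[K] X)
    (g : TensorAlgebra K B →ₗ[K] Y) : conv β f g 1 = β (f 1) (g 1) := by
  simp [conv]

theorem conv_snoc (β : X →ₗ[K] Y →ₗ[K] Z) (f : TensorAlgebra K B →ₗ[K] X)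
    (g : TensorAlgebra K B →ₗ[K] Y) (u : TensorAlgebra K B) (y : B) :
    conv β f g (u * ι K y) = β (f (u * ι K y)) (g 1) +
      conv β f (g ∘ₗ LinearMap.mulRight K (ι K y)) u := by
  rw [conv_apply, decon_snoc, map_add, map_add, conv_apply,
    ← LinearMap.comp_apply (TensorProduct.map f g), LinearMap.map_comp_lTensor]
  simp

theorem conv_cons (β : X →ₗ[K] Y →ₗ[K] Z) (f : TensorAlgebra K B →ₗ[K] X)
    (g : TensorAlgebra K B →ₗ[K] Y) (u : TensorAlgebra K B) (y : B) :
    conv β f g (ι K y * u) = β (f 1) (g (ι K y * u)) +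
      conv β (f ∘ₗ LinearMap.mulLeft K (ι K y)) g u := by
  rw [conv_apply, decon_cons, map_add, map_add, conv_apply,
    ← LinearMap.comp_apply (TensorProduct.map f g), LinearMap.map_comp_rTensor]
  simp

theorem conv_word (β : X →ₗ[K] Y →ₗ[K] Z) (f : TensorAlgebra K B →ₗ[K] X)
    (g : TensorAlgebra K B →ₗ[K] Y) (l : List B) :
    conv β f g (word l) =
      ∑ i ∈ Finset.range (l.length + 1), β (f (word (l.take i))) (g (word (l.drop i))) := by
  simp [conv_apply, decon_word]

theorem conv_add_left (β : X →ₗ[K] Y →ₗ[K] Z) (f f' : TensorAlgebra K B →ₗ[K] X)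
    (g : TensorAlgebra K B →ₗ[K] Y) : conv β (f + f') g = conv β f g + conv β f' g := by
  ext t; simp [conv_apply, TensorProduct.map_add_left]

theorem conv_smul_left (β : X →ₗ[K] Y →ₗ[K] Z) (c : K) (f : TensorAlgebra K B →ₗ[K] X)
    (g : TensorAlgebra K B →ₗ[K] Y) : conv β (c • f) g = c • conv β f g := by
  ext t; simp [conv_apply, TensorProduct.map_smul_left]

theorem conv_add_right (β : X →ₗ[K] Y →ₗ[K] Z) (f : TensorAlgebra K B →ₗ[K] X)
    (g g' : TensorAlgebra K B →ₗ[K] Y) : conv β f (g + g') = conv β f g + conv β f g' := by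
  ext t; simp [conv_apply, TensorProduct.map_add_right]

theorem conv_smul_right (β : X →ₗ[K] Y →ₗ[K] Z) (c : K) (f : TensorAlgebra K B →ₗ[K] X)
    (g : TensorAlgebra K B →ₗ[K] Y) : conv β f (c • g) = c • conv β f g := by
  ext t; simp [conv_apply, TensorProduct.map_smul_right]

/-- The convolution as a bilinear map of its two arguments. -/
def convHom (β : X →ₗ[K] Y →ₗ[K] Z) : (TensorAlgebra K B →ₗ[K] X) →ₗ[K]
    (TensorAlgebra K B →ₗ[K] Y) →ₗ[K] (TensorAlgebra K B →ₗ[K] Z) :=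
  LinearMap.mk₂ K (conv β) (conv_add_left β) (conv_smul_left β)
    (conv_add_right β) (fun c f g => conv_smul_right β c f g)

@[simp] theorem convHom_apply (β : X →ₗ[K] Y →ₗ[K] Z) (f : TensorAlgebra K B →ₗ[K] X)
    (g : TensorAlgebra K B →ₗ[K] Y) : convHom β f g = conv β f g := rfl

/-- Two convolutions agree if the bilinear maps agree on all values. -/
theorem conv_congr {β : X →ₗ[K] Y →ₗ[K] Z} {β' : X' →ₗ[K] Y' →ₗ[K] Z}
    {f : TensorAlgebra K B →ₗ[K] X} {f' : TensorAlgebra K B →ₗ[K] X'}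
    {g : TensorAlgebra K B →ₗ[K] Y} {g' : TensorAlgebra K B →ₗ[K] Y'}
    (h : ∀ a b, β (f a) (g b) = β' (f' a) (g' b)) : conv β f g = conv β' f' g' := by
  ext t
  rw [conv_apply, conv_apply]
  induction decon t with
  | zero => simp
  | add a b ha hb => simp only [map_add, ha, hb]
  | tmul a b => simpa using h a b

theorem map_conv (φ : Z →ₗ[K] Z') (β : X →ₗ[K] Y →ₗ[K] Z) (f : TensorAlgebra K B →ₗ[K] X)
    (g : TensorAlgebra K B →ₗ[K] Y) (t : TensorAlgebra K B) :
    φ (conv β f g t) = conv (β.compr₂ φ) f g t := by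
  rw [conv_apply, conv_apply]
  induction decon t with
  | zero => simp
  | add a b ha hb => simp only [map_add, ha, hb]
  | tmul a b => simp

/-- Convolution is associative whenever the bilinear maps involved are. -/
theorem conv_assoc {W XY YW V : Type*} [AddCommGroup W] [Module K W] [AddCommGroup XY]
    [Module K XY] [AddCommGroup YW] [Module K YW] [AddCommGroup V] [Module K V]
    {β : X →ₗ[K] Y →ₗ[K] XY} {γ : XY →ₗ[K] W →ₗ[K] V}
    {β' : Y →ₗ[K] W →ₗ[K] YW} {γ' : X →ₗ[K] YW →ₗ[K] V}
    {f : TensorAlgebra K B →ₗ[K] X} {g : TensorAlgebra K B →ₗ[K] Y} {h : TensorAlgebra K B →ₗ[K] W}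
    (H : ∀ a b c, γ (β (f a) (g b)) (h c) = γ' (f a) (β' (g b) (h c))) :
    conv γ (conv β f g) h = conv γ' f (conv β' g h) := by
  ext t
  -- both sides arise from the iterated coproduct by the map `a ⊗ b ⊗ c ↦ γ' (f a) (β' (g b) (h c))`
  have h1 : ∀ X : TensorAlgebra K B ⊗[K] TensorAlgebra K B,
      TensorProduct.lift γ (TensorProduct.map (conv β f g) h X) =
      TensorProduct.lift (TensorProduct.lift (LinearMap.mk₂ K
        (fun a b => γ' (f a) ∘ₗ β'.flip.flip (g b) ∘ₗ h)
        (by intros; ext; simp) (by intros; ext; simp) (by intros; ext; simp)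
        (by intros; ext; simp))) (decon.rTensor _ X) := by
    intro X
    induction X with
    | zero => simp
    | add a b ha hb => simp only [map_add, ha, hb]
    | tmul a b =>
      simp only [TensorProduct.map_tmul, TensorProduct.lift.tmul, LinearMap.rTensor_tmul,
        conv_apply]
      induction decon a with
      | zero => simp
      | add a b ha hb => simp only [map_add, LinearMap.add_apply, ha, hb]
      | tmul c d => simpa using H c d b
  have h2 : ∀ X : TensorAlgebra K B ⊗[K] TensorAlgebra K B,
      TensorProduct.lift γ' (TensorProduct.map f (conv β' g h) X) =
      TensorProduct.lift (TensorProduct.lift (LinearMap.mk₂ K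
        (fun a b => γ' (f a) ∘ₗ β'.flip.flip (g b) ∘ₗ h)
        (by intros; ext; simp) (by intros; ext; simp) (by intros; ext; simp)
        (by intros; ext; simp)))
        ((TensorProduct.assoc K _ _ _).symm (decon.lTensor _ X)) := by
    intro X
    induction X with
    | zero => simp
    | add a b ha hb => simp only [map_add, ha, hb]
    | tmul a b =>
      simp only [TensorProduct.map_tmul, TensorProduct.lift.tmul, LinearMap.lTensor_tmul,
        conv_apply]
      induction decon b with
      | zero => simp
      | add a b ha hb => simp only [map_add, ha, hb, TensorProduct.tmul_add]
      | tmul c d => simp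
  rw [conv_apply, conv_apply, h1, h2, ← decon_coassoc, LinearEquiv.symm_apply_apply]

theorem conv_eps_left (β : K →ₗ[K] Y →ₗ[K] Z) (g : TensorAlgebra K B →ₗ[K] Y)
    (t : TensorAlgebra K B) : conv β eps g t = β 1 (g t) := by
  have : TensorProduct.map (eps (K := K) (B := B)) g = g.lTensor _ ∘ₗ eps.rTensor _ := by
    rw [LinearMap.lTensor_comp_rTensor]
  rw [conv_apply, this, LinearMap.comp_apply, decon_counit_left]
  simp

end Words

/-! ### The dendriform operations on words over a brace algebra -/

namespace Words

open TensorAlgebra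

section Brace

variable {K : Type*} {B : Type*} [Field K] [AddCommGroup B] [Module K B]
  (M : B →ₗ[K] TensorAlgebra K B →ₗ[K] B)

/-- The step `(φ, y) ↦ (v ↦ ∑ φ(v₁) M(y; v₂) v₃)` of the recursion defining `star`. -/
def starStep : (TensorAlgebra K B →ₗ[K] TensorAlgebra K B) →ₗ[K] B →ₗ[K]
    (TensorAlgebra K B →ₗ[K] TensorAlgebra K B) :=
  LinearMap.mk₂ K (fun φ y => conv (LinearMap.mul K _) (conv snoc φ (M y)) LinearMap.id)
    (by intro φ φ' y; simp only [conv_add_left]) (by intro c φ y; simp only [conv_smul_left])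
    (by intro φ y y'; simp only [map_add, conv_add_left, conv_add_right])
    (by intro c φ y; simp only [map_smul, conv_smul_left, conv_smul_right])

/-- The product of words defined by the brace operations `M`:
`y₁ ⋯ yₙ * v = ∑ v₀ M(y₁; v₁) v₂ M(y₂; v₃) ⋯ M(yₙ; v₂ₙ₋₁) v₂ₙ`, where the sum runs over the
factorizations `v = v₀ v₁ ⋯ v₂ₙ`. -/
def star : TensorAlgebra K B →ₗ[K] TensorAlgebra K B →ₗ[K] TensorAlgebra K B :=
  fold LinearMap.id (starStep M)

/-- The part of `star` in which the last letter is a brace. -/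
def prec : TensorAlgebra K B →ₗ[K] TensorAlgebra K B →ₗ[K] TensorAlgebra K B :=
  onLast (LinearMap.mk₂ K (fun u y => conv snoc (star M u) (M y))
    (by intro φ φ' y; simp only [map_add, conv_add_left])
    (by intro c φ y; simp only [map_smul, conv_smul_left])
    (by intro φ y y'; simp only [map_add, conv_add_right])
    (by intro c φ y; simp only [map_smul, conv_smul_right]))

/-- The part of `star` in which the last letter is the last letter of the right factor. -/
def tsucc : TensorAlgebra K B →ₗ[K] TensorAlgebra K B →ₗ[K] TensorAlgebra K B :=
  (onLast (LinearMap.mk₂ K (fun v z => (LinearMap.mulRight K (ι K z)) ∘ₗ (star M).flip v)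
    (by intro v v' z; ext r; simp [add_mul]) (by intro c v z; ext r; simp)
    (by intro v z z'; ext r; simp [mul_add]) (by intro c v z; ext r; simp))).flip

@[simp] theorem star_one_left (s : TensorAlgebra K B) : star M 1 s = s := by simp [star]

@[simp] theorem prec_one_left (s : TensorAlgebra K B) : prec M 1 s = 0 := by simp [prec]

theorem prec_snoc (u : TensorAlgebra K B) (y : B) (s : TensorAlgebra K B) :
    prec M (u * ι K y) s = conv snoc (star M u) (M y) s := by simp [prec]

@[simp] theorem tsucc_one_right (r : TensorAlgebra K B) : tsucc M r 1 = 0 := by simp [tsucc]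

@[simp] theorem tsucc_snoc (r v : TensorAlgebra K B) (z : B) :
    tsucc M r (v * ι K z) = star M r v * ι K z := by simp [tsucc]

theorem star_snoc_left (u : TensorAlgebra K B) (y : B) (s : TensorAlgebra K B) :
    star M (u * ι K y) s =
      conv (LinearMap.mul K _) (conv snoc (star M u) (M y)) LinearMap.id s := by
  simp [star, starStep]

/-- The decomposition of `star` by the origin of the last letter. -/
theorem star_eq (r s : TensorAlgebra K B) :
    star M r s = prec M r s + tsucc M r s + (eps r * eps s) • 1 := by
  induction r using snoc_induction with
  | add a b ha hb => simp only [map_add, LinearMap.add_apply, ha, hb, add_mul, add_smul]; abel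
  | smul c a ha =>
    simp only [map_smul, LinearMap.smul_apply, ha, smul_add, smul_eq_mul, mul_assoc, mul_smul]
  | one =>
    induction s using snoc_induction with
    | add a b ha hb => simp only [map_add, ha, hb, mul_add, add_smul]; abel
    | smul c a ha =>
      simp only [map_smul, ha, smul_add, smul_eq_mul, mul_left_comm _ c, mul_smul]
    | one => simp
    | snoc v z _ => simp
  | snoc u y ih =>
    clear ih
    induction s using snoc_induction with
    | add a b ha hb => simp only [map_add, ha, hb, mul_add, add_smul]; abel
    | smul c a ha =>
      simp only [map_smul, ha, smul_add, smul_eq_mul, mul_left_comm _ c, mul_smul]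
    | one => simp [star_snoc_left, prec_snoc]
    | snoc v z _ =>
      rw [star_snoc_left, conv_snoc, prec_snoc, tsucc_snoc, star_snoc_left]
      have h := map_conv (LinearMap.mulRight K (ι K z)) (LinearMap.mul K _)
        (conv snoc (star M u) (M y)) LinearMap.id v
      rw [LinearMap.mulRight_apply] at h
      rw [h]
      simp only [LinearMap.id_apply, LinearMap.mul_apply', mul_one, LinearMap.id_comp, eps_snoc,
        mul_zero, zero_smul, add_zero]
      congr 1
      exact LinearMap.congr_fun (conv_congr (by intro a b; simp [mul_assoc])) v

theorem star_snoc (r w : TensorAlgebra K B) (z : B) :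
    star M r (w * ι K z) = prec M r (w * ι K z) + star M r w * ι K z := by
  simp [star_eq M r (w * ι K z)]

@[simp] theorem eps_prec (r s : TensorAlgebra K B) : eps (prec M r s) = 0 := by
  induction r using snoc_induction with
  | add a b ha hb => simp [ha, hb]
  | smul c a ha => simp [ha]
  | one => simp
  | snoc u y _ =>
    rw [prec_snoc, map_conv, conv_apply]
    induction decon s with
    | zero => simp
    | add a b ha hb => simp [ha, hb]
    | tmul a b => simp

@[simp] theorem eps_tsucc (r s : TensorAlgebra K B) : eps (tsucc M r s) = 0 := by
  induction s using snoc_induction with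
  | add a b ha hb => simp [ha, hb]
  | smul c a ha => simp [ha]
  | one => simp
  | snoc u y _ => simp

/-- Adding a letter to the second tensor factor. -/
def rsnoc : (TensorAlgebra K B ⊗[K] TensorAlgebra K B) →ₗ[K] B →ₗ[K]
    (TensorAlgebra K B ⊗[K] TensorAlgebra K B) :=
  (LinearMap.lTensorHom _ ∘ₗ snoc.flip).flip

@[simp] theorem rsnoc_tmul (a b : TensorAlgebra K B) (y : B) :
    rsnoc (a ⊗ₜ b) y = a ⊗ₜ (b * ι K y) := by simp [rsnoc]

theorem decon_snoc' (u : TensorAlgebra K B) (y : B) :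
    decon (u * ι K y) = (u * ι K y) ⊗ₜ 1 + rsnoc (decon u) y := by
  rw [decon_snoc]
  rfl

theorem decon_conv_snoc (f : TensorAlgebra K B →ₗ[K] TensorAlgebra K B)
    (g : TensorAlgebra K B →ₗ[K] B) (s : TensorAlgebra K B) :
    decon (conv snoc f g s) = conv snoc f g s ⊗ₜ 1 + conv rsnoc (decon ∘ₗ f) g s := by
  rw [conv_apply, conv_apply]
  induction decon s with
  | zero => simp
  | add a b ha hb => simp only [map_add, ha, hb, TensorProduct.add_tmul]; abel
  | tmul a b => simp [decon_snoc']

/-- Deconcatenation of `prec`, given the compatibility of `star` with the coproducts for a word with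
one letter less. -/
theorem decon_prec_of_star {u : TensorAlgebra K B} (y : B)
    (hu : ∀ s, decon (star M u s) = TensorProduct.map₂ (star M) (star M) (decon u) (decon s))
    (s : TensorAlgebra K B) : decon (prec M (u * ι K y) s) = prec M (u * ι K y) s ⊗ₜ 1 +
      TensorProduct.map₂ (star M) (prec M) (decon (u * ι K y)) (decon s) := by
  have h1 : decon ∘ₗ star M u = TensorProduct.map₂ (star M) (star M) (decon u) ∘ₗ decon :=
    LinearMap.ext hu
  have h2 : ∀ X : TensorAlgebra K B ⊗[K] TensorAlgebra K B,
      conv rsnoc (TensorProduct.map₂ (star M) (star M) X ∘ₗ decon) (M y) s =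
        TensorProduct.map₂ (star M) (prec M) (rsnoc X y) (decon s) := by
    intro X
    induction X with
    | zero => simp [conv_apply]
    | add a b ha hb =>
      simp only [map_add, LinearMap.add_apply, LinearMap.add_comp, conv_add_left, ha, hb]
    | tmul a b =>
      have h3 : TensorProduct.map₂ (star M) (star M) (a ⊗ₜ b) ∘ₗ decon =
          conv (TensorProduct.mk K _ _) (star M a) (star M b) := by
        ext t
        rw [conv_apply, LinearMap.comp_apply]
        induction decon t with
        | zero => simp
        | add a b ha hb => simp only [map_add, ha, hb]
        | tmul a b => simp
      have h4 : TensorProduct.map₂ (star M) (prec M) (rsnoc (a ⊗ₜ b) y) (decon s) =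
          conv (TensorProduct.mk K _ _) (star M a) (conv snoc (star M b) (M y)) s := by
        have : prec M (b * ι K y) = conv snoc (star M b) (M y) :=
          LinearMap.ext (prec_snoc M b y)
        rw [conv_apply, rsnoc_tmul]
        induction decon s with
        | zero => simp
        | add a b ha hb => simp only [map_add, ha, hb]
        | tmul c d => simp [this]
      rw [h3, h4]
      exact LinearMap.congr_fun (conv_assoc (by intro a b c; simp)) s
  have h5 : ∀ X : TensorAlgebra K B ⊗[K] TensorAlgebra K B, ∀ a,
      TensorProduct.map₂ (star M) (prec M) (a ⊗ₜ 1) X = 0 := by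
    intro X a
    induction X with
    | zero => simp
    | add a b ha hb => simp only [map_add, ha, hb, add_zero]
    | tmul c d => simp
  rw [decon_snoc', map_add, LinearMap.add_apply, h5, zero_add, ← h2, ← h1, prec_snoc,
    decon_conv_snoc]

/-- Deconcatenation of `tsucc`, given the compatibility of `star` with the coproducts for a word
with one letter less. -/
theorem decon_tsucc_of_star {r v : TensorAlgebra K B} (z : B)
    (h : decon (star M r v) = TensorProduct.map₂ (star M) (star M) (decon r) (decon v)) :
    decon (tsucc M r (v * ι K z)) = tsucc M r (v * ι K z) ⊗ₜ 1 +
      TensorProduct.map₂ (star M) (tsucc M) (decon r) (decon (v * ι K z)) := by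
  rw [tsucc_snoc, decon_snoc', decon_snoc', h, map_add]
  congr 1
  induction decon r with
  | zero => simp
  | add a b ha hb => simp only [map_add, LinearMap.add_apply, ha, hb]; abel
  | tmul a b =>
    induction decon v with
    | zero => simp
    | add a b ha hb =>
      simp only [map_add, LinearMap.add_apply]
      rw [ha, hb]
      simp only [TensorProduct.map₂_apply_tmul, TensorProduct.map_tmul, tsucc_one_right,
        TensorProduct.tmul_zero, zero_add]
    | tmul c d => simp

/-- The unit part of the second factor is governed by the counits. -/
theorem map₂_eps (op : TensorAlgebra K B →ₗ[K] TensorAlgebra K B →ₗ[K] TensorAlgebra K B)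
    (e : TensorAlgebra K B →ₗ[K] TensorAlgebra K B →ₗ[K] TensorAlgebra K B)
    (he : ∀ a b, e a b = (eps a * eps b) • 1) (r s : TensorAlgebra K B) :
    TensorProduct.map₂ op e (decon r) (decon s) = op r s ⊗ₜ 1 := by
  have h : ∀ X Y : TensorAlgebra K B ⊗[K] TensorAlgebra K B,
      TensorProduct.map₂ op e X Y = op (TensorProduct.rid K _ (eps.lTensor _ X))
        (TensorProduct.rid K _ (eps.lTensor _ Y)) ⊗ₜ 1 := by
    intro X Y
    induction X with
    | zero => simp
    | add a b ha hb => simp only [map_add, LinearMap.add_apply, ha, hb, TensorProduct.add_tmul]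
    | tmul a b =>
      induction Y with
      | zero => simp
      | add c d hc hd => simp only [map_add, hc, hd, TensorProduct.add_tmul]
      | tmul c d =>
        simp only [TensorProduct.map₂_apply_tmul, TensorProduct.map_tmul, he,
          LinearMap.lTensor_tmul, TensorProduct.rid_tmul, map_smul, LinearMap.smul_apply,
          smul_smul, TensorProduct.tmul_smul, TensorProduct.smul_tmul']
        rw [mul_comm]
  rw [h, decon_counit_right, decon_counit_right]
  simp

/-- Compatibility of `star` with the coproducts follows from that of its two parts. -/
theorem decon_star_aux {r s : TensorAlgebra K B}
    (h1 : decon (prec M r s) = prec M r s ⊗ₜ 1 +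
      TensorProduct.map₂ (star M) (prec M) (decon r) (decon s))
    (h2 : decon (tsucc M r s) = tsucc M r s ⊗ₜ 1 +
      TensorProduct.map₂ (star M) (tsucc M) (decon r) (decon s)) :
    decon (star M r s) = TensorProduct.map₂ (star M) (star M) (decon r) (decon s) := by
  let e : TensorAlgebra K B →ₗ[K] TensorAlgebra K B →ₗ[K] TensorAlgebra K B :=
    (LinearMap.mul K K).compl₁₂ eps eps |>.compr₂ (Algebra.linearMap K _)
  have he : ∀ a b, e a b = (eps a * eps b) • 1 := by
    intro a b; simp [e, Algebra.algebraMap_eq_smul_one, mul_smul]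
  have h3 : star M = prec M + tsucc M + e := by
    ext1 a; ext1 b
    simp only [LinearMap.add_apply, he, star_eq M a b]
  have h4 : TensorProduct.map₂ (star M) (star M) (decon r) (decon s) =
      TensorProduct.map₂ (star M) (prec M + tsucc M + e) (decon r) (decon s) := by rw [← h3]
  have h5 : ∀ (f g h : TensorAlgebra K B →ₗ[K] TensorAlgebra K B →ₗ[K] TensorAlgebra K B)
      (X Y : TensorAlgebra K B ⊗[K] TensorAlgebra K B), TensorProduct.map₂ f (g + h) X Y =
        TensorProduct.map₂ f g X Y + TensorProduct.map₂ f h X Y := by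
    intro f g h X Y
    induction X with
    | zero => simp
    | add a b ha hb => simp only [map_add, LinearMap.add_apply, ha, hb]; abel
    | tmul a b => simp [TensorProduct.map_add_right]
  rw [h4, h5, h5, map₂_eps _ e he, star_eq, map_add, map_add, h1, h2]
  simp only [map_smul, decon_one, TensorProduct.add_tmul, TensorProduct.smul_tmul']
  abel

/-- `star` is a morphism of coalgebras. -/
theorem decon_star (r s : TensorAlgebra K B) :
    decon (star M r s) = TensorProduct.map₂ (star M) (star M) (decon r) (decon s) := by
  induction r using snoc_induction generalizing s with
  | add a b ha hb => simp only [map_add, LinearMap.add_apply, ha, hb]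
  | smul c a ha => simp only [map_smul, LinearMap.smul_apply, ha]
  | one =>
    rw [star_one_left, decon_one]
    induction decon s with
    | zero => simp
    | add a b ha hb => rw [map_add, ← ha, ← hb]
    | tmul a b => simp
  | snoc u y ihu =>
    induction s using snoc_induction with
    | add a b ha hb => simp only [map_add, ha, hb]
    | smul c a ha => simp only [map_smul, ha]
    | one =>
      refine decon_star_aux M (decon_prec_of_star M y ihu 1) ?_
      rw [decon_one]
      induction decon (u * ι K y) with
      | zero => simp
      | add a b ha hb =>
        rw [map_add, LinearMap.add_apply, ← add_assoc, ← ha]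
        simpa using hb
      | tmul a b => simp
    | snoc v z ihv =>
      exact decon_star_aux M (decon_prec_of_star M y ihu _) (decon_tsucc_of_star M z ihv)

/-- `prec` satisfies the compatibility of a tridendriform bialgebra. The summand `prec M r s ⊗ₜ 1`
stands for the convention `(r * s) ⊗ (1 ≺ 1) := (r ≺ s) ⊗ 1`. -/
theorem decon_prec (r s : TensorAlgebra K B) : decon (prec M r s) = prec M r s ⊗ₜ 1 +
    TensorProduct.map₂ (star M) (prec M) (decon r) (decon s) := by
  induction r using snoc_induction with
  | add a b ha hb =>
    simp only [map_add, LinearMap.add_apply, ha, hb, TensorProduct.add_tmul]; abel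
  | smul c a ha =>
    simp only [map_smul, LinearMap.smul_apply, ha, TensorProduct.smul_tmul', smul_add]
  | one =>
    rw [decon_one]
    induction decon s with
    | zero => simp
    | add a b ha hb => simp at ha hb ⊢; simp [← ha, ← hb]
    | tmul a b => simp
  | snoc u y _ => exact decon_prec_of_star M y (decon_star M u) s

theorem decon_tsucc (r s : TensorAlgebra K B) : decon (tsucc M r s) = tsucc M r s ⊗ₜ 1 +
    TensorProduct.map₂ (star M) (tsucc M) (decon r) (decon s) := by
  induction s using snoc_induction with
  | add a b ha hb =>
    simp only [map_add, ha, hb, TensorProduct.add_tmul]; abel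
  | smul c a ha => simp only [map_smul, ha, TensorProduct.smul_tmul', smul_add]
  | one =>
    rw [decon_one]
    induction decon r with
    | zero => simp
    | add a b ha hb => simp at ha hb ⊢; simp [← ha, ← hb]
    | tmul a b => simp
  | snoc v z _ => exact decon_tsucc_of_star M z (decon_star M r v)

/-! #### Associativity -/

variable {M}

theorem prec_one_right (hM : ∀ x, M x 1 = x) (r : TensorAlgebra K B) :
    prec M r 1 = r - eps r • 1 := by
  suffices h : star M r 1 = r by
    have := star_eq M r 1
    rw [h, tsucc_one_right, eps_one, mul_one, add_zero] at this
    rw [eq_sub_iff_add_eq, ← this]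
  induction r using snoc_induction with
  | add a b ha hb => simp [ha, hb]
  | smul c a ha => simp [ha]
  | one => simp
  | snoc u y ih => simp [star_snoc_left, ih, hM]

@[simp] theorem star_one_right (hM : ∀ x, M x 1 = x) (r : TensorAlgebra K B) :
    star M r 1 = r := by
  simp [star_eq, prec_one_right hM]

/-- The brace identity `hact` turns `prec` into a right action, given associativity for a left
factor with one letter less. -/
theorem prec_prec_of_star (hact : ∀ x s t, M (M x s) t = M x (star M s t))
    {u : TensorAlgebra K B} (y : B)
    (hu : ∀ s t, star M (star M u s) t = star M u (star M s t)) (s t : TensorAlgebra K B) :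
    prec M (prec M (u * ι K y) s) t = prec M (u * ι K y) (star M s t) := by
  rw [prec_snoc, prec_snoc, conv_apply, conv_apply, decon_star]
  induction decon s with
  | zero => simp
  | add a b ha hb => simp only [map_add, LinearMap.add_apply, ha, hb]
  | tmul a b =>
    rw [TensorProduct.map_tmul, TensorProduct.lift.tmul, snoc_apply, prec_snoc, conv_apply]
    induction decon t with
    | zero => simp
    | add c d hc hd => simp only [map_add, hc, hd]
    | tmul c d => simp [hu, hact]

theorem tsucc_conv_snoc (r : TensorAlgebra K B) (f : TensorAlgebra K B →ₗ[K] TensorAlgebra K B)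
    (g : TensorAlgebra K B →ₗ[K] B) (s : TensorAlgebra K B) :
    tsucc M r (conv snoc f g s) = conv snoc (star M r ∘ₗ f) g s := by
  rw [map_conv]
  exact LinearMap.congr_fun (conv_congr (by intro a b; simp)) s

/-- The brace identities make `star` associative. -/
theorem star_assoc (hM : ∀ x, M x 1 = x) (hact : ∀ x s t, M (M x s) t = M x (star M s t))
    (r s t : TensorAlgebra K B) : star M (star M r s) t = star M r (star M s t) := by
  induction r using snoc_induction generalizing s t with
  | add a b ha hb => simp only [map_add, LinearMap.add_apply, ha, hb]
  | smul c a ha => simp only [map_smul, LinearMap.smul_apply, ha]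
  | one => simp
  | snoc u y ihu =>
    have act := prec_prec_of_star hact y ihu
    set r := u * ι K y with hr
    have er : eps r = 0 := by simp [hr]
    induction s using snoc_induction generalizing t with
    | add a b ha hb => simp only [map_add, LinearMap.add_apply, ha, hb]
    | smul c a ha => simp only [map_smul, LinearMap.smul_apply, ha]
    | one => simp [hM]
    | snoc v x ihs =>
      -- the part of associativity in which the last letter is a brace of `r * s`
      have D : ∀ t, prec M (star M r (v * ι K x)) t =
          tsucc M r (prec M (v * ι K x) t) + prec M r (star M (v * ι K x) t) := by
        intro t
        rw [star_eq M r, er, zero_mul, zero_smul, add_zero, map_add, LinearMap.add_apply, act,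
          tsucc_snoc, prec_snoc M (star M r v), prec_snoc M v,
          tsucc_conv_snoc, add_comm]
        congr 1
        exact LinearMap.congr_fun (conv_congr (by intro a b; simp [ihs])) t
      induction t using snoc_induction with
      | add a b ha hb => simp only [map_add, ha, hb]
      | smul c a ha => simp only [map_smul, ha]
      | one => simp [hM]
      | snoc w z iht =>
        rw [star_snoc, iht, D, star_snoc M (v * ι K x), map_add (star M r), star_snoc M r,
          star_eq M r (prec M _ _), map_add (prec M r), er]
        simp only [zero_mul, zero_smul, add_zero]
        abel

theorem prec_prec (hM : ∀ x, M x 1 = x) (hact : ∀ x s t, M (M x s) t = M x (star M s t))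
    (r s t : TensorAlgebra K B) : prec M (prec M r s) t = prec M r (star M s t) := by
  induction r using snoc_induction with
  | add a b ha hb => simp only [map_add, LinearMap.add_apply, ha, hb]
  | smul c a ha => simp only [map_smul, LinearMap.smul_apply, ha]
  | one => simp
  | snoc u y _ => exact prec_prec_of_star hact y (star_assoc hM hact u) s t

theorem tsucc_prec (hM : ∀ x, M x 1 = x) (hact : ∀ x s t, M (M x s) t = M x (star M s t))
    (r s t : TensorAlgebra K B) : prec M (tsucc M r s) t = tsucc M r (prec M s t) := by
  induction s using snoc_induction with
  | add a b ha hb => simp only [map_add, LinearMap.add_apply, ha, hb]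
  | smul c a ha => simp only [map_smul, LinearMap.smul_apply, ha]
  | one => simp
  | snoc v x _ =>
    rw [tsucc_snoc, prec_snoc, prec_snoc, tsucc_conv_snoc]
    exact LinearMap.congr_fun (conv_congr (by intro a b; simp [star_assoc hM hact])) t

theorem tsucc_tsucc (hM : ∀ x, M x 1 = x) (hact : ∀ x s t, M (M x s) t = M x (star M s t))
    (r s t : TensorAlgebra K B) : tsucc M (star M r s) t = tsucc M r (tsucc M s t) := by
  induction t using snoc_induction with
  | add a b ha hb => simp only [map_add, ha, hb]
  | smul c a ha => simp only [map_smul, ha]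
  | one => simp
  | snoc v x _ => simp [star_assoc hM hact]

end Brace

end Words

/-! ### The third operation on words over a `GV_q` algebra -/

namespace Words

open TensorAlgebra

section Dot

variable {K : Type*} {B : Type*} [Field K] [AddCommGroup B] [Module K B] (q : K)
  (mul : B →ₗ[K] B →ₗ[K] B) (M : B →ₗ[K] TensorAlgebra K B →ₗ[K] B)

/-- Multiplying the last letter of a word on the right: `1 ↦ 0`, `u y ↦ u (y · z)`. -/
def rmul : TensorAlgebra K B →ₗ[K] B →ₗ[K] TensorAlgebra K B :=
  onLast (LinearMap.mk₂ K (fun u y => LinearMap.mulLeft K u ∘ₗ ι K ∘ₗ mul y)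
    (by intros; ext; simp [add_mul]) (by intros; ext; simp)
    (by intros; ext; simp [mul_add]) (by intros; ext; simp))

@[simp] theorem rmul_one (z : B) : rmul mul 1 z = 0 := by simp [rmul]

@[simp] theorem rmul_snoc (u : TensorAlgebra K B) (y z : B) :
    rmul mul (u * ι K y) z = u * ι K (mul y z) := by simp [rmul]

/-- The iterated product `(b, z₁ ⋯ zₖ) ↦ qᵏ b · z₁ · ⋯ · zₖ`. -/
def mulWord : B →ₗ[K] TensorAlgebra K B →ₗ[K] B :=
  (fold LinearMap.id (LinearMap.mk₂ K (fun φ z => q • mul.flip z ∘ₗ φ)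
    (by intros; ext; simp) (by intro c φ y; ext; simp [smul_comm q c])
    (by intros; ext; simp) (by intro c φ y; ext; simp [smul_comm q c]))).flip

@[simp] theorem mulWord_one (b : B) : mulWord q mul b 1 = b := by simp [mulWord]

@[simp] theorem mulWord_snoc (b : B) (u : TensorAlgebra K B) (z : B) :
    mulWord q mul b (u * ι K z) = q • mul (mulWord q mul b u) z := by simp [mulWord]

/-- The operation `·` on words, given by `r · 1 = 0` and
`r · (v z) = (r ≺ v + q r · v) · z`, where the last product by the letter `z` is `rmul`. -/
def dot : TensorAlgebra K B →ₗ[K] TensorAlgebra K B →ₗ[K] TensorAlgebra K B :=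
  (LinearMap.snd K _ _ ∘ₗ fold
    (X := TensorAlgebra K B × (TensorAlgebra K B →ₗ[K] TensorAlgebra K B)) (1, 0)
    (LinearMap.mk₂ K (fun p z => (p.1 * ι K z,
        (rmul mul).flip z ∘ₗ ((prec M).flip p.1 + q • p.2)))
      (by intros; ext <;> simp [add_mul]; abel)
      (by intro c p z; ext <;> simp [smul_comm q c])
      (by intros; ext <;> simp [mul_add]) (by intro c p z; ext <;> simp))).flip

/-- The operation `≺ + q ·` on words. -/
def precT : TensorAlgebra K B →ₗ[K] TensorAlgebra K B →ₗ[K] TensorAlgebra K B :=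
  prec M + q • dot q mul M

theorem precT_apply (r s : TensorAlgebra K B) :
    precT q mul M r s = prec M r s + q • dot q mul M r s := rfl

@[simp] theorem dot_one_right (r : TensorAlgebra K B) : dot q mul M r 1 = 0 := by simp [dot]

theorem dot_snoc (r v : TensorAlgebra K B) (z : B) :
    dot q mul M r (v * ι K z) = rmul mul (precT q mul M r v) z := by
  simp only [dot, precT_apply, LinearMap.flip_apply, LinearMap.comp_apply, fold_snoc,
    LinearMap.mk₂_apply, LinearMap.snd_apply, LinearMap.add_apply, LinearMap.smul_apply]
  congr 4
  exact fst_fold _ _ (by intro p y; rfl) v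

@[simp] theorem dot_one_left (s : TensorAlgebra K B) : dot q mul M 1 s = 0 := by
  induction s using snoc_induction with
  | add a b ha hb => simp [ha, hb]
  | smul c a ha => simp [ha]
  | one => simp
  | snoc v z ih => simp [dot_snoc, precT_apply, ih]

@[simp] theorem eps_rmul (r : TensorAlgebra K B) (z : B) : eps (rmul mul r z) = 0 := by
  induction r using snoc_induction with
  | add a b ha hb => simp [ha, hb]
  | smul c a ha => simp [ha]
  | one => simp
  | snoc u y _ => simp

@[simp] theorem eps_dot (r s : TensorAlgebra K B) : eps (dot q mul M r s) = 0 := by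
  induction s using snoc_induction with
  | add a b ha hb => simp [ha, hb]
  | smul c a ha => simp [ha]
  | one => simp
  | snoc u y _ => simp [dot_snoc]

theorem rmul_tsucc (r w : TensorAlgebra K B) (z : B) :
    rmul mul (tsucc M r w) z = tsucc M r (rmul mul w z) := by
  induction w using snoc_induction with
  | add a b ha hb => simp [ha, hb]
  | smul c a ha => simp [ha]
  | one => simp
  | snoc u y _ => simp

theorem rmul_conv_snoc (f : TensorAlgebra K B →ₗ[K] TensorAlgebra K B)
    (g : TensorAlgebra K B →ₗ[K] B) (z : B) (t : TensorAlgebra K B) :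
    rmul mul (conv snoc f g t) z = conv snoc f (mul.flip z ∘ₗ g) t := by
  rw [← LinearMap.flip_apply, map_conv]
  exact LinearMap.congr_fun (conv_congr (by intro a b; simp)) t

theorem decon_rmul (w : TensorAlgebra K B) (z : B) : decon (rmul mul w z) =
    rmul mul w z ⊗ₜ 1 + ((rmul mul).flip z).lTensor _ (decon w) := by
  induction w using snoc_induction with
  | add a b ha hb =>
    simp only [map_add, LinearMap.add_apply, ha, hb, TensorProduct.add_tmul]; abel
  | smul c a ha =>
    simp only [map_smul, LinearMap.smul_apply, ha, TensorProduct.smul_tmul', smul_add]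
  | one => simp
  | snoc u y _ =>
    rw [rmul_snoc, decon_snoc', decon_snoc', map_add]
    simp only [LinearMap.lTensor_tmul, LinearMap.flip_apply, rmul_one, TensorProduct.tmul_zero,
      zero_add]
    congr 1
    induction decon u with
    | zero => simp
    | add a b ha hb => simp only [map_add, LinearMap.add_apply, ha, hb]
    | tmul a b => simp

theorem decon_dot (r s : TensorAlgebra K B) : decon (dot q mul M r s) =
    dot q mul M r s ⊗ₜ 1 +
      TensorProduct.map₂ (star M) (dot q mul M) (decon r) (decon s) := by
  induction s using snoc_induction with
  | add a b ha hb =>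
    simp only [map_add, ha, hb, TensorProduct.add_tmul]; abel
  | smul c a ha => simp only [map_smul, ha, TensorProduct.smul_tmul', smul_add]
  | one =>
    rw [decon_one]
    induction decon r with
    | zero => simp
    | add a b ha hb => simp at ha hb ⊢; simp [← ha, ← hb]
    | tmul a b => simp
  | snoc v z ih =>
    have h1 : decon (precT q mul M r v) = precT q mul M r v ⊗ₜ 1 +
        TensorProduct.map₂ (star M) (precT q mul M) (decon r) (decon v) := by
      rw [precT_apply, map_add, map_smul, ih, decon_prec, TensorProduct.add_tmul,
        ← TensorProduct.smul_tmul', smul_add]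
      have h2 : ∀ X Y : TensorAlgebra K B ⊗[K] TensorAlgebra K B,
          TensorProduct.map₂ (star M) (precT q mul M) X Y =
          TensorProduct.map₂ (star M) (prec M) X Y +
            q • TensorProduct.map₂ (star M) (dot q mul M) X Y := by
        intro X Y
        induction X with
        | zero => simp
        | add a b ha hb => simp only [map_add, LinearMap.add_apply, ha, hb, smul_add]; abel
        | tmul a b =>
          induction Y with
          | zero => simp
          | add a b ha hb => simp only [map_add, ha, hb, smul_add]; abel
          | tmul c d => simp [precT_apply, TensorProduct.tmul_add]
      rw [h2]
      abel
    rw [dot_snoc, decon_rmul, h1, map_add, decon_snoc', map_add]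
    simp only [LinearMap.lTensor_tmul, LinearMap.flip_apply, rmul_one, TensorProduct.tmul_zero,
      zero_add]
    congr 1
    induction decon r with
    | zero => simp
    | add a b ha hb =>
      simp only [map_add, LinearMap.add_apply, ha, hb]; abel
    | tmul a b =>
      induction decon v with
      | zero => simp
      | add c d hc hd =>
        simp only [map_add, LinearMap.add_apply]
        rw [hc, hd]
        simp
      | tmul c d => simp [dot_snoc]

variable {q mul M}

theorem precT_one_right (hM : ∀ x, M x 1 = x) (r : TensorAlgebra K B) :
    precT q mul M r 1 = r - eps r • 1 := by
  simp [precT_apply, prec_one_right hM]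

@[simp] theorem precT_one_left (s : TensorAlgebra K B) : precT q mul M 1 s = 0 := by
  simp [precT_apply]

@[simp] theorem eps_precT (r s : TensorAlgebra K B) : eps (precT q mul M r s) = 0 := by
  simp [precT_apply]

theorem conv_mulWord_mulRight (f : TensorAlgebra K B →ₗ[K] B) (z : B) :
    conv (mulWord q mul) f LinearMap.id ∘ₗ LinearMap.mulRight K (ι K z) =
      f ∘ₗ LinearMap.mulRight K (ι K z) +
        q • (mul.flip z ∘ₗ conv (mulWord q mul) f LinearMap.id) := by
  ext1 v
  simp only [LinearMap.comp_apply, LinearMap.mulRight_apply, LinearMap.add_apply,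
    LinearMap.smul_apply, conv_snoc, LinearMap.id_apply, mulWord_one]
  rw [map_conv, conv_apply, conv_apply]
  congr 1
  induction decon v with
  | zero => simp
  | add a b ha hb => simp only [map_add, ha, hb, smul_add]
  | tmul a b => simp

/-- Unwinding the recursion of `dot`: the last letter `y` takes up the brace of a subword and is
then multiplied by all remaining letters, with a factor `q` for each. -/
theorem precT_snoc (hM : ∀ x, M x 1 = x) (u : TensorAlgebra K B) (y : B)
    (t : TensorAlgebra K B) : precT q mul M (u * ι K y) t =
      conv snoc (star M u) (conv (mulWord q mul) (M y) LinearMap.id) t := by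
  induction t using snoc_induction with
  | add a b ha hb => simp only [map_add, ha, hb]
  | smul c a ha => simp only [map_smul, ha]
  | one => simp [precT_one_right hM, hM]
  | snoc v z ih =>
    rw [precT_apply, dot_snoc, ih, rmul_conv_snoc, conv_snoc, conv_mulWord_mulRight,
      conv_add_right, conv_smul_right, prec_snoc, conv_snoc]
    simp [hM, add_assoc]

/-- The distributive relation `hmul` of the braces over the product, for words. -/
theorem prec_rmul (hM : ∀ x, M x 1 = x)
    (hmul : ∀ x y t, M (mul x y) t =
      conv mul (conv (mulWord q mul) (M x) LinearMap.id) (M y) t)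
    (w : TensorAlgebra K B) (x : B) (t : TensorAlgebra K B) :
    prec M (rmul mul w x) t = conv (rmul mul) (precT q mul M w) (M x) t := by
  induction w using snoc_induction with
  | add a b ha hb => simp only [map_add, LinearMap.add_apply, ha, hb, conv_add_left]
  | smul c a ha => simp only [map_smul, LinearMap.smul_apply, ha, conv_smul_left]
  | one =>
    rw [rmul_one, map_zero, conv_apply]
    induction decon t with
    | zero => simp
    | add a b ha hb => simp only [map_add, ← ha, ← hb, LinearMap.zero_apply, add_zero]
    | tmul a b => simp
  | snoc u y _ =>
    have h1 : precT q mul M (u * ι K y) =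
        conv snoc (star M u) (conv (mulWord q mul) (M y) LinearMap.id) :=
      LinearMap.ext (precT_snoc hM u y)
    have h2 : M (mul y x) = conv mul (conv (mulWord q mul) (M y) LinearMap.id) (M x) :=
      LinearMap.ext (hmul y x)
    rw [rmul_snoc, prec_snoc, h1, h2]
    exact (LinearMap.congr_fun (conv_assoc (by intro a b c; simp)) t).symm

theorem tsucc_dot (hM : ∀ x, M x 1 = x) (hact : ∀ x s t, M (M x s) t = M x (star M s t))
    (r s t : TensorAlgebra K B) :
    dot q mul M (tsucc M r s) t = tsucc M r (dot q mul M s t) := by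
  induction t using snoc_induction with
  | add a b ha hb => simp only [map_add, ha, hb]
  | smul c a ha => simp only [map_smul, ha]
  | one => simp
  | snoc v z ih =>
    rw [dot_snoc, dot_snoc, ← rmul_tsucc, precT_apply, precT_apply, ih, tsucc_prec hM hact]
    simp

/-- The relation `(r · s) ≺ t = r · (s ≺ t)`, given the action property of `precT` for a word `v`
with one letter less than `s`. -/
theorem prec_dot_of_precT (hM : ∀ x, M x 1 = x)
    (hmul : ∀ x y t, M (mul x y) t =
      conv mul (conv (mulWord q mul) (M x) LinearMap.id) (M y) t)
    {r v : TensorAlgebra K B} (x : B)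
    (hv : ∀ t, precT q mul M (precT q mul M r v) t = precT q mul M r (star M v t))
    (t : TensorAlgebra K B) :
    prec M (dot q mul M r (v * ι K x)) t = dot q mul M r (prec M (v * ι K x) t) := by
  rw [dot_snoc, prec_rmul hM hmul, prec_snoc, map_conv]
  exact LinearMap.congr_fun (conv_congr (by intro a b; simp [dot_snoc, hv])) t

/-- The operation `≺ + q ·` is a right action of the words under `star`. -/
theorem precT_precT (hM : ∀ x, M x 1 = x) (hact : ∀ x s t, M (M x s) t = M x (star M s t))
    (hmul : ∀ x y t, M (mul x y) t =
      conv mul (conv (mulWord q mul) (M x) LinearMap.id) (M y) t)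
    (r s t : TensorAlgebra K B) :
    precT q mul M (precT q mul M r s) t = precT q mul M r (star M s t) := by
  induction s using snoc_induction generalizing t with
  | add a b ha hb => simp only [map_add, LinearMap.add_apply, ha, hb]
  | smul c a ha => simp only [map_smul, LinearMap.smul_apply, ha]
  | one => simp [precT_one_right hM]
  | snoc v x ihs =>
    have D3 := prec_dot_of_precT hM hmul x ihs
    induction t using snoc_induction with
    | add a b ha hb => simp only [map_add, ha, hb]
    | smul c a ha => simp only [map_smul, ha]
    | one => simp [precT_one_right hM, hM]
    | snoc w z iht =>
      rw [precT_apply, dot_snoc, iht, ← dot_snoc, precT_apply, map_add, LinearMap.add_apply,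
        map_smul, LinearMap.smul_apply, D3, prec_prec hM hact, precT_apply, add_assoc,
        ← smul_add, ← map_add, star_snoc]

theorem dot_tsucc (hM : ∀ x, M x 1 = x) (hact : ∀ x s t, M (M x s) t = M x (star M s t))
    (hmul : ∀ x y t, M (mul x y) t =
      conv mul (conv (mulWord q mul) (M x) LinearMap.id) (M y) t)
    (r s t : TensorAlgebra K B) :
    dot q mul M r (tsucc M s t) = dot q mul M (precT q mul M r s) t := by
  induction t using snoc_induction with
  | add a b ha hb => simp only [map_add, ha, hb]
  | smul c a ha => simp only [map_smul, ha]
  | one => simp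
  | snoc v z ih => rw [tsucc_snoc, dot_snoc, dot_snoc, precT_precT hM hact hmul]

theorem dot_prec (hM : ∀ x, M x 1 = x) (hact : ∀ x s t, M (M x s) t = M x (star M s t))
    (hmul : ∀ x y t, M (mul x y) t =
      conv mul (conv (mulWord q mul) (M x) LinearMap.id) (M y) t)
    (r s t : TensorAlgebra K B) :
    prec M (dot q mul M r s) t = dot q mul M r (prec M s t) := by
  induction s using snoc_induction with
  | add a b ha hb => simp only [map_add, LinearMap.add_apply, ha, hb]
  | smul c a ha => simp only [map_smul, LinearMap.smul_apply, ha]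
  | one => simp
  | snoc v x _ => exact prec_dot_of_precT hM hmul x (precT_precT hM hact hmul r v) t

theorem dot_dot (hM : ∀ x, M x 1 = x) (hact : ∀ x s t, M (M x s) t = M x (star M s t))
    (hmul : ∀ x y t, M (mul x y) t =
      conv mul (conv (mulWord q mul) (M x) LinearMap.id) (M y) t)
    (hassoc : ∀ x y z, mul (mul x y) z = mul x (mul y z))
    (r s t : TensorAlgebra K B) :
    dot q mul M (dot q mul M r s) t = dot q mul M r (dot q mul M s t) := by
  have h : ∀ w z, dot q mul M r (rmul mul w z) = rmul mul (dot q mul M r w) z := by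
    intro w z
    induction w using snoc_induction with
    | add a b ha hb => simp only [map_add, LinearMap.add_apply, ha, hb]
    | smul c a ha => simp only [map_smul, LinearMap.smul_apply, ha]
    | one => simp
    | snoc v y _ =>
      rw [rmul_snoc, dot_snoc, dot_snoc]
      induction precT q mul M r v using snoc_induction with
      | add a b ha hb => simp only [map_add, LinearMap.add_apply, ha, hb]
      | smul c a ha => simp only [map_smul, LinearMap.smul_apply, ha]
      | one => simp
      | snoc u x _ => simp [hassoc]
  induction t using snoc_induction with
  | add a b ha hb => simp only [map_add, ha, hb]
  | smul c a ha => simp only [map_smul, ha]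
  | one => simp
  | snoc v z ih =>
    rw [dot_snoc, dot_snoc, h, precT_apply, precT_apply, ih, dot_prec hM hact hmul]
    simp

end Dot

/-! #### Comparison with sums over lists -/

section Lists

variable {K : Type*} {B : Type*} [Field K] [AddCommGroup B] [Module K B] {q : K}
  {mul : B →ₗ[K] B →ₗ[K] B} {M : B →ₗ[K] TensorAlgebra K B →ₗ[K] B}

theorem conv_mul_assoc (f g h : TensorAlgebra K B →ₗ[K] TensorAlgebra K B) :
    conv (LinearMap.mul K _) (conv (LinearMap.mul K _) f g) h =
      conv (LinearMap.mul K _) f (conv (LinearMap.mul K _) g h) :=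
  conv_assoc (by intro a b c; simp [mul_assoc])

/-- Recursion for `star` on the first letter of the left factor. -/
theorem star_cons (y : B) (u : TensorAlgebra K B) : star M (ι K y * u) =
    conv (LinearMap.mul K _) LinearMap.id
      (conv (LinearMap.mul K _) (ι K ∘ₗ M y) (star M u)) := by
  have h0 : ∀ (u : TensorAlgebra K B) (y : B), star M (u * ι K y) =
      conv (LinearMap.mul K _) (star M u)
        (conv (LinearMap.mul K _) (ι K ∘ₗ M y) LinearMap.id) := by
    intro u y
    have h : conv snoc (star M u) (M y) =
        conv (LinearMap.mul K _) (star M u) (ι K ∘ₗ M y) := conv_congr (by intro a b; simp)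
    rw [← conv_mul_assoc, ← h]
    exact LinearMap.ext (star_snoc_left M u y)
  have h1 : star M 1 = LinearMap.id := LinearMap.ext (star_one_left M)
  induction u using snoc_induction with
  | add a b ha hb => rw [mul_add, map_add, ha, hb, map_add, conv_add_right, conv_add_right]
  | smul c a ha => rw [mul_smul_comm, map_smul, ha, map_smul, conv_smul_right, conv_smul_right]
  | one =>
    have := h0 1 y
    rw [one_mul, h1] at this
    rw [mul_one, this, h1]
  | snoc u z ih => rw [← mul_assoc, h0, ih, h0]; simp only [conv_mul_assoc]

theorem sum_Icc_eq_sum_range {X : Type*} [AddCommMonoid X] {i n : ℕ} (h : i ≤ n) (f : ℕ → X) :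
    ∑ j ∈ Finset.Icc i n, f j = ∑ j ∈ Finset.range (n - i + 1), f (i + j) := by
  rw [← Finset.Ico_add_one_right_eq_Icc, Finset.sum_Ico_eq_sum_range]
  congr 2
  omega

/-- The iterated sum on the right-hand side of the brace identities is a value on a product of
words. -/
theorem braceSum_eq {N : B → List B → B} (hN : ∀ x l, M x (word l) = N x l)
    (F : TensorAlgebra K B →ₗ[K] B) (ys zs : List B) :
    braceSum N (fun l => F (word l)) ys zs = F (star M (word ys) (word zs)) := by
  induction ys generalizing F zs with
  | nil => simp [braceSum]
  | cons y ys ih =>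
    rw [braceSum, word_cons, star_cons, conv_word, map_sum]
    refine Finset.sum_congr rfl fun i hi => ?_
    have hi' : i ≤ zs.length := by simpa [Nat.lt_succ_iff] using hi
    rw [sum_Icc_eq_sum_range hi', conv_word, map_sum, map_sum, List.length_drop]
    refine Finset.sum_congr rfl fun j _ => ?_
    have h := ih (F ∘ₗ LinearMap.mulLeft K (word (zs.take i) *
      ι K (N y ((zs.drop i).take (i + j - i))))) (zs.drop (i + j))
    simp only [LinearMap.comp_apply, LinearMap.mulLeft_apply, mul_assoc] at h
    simp only [word_append, word_cons]
    rw [h]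
    simp [hN, List.drop_drop]

theorem mulWord_word (b : B) (l : List B) :
    mulWord q mul b (word l) = q ^ l.length • l.foldl (fun a z => mul a z) b := by
  induction l using List.reverseRecOn with
  | nil => simp
  | append_singleton l z ih =>
    rw [word_append, word_cons, word_nil, mul_one, mulWord_snoc, ih]
    simp [smul_smul, pow_succ']

/-- The double sum on the right-hand side of the distributive relation is a convolution. -/
theorem conv_mulWord_word {N : B → List B → B} (hN : ∀ x l, M x (word l) = N x l)
    (x y : B) (zs : List B) :
    conv mul (conv (mulWord q mul) (M x) LinearMap.id) (M y) (word zs) =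
    ∑ i ∈ Finset.range (zs.length + 1), ∑ j ∈ Finset.Icc i zs.length, q ^ (j - i) •
      mul (((zs.drop i).take (j - i)).foldl (fun a z => mul a z) (N x (zs.take i)))
        (N y (zs.drop j)) := by
  let β' : TensorAlgebra K B →ₗ[K] B →ₗ[K] (B →ₗ[K] B) :=
    LinearMap.mk₂ K (fun t c => mul.flip c ∘ₗ (mulWord q mul).flip t)
      (by intros; ext; simp) (by intros; ext; simp) (by intros; ext; simp)
      (by intros; ext; simp)
  have h : conv mul (conv (mulWord q mul) (M x) LinearMap.id) (M y) =
      conv (LinearMap.applyₗ : B →ₗ[K] (B →ₗ[K] B) →ₗ[K] B) (M x)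
        (conv β' LinearMap.id (M y)) := conv_assoc (by intro a b c; simp [β'])
  rw [h, conv_word]
  refine Finset.sum_congr rfl fun i hi => ?_
  have hi' : i ≤ zs.length := by simpa [Nat.lt_succ_iff] using hi
  rw [sum_Icc_eq_sum_range hi', conv_word, map_sum, List.length_drop]
  refine Finset.sum_congr rfl fun j hj => ?_
  have hj' : j ≤ zs.length - i := by simpa [Nat.lt_succ_iff] using hj
  simp [β', hN, mulWord_word, List.drop_drop, hj']

end Lists

end Words

/-! ### Words in a tridendriform algebra -/

namespace TriOps

open TensorAlgebra Words

variable {K : Type*} {A : Type*} [Field K] [AddCommGroup A] [Module K A]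

theorem plusPrec_apply (o : TriOps K A) (a b : A × K) :
    o.plusPrec a b = (o.prec a.1 b.1 + b.2 • a.1, 0) := rfl

theorem plusDot_apply (o : TriOps K A) (a b : A × K) :
    o.plusDot a b = (o.dot a.1 b.1, 0) := rfl

theorem plusSucc_apply (o : TriOps K A) (a b : A × K) :
    o.plusSucc a b = (o.succ a.1 b.1 + a.2 • b.1, 0) := rfl

theorem plusTsucc_apply (o : TriOps K A) (q : K) (a b : A × K) :
    o.plusTsucc q a b = (q • o.dot a.1 b.1 + (o.succ a.1 b.1 + a.2 • b.1), 0) := by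
  simp [plusTsucc, plusDot_apply, plusSucc_apply]

theorem plusStar_apply (o : TriOps K A) (q : K) (a b : A × K) :
    o.plusStar q a b = (o.star q a.1 b.1 + a.2 • b.1 + b.2 • a.1, a.2 * b.2) := rfl

theorem star_apply (o : TriOps K A) (q : K) (a b : A) :
    o.star q a b = o.prec a b + q • o.dot a b + o.succ a b := rfl

@[simp] theorem incl_fst (a : A) : (incl K A a).1 = a := rfl

@[simp] theorem incl_snd (a : A) : (incl K A a).2 = 0 := rfl

@[simp] theorem one_fst : (one K A).1 = 0 := rfl

@[simp] theorem one_snd : (one K A).2 = 1 := rfl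

section Plus

variable {o : TriOps K A} {q : K}

theorem plusStar_eq (a b : A × K) :
    o.plusStar q a b = o.plusPrec a b + o.plusTsucc q a b + (a.2 * b.2) • one K A := by
  ext
  · simp only [plusPrec_apply, plusTsucc_apply, plusStar_apply, star_apply, Prod.fst_add,
      Prod.smul_fst, one_fst, smul_zero]
    abel
  · simp [plusPrec_apply, plusTsucc_apply, plusStar_apply]

@[simp] theorem plusPrec_one_left (a : A × K) : o.plusPrec (one K A) a = 0 := by
  ext <;> simp [plusPrec_apply]

@[simp] theorem plusTsucc_one_right (a : A × K) : o.plusTsucc q a (one K A) = 0 := by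
  ext <;> simp [plusTsucc_apply]

@[simp] theorem plusTsucc_one_left (a : A) :
    o.plusTsucc q (one K A) (incl K A a) = incl K A a := by
  ext <;> simp [plusTsucc_apply]

@[simp] theorem plusPrec_one_right (a : A) :
    o.plusPrec (incl K A a) (one K A) = incl K A a := by
  ext <;> simp [plusPrec_apply]

@[simp] theorem plusDot_one_right (a : A × K) : o.plusDot a (one K A) = 0 := by
  ext <;> simp [plusDot_apply]

@[simp] theorem plusStar_one_left (a : A × K) : o.plusStar q (one K A) a = a := by
  ext <;> simp [plusStar_apply]

@[simp] theorem plusStar_one_right (a : A × K) : o.plusStar q a (one K A) = a := by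
  ext <;> simp [plusStar_apply]

@[simp] theorem plusPrec_snd (a b : A × K) : (o.plusPrec a b).2 = 0 := rfl

@[simp] theorem plusDot_snd (a b : A × K) : (o.plusDot a b).2 = 0 := rfl

@[simp] theorem plusTsucc_snd (a b : A × K) : (o.plusTsucc q a b).2 = 0 := by
  simp [plusTsucc_apply]

theorem plusPrec_plusPrec (ho : o.IsTridend q) (a b c : A × K) :
    o.plusPrec (o.plusPrec a b) c = o.plusPrec a (o.plusStar q b c) := by
  ext
  · simp only [plusPrec_apply, plusStar_apply, star_apply, map_add, map_smul,
      LinearMap.add_apply, LinearMap.smul_apply, ho.prec_prec]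
    module
  · rfl

theorem plusPrec_plusTsucc (ho : o.IsTridend q) (a b c : A × K) :
    o.plusPrec (o.plusTsucc q a b) c = o.plusTsucc q a (o.plusPrec b c) := by
  ext
  · simp only [plusPrec_apply, plusTsucc_apply, map_add, map_smul,
      LinearMap.add_apply, LinearMap.smul_apply, ho.dot_prec, ho.succ_prec]
    module
  · simp

theorem plusTsucc_plusTsucc (ho : o.IsTridend q) (a b c : A × K) :
    o.plusTsucc q (o.plusStar q a b) c = o.plusTsucc q a (o.plusTsucc q b c) := by
  ext
  · have h := ho.succ_succ a.1 b.1 c.1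
    simp only [map_add, LinearMap.add_apply, map_smul, LinearMap.smul_apply] at h
    simp only [plusStar_apply, star_apply, plusTsucc_apply, map_add, map_smul,
      LinearMap.add_apply, LinearMap.smul_apply, ho.dot_dot, ho.succ_dot, ho.prec_dot, ← h]
    module
  · simp

theorem plusDot_plusTsucc_left (ho : o.IsTridend q) (a b c : A × K) :
    o.plusDot (o.plusTsucc q a b) c = o.plusTsucc q a (o.plusDot b c) := by
  ext
  · simp only [plusDot_apply, plusTsucc_apply, map_add, map_smul,
      LinearMap.add_apply, LinearMap.smul_apply, ho.dot_dot, ho.succ_dot]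
  · simp

theorem plusDot_plusTsucc_right (ho : o.IsTridend q) (a b c : A × K) :
    o.plusDot a (o.plusTsucc q b c) = o.plusDot (o.plusPrec a b + q • o.plusDot a b) c := by
  ext
  · simp only [plusDot_apply, plusPrec_apply, plusTsucc_apply, map_add, map_smul, Prod.fst_add,
      Prod.smul_fst, LinearMap.add_apply, LinearMap.smul_apply, ho.dot_dot, ho.prec_dot]
    module
  · simp

theorem plusPrec_plusDot (ho : o.IsTridend q) (a b c : A × K) :
    o.plusPrec (o.plusDot a b) c = o.plusDot a (o.plusPrec b c) := by
  ext
  · simp only [plusDot_apply, plusPrec_apply, map_add, map_smul, ho.dot_prec]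
  · simp

end Plus

section WordMap

variable {B : Type*} [AddCommGroup B] [Module K B] (o : TriOps K A) (q : K) (i : B →ₗ[K] A)

/-- The map `y₁ ⋯ yₙ ↦ ω_≻~(i y₁, …, i yₙ)` from words to `A₊`, started at `h` instead of `1`. -/
def wordMapFrom (h : A × K) : TensorAlgebra K B →ₗ[K] A × K :=
  fold h ((o.plusTsucc q).compl₂ (incl K A ∘ₗ i))

/-- The map `y₁ ⋯ yₙ ↦ ω_≻~(i y₁, …, i yₙ)` from words to `A₊`. -/
def wordMap : TensorAlgebra K B →ₗ[K] A × K := o.wordMapFrom q i (one K A)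

@[simp] theorem wordMap_one : o.wordMap q i 1 = one K A := by simp [wordMap, wordMapFrom]

@[simp] theorem wordMap_snoc (u : TensorAlgebra K B) (y : B) :
    o.wordMap q i (u * ι K y) = o.plusTsucc q (o.wordMap q i u) (incl K A (i y)) := by
  simp [wordMap, wordMapFrom]

@[simp] theorem wordMap_ι (y : B) : o.wordMap q i (ι K y) = incl K A (i y) := by
  have := o.wordMap_snoc q i 1 y
  simpa using this

theorem wordMap_snd (t : TensorAlgebra K B) : (o.wordMap q i t).2 = eps t := by
  induction t using snoc_induction with
  | add a b ha hb => simp [ha, hb]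
  | smul c a ha => simp [ha]
  | one => simp
  | snoc u y _ => simp

theorem wordMap_word (l : List B) :
    o.wordMap q i (word l) = o.omegaTsucc q (l.map i) := by
  induction l using List.reverseRecOn with
  | nil => simp [omegaTsucc]
  | append_singleton l y ih => simp [ih, omegaTsucc]

theorem wordMapFrom_cons (h : A × K) (y : B) (u : TensorAlgebra K B) :
    o.wordMapFrom q i h (ι K y * u) =
      o.wordMapFrom q i (o.plusTsucc q h (incl K A (i y))) u := by
  induction u using snoc_induction with
  | add a b ha hb => simp [mul_add, ha, hb]
  | smul c a ha => simp [ha]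
  | one =>
    have := fold_snoc h ((o.plusTsucc q).compl₂ (incl K A ∘ₗ i)) 1 y
    rw [one_mul] at this
    simp [wordMapFrom, this]
  | snoc u z ih =>
    rw [← mul_assoc]
    simp only [wordMapFrom, fold_snoc] at ih ⊢
    rw [ih]

/-- The map `y₁ ⋯ yₙ ↦ (-1)ⁿ ω_≺(i y₁, …, i yₙ)`, the convolution inverse of `wordMap`. -/
def antiWordMap : TensorAlgebra K B →ₗ[K] A × K :=
  foldr (one K A) (-(o.plusPrec ∘ₗ incl K A ∘ₗ i))

@[simp] theorem antiWordMap_one : o.antiWordMap i 1 = one K A := by simp [antiWordMap]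

@[simp] theorem antiWordMap_cons (u : TensorAlgebra K B) (y : B) :
    o.antiWordMap i (ι K y * u) = -o.plusPrec (incl K A (i y)) (o.antiWordMap i u) := by
  simp [antiWordMap]

theorem antiWordMap_word (l : List B) :
    o.antiWordMap i (word l) = (-1 : K) ^ l.length • o.omegaPrec (l.map i) := by
  induction l with
  | nil => simp [omegaPrec]
  | cons y l ih =>
    rw [word_cons, antiWordMap_cons, ih]
    simp [omegaPrec, pow_succ]

variable {o q}

/-- The convolution of `wordMapFrom` and `antiWordMap` telescopes. -/
theorem conv_wordMapFrom_antiWordMap (ho : o.IsTridend q) (h : A × K) (t : TensorAlgebra K B) :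
    conv (o.plusStar q) (o.wordMapFrom q i h) (o.antiWordMap i) t =
      o.plusPrec h (o.antiWordMap i t) + (h.2 * eps t) • one K A := by
  induction t using cons_induction generalizing h with
  | add a b ha hb => simp only [map_add, ha, hb, mul_add, add_smul]; abel
  | smul c a ha =>
    simp only [map_smul, ha, smul_add, smul_eq_mul, mul_left_comm _ c, mul_smul]
  | one =>
    simp only [conv_one, antiWordMap_one, wordMapFrom, fold_one, plusStar_one_right, eps_one]
    ext <;> simp [plusPrec_apply]
  | cons y u ih =>
    have h1 : o.wordMapFrom q i h ∘ₗ LinearMap.mulLeft K (ι K y) =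
        o.wordMapFrom q i (o.plusTsucc q h (incl K A (i y))) :=
      LinearMap.ext (o.wordMapFrom_cons q i h y)
    rw [conv_cons, h1, ih, plusPrec_plusTsucc ho, plusStar_eq]
    simp [wordMapFrom]

theorem conv_wordMap_antiWordMap (ho : o.IsTridend q) :
    conv (o.plusStar q) (o.wordMap q i) (o.antiWordMap i) =
      (LinearMap.toSpanSingleton K _ (one K A)) ∘ₗ eps := by
  ext1 t
  rw [wordMap, conv_wordMapFrom_antiWordMap i ho]
  simp

variable (o q)

/-- The brace operations of a tridendriform algebra, as a bilinear map on letters and words. -/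
def braceMap : B →ₗ[K] TensorAlgebra K B →ₗ[K] A :=
  LinearMap.mk₂ K (fun x t => (conv (o.plusPrec ∘ₗ (o.plusTsucc q).flip (incl K A (i x)))
      (o.antiWordMap i) (o.wordMap q i) t).1)
    (by
      intro x x' t
      rw [← Prod.fst_add, conv_apply, conv_apply, conv_apply]
      congr 1
      induction decon t with
      | zero => simp
      | add a b ha hb => simp only [map_add] at ha hb ⊢; rw [ha, hb]; abel
      | tmul a b => simp)
    (by
      intro c x t
      rw [← Prod.smul_fst, conv_apply, conv_apply]
      congr 1
      induction decon t with
      | zero => simp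
      | add a b ha hb => simp only [map_add, map_smul] at ha hb ⊢; rw [ha, hb, smul_add]
      | tmul a b => simp)
    (by intro x t t'; simp) (by intro c x t; simp)

theorem braceMap_word (x : B) (l : List B) :
    o.braceMap q i x (word l) = o.brace q (i x) (l.map i) := by
  simp only [braceMap, LinearMap.mk₂_apply, conv_word, brace, Prod.fst_sum, List.length_map]
  refine Finset.sum_congr rfl fun j hj => ?_
  have hj' : j ≤ l.length := by simpa [Nat.lt_succ_iff] using hj
  simp [antiWordMap_word, wordMap_word, hj']

theorem incl_braceMap (x : B) (t : TensorAlgebra K B) : incl K A (o.braceMap q i x t) =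
    conv (o.plusPrec ∘ₗ (o.plusTsucc q).flip (incl K A (i x)))
      (o.antiWordMap i) (o.wordMap q i) t := by
  ext
  · rfl
  · rw [incl_snd, conv_apply]
    induction decon t with
    | zero => simp
    | add a b ha hb => rw [map_add, map_add, Prod.snd_add, ← ha, ← hb, add_zero]
    | tmul a b => simp

@[simp] theorem braceMap_one (x : B) : o.braceMap q i x 1 = i x := by
  simp [braceMap]

variable {o q}

/-- The braces are determined by `x ≺ ω(v) = ∑ ω(v₁) ≻~ M(x; v₂)`, where `ω` is `wordMap`. -/
theorem plusPrec_wordMap (ho : o.IsTridend q) (x : B) (t : TensorAlgebra K B) :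
    o.plusPrec (incl K A (i x)) (o.wordMap q i t) =
      conv (o.plusTsucc q) (o.wordMap q i) (incl K A ∘ₗ o.braceMap q i x) t := by
  have h1 : incl K A ∘ₗ o.braceMap q i x =
      conv (o.plusPrec ∘ₗ (o.plusTsucc q).flip (incl K A (i x)))
        (o.antiWordMap i) (o.wordMap q i) := LinearMap.ext (o.incl_braceMap q i x)
  have h2 : conv (o.plusTsucc q) (o.wordMap q i)
      (conv (o.plusPrec ∘ₗ (o.plusTsucc q).flip (incl K A (i x)))
        (o.antiWordMap i) (o.wordMap q i)) =
      conv (o.plusPrec ∘ₗ (o.plusTsucc q).flip (incl K A (i x)))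
        (conv (o.plusStar q) (o.wordMap q i) (o.antiWordMap i)) (o.wordMap q i) :=
    (conv_assoc (by
      intro a b c
      simp [plusTsucc_plusTsucc ho, plusPrec_plusTsucc ho])).symm
  have h3 : conv (o.plusPrec ∘ₗ (o.plusTsucc q).flip (incl K A (i x)))
      ((LinearMap.toSpanSingleton K _ (one K A)) ∘ₗ eps) (o.wordMap q i) =
      conv (o.plusPrec ∘ₗ (o.plusTsucc q).flip (incl K A (i x)) ∘ₗ
        LinearMap.toSpanSingleton K _ (one K A)) eps (o.wordMap q i) :=
    conv_congr (by intro a b; simp)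
  rw [h1, h2, conv_wordMap_antiWordMap i ho, h3, conv_eps_left]
  simp

/-- Convolution with `wordMap` is injective. -/
theorem eq_zero_of_conv_wordMap {E : TensorAlgebra K B →ₗ[K] A}
    (h : ∀ t, conv (o.plusTsucc q) (o.wordMap q i) (incl K A ∘ₗ E) t = 0) : E = 0 := by
  apply ext_word
  suffices H : ∀ n, ∀ l : List B, l.length = n → E (word l) = 0 by
    intro l; simpa using H _ l rfl
  intro n
  induction n using Nat.strong_induction_on with
  | _ n ih =>
    intro l hl
    have h1 := h (word l)
    rw [conv_word, Finset.sum_eq_single 0] at h1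
    · simpa using congrArg Prod.fst h1
    · intro j hj hj0
      have : E (word (l.drop j)) = 0 := by
        refine ih (l.length - j) ?_ _ (by simp)
        have := Finset.mem_range.1 hj
        omega
      simp [this]
    · simp

/-- Identities between braces can be checked after convolution with `wordMap`. -/
theorem eq_of_conv_wordMap {E E' : TensorAlgebra K B →ₗ[K] A}
    (h : ∀ t, conv (o.plusTsucc q) (o.wordMap q i) (incl K A ∘ₗ E) t =
      conv (o.plusTsucc q) (o.wordMap q i) (incl K A ∘ₗ E') t) (t : TensorAlgebra K B) :
    E t = E' t := by
  have : E - E' = 0 := by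
    refine eq_zero_of_conv_wordMap (o := o) (q := q) i fun t => ?_
    have h1 : incl K A ∘ₗ (E - E') = incl K A ∘ₗ E + (-1 : K) • (incl K A ∘ₗ E') := by
      rw [LinearMap.comp_sub]; module
    rw [h1, conv_add_right, conv_smul_right, LinearMap.add_apply, LinearMap.smul_apply, h]
    simp
  exact sub_eq_zero.1 (LinearMap.congr_fun this t)

section Hom

variable {i} {M : B →ₗ[K] TensorAlgebra K B →ₗ[K] B} {mul : B →ₗ[K] B →ₗ[K] B}

/-- `wordMap` respects `≺`, given that it respects `star` for a word with one letter less. The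
hypothesis `hM` says that `i` maps the braces `M` to those of `A`. -/
theorem wordMap_prec_of_star (ho : o.IsTridend q)
    (hM : ∀ x t, o.braceMap q i x t = i (M x t)) {u : TensorAlgebra K B} (y : B)
    (hu : ∀ s, o.wordMap q i (Words.star M u s) =
      o.plusStar q (o.wordMap q i u) (o.wordMap q i s)) (s : TensorAlgebra K B) :
    o.wordMap q i (Words.prec M (u * ι K y) s) =
      o.plusPrec (o.wordMap q i (u * ι K y)) (o.wordMap q i s) := by
  rw [prec_snoc, map_conv, wordMap_snoc, plusPrec_plusTsucc ho, plusPrec_wordMap i ho, map_conv]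
  refine LinearMap.congr_fun (conv_congr ?_) s
  intro a b
  simp [hu, plusTsucc_plusTsucc ho, hM]

/-- `wordMap` sends the product of words to the product of `A₊`. -/
theorem wordMap_star (ho : o.IsTridend q) (hM : ∀ x t, o.braceMap q i x t = i (M x t))
    (r s : TensorAlgebra K B) : o.wordMap q i (Words.star M r s) =
      o.plusStar q (o.wordMap q i r) (o.wordMap q i s) := by
  induction r using snoc_induction generalizing s with
  | add a b ha hb => simp only [map_add, LinearMap.add_apply, ha, hb]
  | smul c a ha => simp only [map_smul, LinearMap.smul_apply, ha]
  | one => simp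
  | snoc u y ihu =>
    induction s using snoc_induction with
    | add a b ha hb => simp only [map_add, ha, hb]
    | smul c a ha => simp only [map_smul, ha]
    | one =>
      rw [Words.star_eq, map_add, map_add, wordMap_prec_of_star ho hM y ihu, plusStar_eq]
      simp
    | snoc v z ihv =>
      rw [star_snoc, map_add, wordMap_prec_of_star ho hM y ihu,
        wordMap_snoc _ _ _ (Words.star M _ _), ihv, plusTsucc_plusTsucc ho, ← wordMap_snoc o q i v, plusStar_eq]
      simp

theorem wordMap_prec (ho : o.IsTridend q) (hM : ∀ x t, o.braceMap q i x t = i (M x t))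
    (r s : TensorAlgebra K B) : o.wordMap q i (Words.prec M r s) =
      o.plusPrec (o.wordMap q i r) (o.wordMap q i s) := by
  induction r using snoc_induction with
  | add a b ha hb => simp only [map_add, LinearMap.add_apply, ha, hb]
  | smul c a ha => simp only [map_smul, LinearMap.smul_apply, ha]
  | one => simp
  | snoc u y _ => exact wordMap_prec_of_star ho hM y (wordMap_star ho hM u) s

theorem wordMap_tsucc (ho : o.IsTridend q) (hM : ∀ x t, o.braceMap q i x t = i (M x t))
    (r s : TensorAlgebra K B) : o.wordMap q i (Words.tsucc M r s) =
      o.plusTsucc q (o.wordMap q i r) (o.wordMap q i s) := by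
  induction s using snoc_induction with
  | add a b ha hb => simp only [map_add, ha, hb]
  | smul c a ha => simp only [map_smul, ha]
  | one => simp
  | snoc v z _ => simp [wordMap_star ho hM, plusTsucc_plusTsucc ho]

theorem wordMap_rmul (ho : o.IsTridend q) (hmul : ∀ x y, i (mul x y) = o.dot (i x) (i y))
    (w : TensorAlgebra K B) (z : B) : o.wordMap q i (rmul mul w z) =
      o.plusDot (o.wordMap q i w) (incl K A (i z)) := by
  induction w using snoc_induction with
  | add a b ha hb => simp only [map_add, LinearMap.add_apply, ha, hb]
  | smul c a ha => simp only [map_smul, LinearMap.smul_apply, ha]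
  | one => ext <;> simp [plusDot_apply]
  | snoc v y _ =>
    rw [rmul_snoc, wordMap_snoc, wordMap_snoc, plusDot_plusTsucc_left ho, hmul]
    rfl

theorem wordMap_dot (ho : o.IsTridend q) (hM : ∀ x t, o.braceMap q i x t = i (M x t))
    (hmul : ∀ x y, i (mul x y) = o.dot (i x) (i y)) (r s : TensorAlgebra K B) :
    o.wordMap q i (Words.dot q mul M r s) =
      o.plusDot (o.wordMap q i r) (o.wordMap q i s) := by
  induction s using snoc_induction with
  | add a b ha hb => simp only [map_add, ha, hb]
  | smul c a ha => simp only [map_smul, ha]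
  | one => simp
  | snoc v z ih =>
    rw [dot_snoc, wordMap_rmul ho hmul, precT_apply, map_add, map_smul, ih,
      wordMap_prec ho hM, wordMap_snoc, plusDot_plusTsucc_right ho]

end Hom

end WordMap

/-! #### The brace identities in a tridendriform algebra -/

section BraceIdentities

variable {o : TriOps K A} {q : K}

/-- The brace identities: after convolution with `wordMap` in both variables, the two sides become
`(x ≺ ω(s)) ≺ ω(t)` and `x ≺ (ω(s) * ω(t))`. -/
theorem braceMap_braceMap (ho : o.IsTridend q) (x : A) (s t : TensorAlgebra K A) :
    o.braceMap q LinearMap.id (o.braceMap q LinearMap.id x s) t =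
      o.braceMap q LinearMap.id x (Words.star (o.braceMap q LinearMap.id) s t) := by
  set i : A →ₗ[K] A := LinearMap.id with hi
  set M := o.braceMap q i with hM
  have hM' : ∀ x t, o.braceMap q i x t = i (M x t) := fun _ _ => rfl
  refine eq_of_conv_wordMap (o := o) (q := q) (E' := M x ∘ₗ Words.star M s) i (fun t => ?_) t
  have h1 := plusPrec_wordMap i ho (M x s) t
  rw [← h1]
  -- as functions of `s`, both sides have the same convolution with `wordMap`
  let E : TensorAlgebra K A →ₗ[K] A :=
    LinearMap.fst K A K ∘ₗ o.plusPrec.flip (o.wordMap q i t) ∘ₗ incl K A ∘ₗ M x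
  let E' : TensorAlgebra K A →ₗ[K] A :=
    LinearMap.fst K A K ∘ₗ LinearMap.applyₗ (R := K) t ∘ₗ
      convHom (o.plusTsucc q) (o.wordMap q i) ∘ₗ LinearMap.llcomp K _ _ _ (incl K A ∘ₗ M x) ∘ₗ
        Words.star M
  have hE : ∀ s, incl K A (E s) = o.plusPrec (incl K A (M x s)) (o.wordMap q i t) := by
    intro s; ext <;> simp [E]
  have hE' : ∀ s, incl K A (E' s) = conv (o.plusTsucc q) (o.wordMap q i)
      (incl K A ∘ₗ M x ∘ₗ Words.star M s) t := by
    intro s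
    ext
    · rfl
    · rw [incl_snd, conv_apply]
      induction decon t with
      | zero => simp
      | add a b ha hb => rw [map_add, map_add, Prod.snd_add, ← ha, ← hb, add_zero]
      | tmul a b => simp
  have key : E s = E' s := by
    refine eq_of_conv_wordMap (o := o) (q := q) i (fun s => ?_) s
    have h2 : conv (o.plusTsucc q) (o.wordMap q i) (incl K A ∘ₗ E) s =
        o.plusPrec (conv (o.plusTsucc q) (o.wordMap q i) (incl K A ∘ₗ M x) s)
          (o.wordMap q i t) := by
      rw [conv_apply, conv_apply]
      induction decon s with
      | zero => simp
      | add a b ha hb => simp only [map_add, LinearMap.add_apply, ha, hb]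
      | tmul a b => simp [hE, plusPrec_plusTsucc ho]
    have h3 : conv (o.plusTsucc q) (o.wordMap q i) (incl K A ∘ₗ E') s =
        conv (o.plusTsucc q) (o.wordMap q i) (incl K A ∘ₗ M x) (Words.star M s t) := by
      rw [conv_apply, conv_apply, decon_star]
      induction decon s with
      | zero => simp
      | add a b ha hb => simp only [map_add, LinearMap.add_apply, ha, hb]
      | tmul a b =>
        simp only [TensorProduct.map_tmul, TensorProduct.lift.tmul, LinearMap.comp_apply, hE']
        rw [conv_apply]
        induction decon t with
        | zero => simp
        | add a b ha hb => simp only [map_add, ha, hb]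
        | tmul c d => simp [wordMap_star ho hM', plusTsucc_plusTsucc ho]
    have h4 := plusPrec_wordMap i ho x s
    have h5 := plusPrec_wordMap i ho x (Words.star M s t)
    rw [h2, h3, ← h4, ← h5, wordMap_star ho hM', plusPrec_plusPrec ho]
  have := congrArg (incl K A) key
  rw [hE, hE'] at this
  exact this

/-- The analogue of `plusPrec_wordMap` for the operation `≺ + q ·`. -/
theorem precT_wordMap (ho : o.IsTridend q) (x : A) (t : TensorAlgebra K A) :
    o.plusPrec (incl K A x) (o.wordMap q LinearMap.id t) +
      q • o.plusDot (incl K A x) (o.wordMap q LinearMap.id t) =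
    conv (o.plusTsucc q) (o.wordMap q LinearMap.id) (incl K A ∘ₗ
      conv (mulWord q o.dot) (o.braceMap q LinearMap.id x) LinearMap.id) t := by
  induction t using snoc_induction with
  | add a b ha hb => simp only [map_add, ← ha, ← hb, smul_add]; abel
  | smul c a ha => simp only [map_smul, ← ha, smul_add, smul_comm c]
  | one => simp
  | snoc v z ih =>
    have h1 := plusPrec_wordMap LinearMap.id ho x (v * ι K z)
    rw [LinearMap.id_apply] at h1
    rw [h1, wordMap_snoc, plusDot_plusTsucc_right ho, ih, conv_snoc, conv_snoc,
      LinearMap.comp_assoc, LinearMap.comp_assoc, conv_mulWord_mulRight, LinearMap.comp_add,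
      LinearMap.comp_smul, conv_add_right, conv_smul_right]
    simp only [LinearMap.comp_apply, braceMap_one, conv_one, LinearMap.id_apply, mulWord_one,
      LinearMap.add_apply, LinearMap.smul_apply, add_assoc]
    congr 3
    rw [← LinearMap.flip_apply, map_conv]
    refine LinearMap.congr_fun (conv_congr ?_) v
    intro a b
    simp only [LinearMap.compr₂_apply, LinearMap.flip_apply, plusDot_plusTsucc_left ho]
    rfl

/-- The distributive relation: after convolution with `wordMap`, it becomes
`(x · y) ≺ ω(t) = x · (y ≺ ω(t))`. -/
theorem braceMap_dot (ho : o.IsTridend q) (x y : A) (t : TensorAlgebra K A) :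
    o.braceMap q LinearMap.id (o.dot x y) t =
      conv o.dot (conv (mulWord q o.dot) (o.braceMap q LinearMap.id x) LinearMap.id)
        (o.braceMap q LinearMap.id y) t := by
  refine eq_of_conv_wordMap (o := o) (q := q) LinearMap.id (fun t => ?_) t
  set M := o.braceMap q LinearMap.id with hM
  set g := conv (mulWord q o.dot) (M x) LinearMap.id with hg
  have h1 := plusPrec_wordMap LinearMap.id ho (o.dot x y) t
  have h2 := plusPrec_wordMap LinearMap.id ho y t
  have h3 : o.plusPrec (incl K A (o.dot x y)) (o.wordMap q LinearMap.id t) =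
      o.plusDot (incl K A x) (o.plusPrec (incl K A y) (o.wordMap q LinearMap.id t)) := by
    rw [← plusPrec_plusDot ho]; rfl
  rw [LinearMap.id_apply] at h1 h2
  rw [← h1, h3, h2, map_conv]
  have h4 : conv ((o.plusTsucc q).compr₂ (o.plusDot (incl K A x))) (o.wordMap q LinearMap.id)
      (incl K A ∘ₗ M y) = conv o.plusDot (conv (o.plusTsucc q) (o.wordMap q LinearMap.id)
        (incl K A ∘ₗ g)) (incl K A ∘ₗ M y) := by
    refine conv_congr fun a b => ?_
    rw [← precT_wordMap ho, ← plusDot_plusTsucc_right ho]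
    rfl
  have h5 : incl K A ∘ₗ conv o.dot g (M y) =
      conv o.plusDot (incl K A ∘ₗ g) (incl K A ∘ₗ M y) := by
    ext1 t
    rw [LinearMap.comp_apply, map_conv]
    exact LinearMap.congr_fun (conv_congr (by intro a b; rfl)) t
  rw [h4, h5]
  exact LinearMap.congr_fun (conv_assoc (by intro a b c; rw [plusDot_plusTsucc_left ho])) t

/-- A tridendriform algebra is a `GV_q` algebra under its brace operations. -/
theorem isGV (ho : o.IsTridend q) : IsGV q o.dot (o.brace q) := by
  have hN : ∀ x l, o.braceMap q LinearMap.id x (word l) = o.brace q x l := by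
    intro x l
    simpa using o.braceMap_word q LinearMap.id x l
  constructor
  · intro x x' ys; simp [← hN]
  · intro c x ys; simp [← hN]
  · intro x l y y' r; simp [← hN, add_mul, mul_add]
  · intro x l c y r; simp [← hN]
  · intro x; simp [← hN]
  · intro x ys zs
    have h := braceSum_eq hN (o.braceMap q LinearMap.id x) ys zs
    simp only [hN] at h
    refine Eq.trans ?_ h.symm
    rw [← braceMap_braceMap ho, hN, hN]
  · intro x y z; exact ho.dot_dot x y z
  · intro x y zs
    rw [← conv_mulWord_word hN, ← braceMap_dot ho, hN]

end BraceIdentities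

end TriOps

/-! ### Primitive elements -/

theorem map_braceSum {B B' : Type*} [AddCommMonoid B] [AddCommMonoid B'] {N : B → List B → B}
    {N' : B' → List B' → B'} (f : B →+ B') (hN : ∀ y l, f (N y l) = N' (f y) (l.map f))
    {F : List B → B} {F' : List B' → B'} (hF : ∀ l, f (F l) = F' (l.map f)) (ys zs : List B) :
    f (braceSum N F ys zs) = braceSum N' F' (ys.map f) (zs.map f) := by
  induction ys generalizing F F' zs with
  | nil => simpa [braceSum] using hF zs
  | cons y ys ih =>
    simp only [braceSum, List.map_cons, map_sum, List.length_map]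
    refine Finset.sum_congr rfl fun i _ => Finset.sum_congr rfl fun j _ => ?_
    have h := ih (F := fun t => F (zs.take i ++ N y ((zs.drop i).take (j - i)) :: t))
      (F' := fun t => F' ((zs.map f).take i ++ N' (f y) (((zs.map f).drop i).take (j - i)) :: t))
      (fun l => by rw [hF]; simp [hN, List.map_take, List.map_drop]) (zs.drop j)
    rwa [List.map_drop] at h

/-- The `GV_q` axioms are inherited along an injective map that preserves the operations. -/
theorem IsGV.of_injective {K : Type u} [Field K] {q : K} {B : Type v} {B' : Type w}
    [AddCommGroup B] [Module K B] [AddCommGroup B'] [Module K B'] {mul : B →ₗ[K] B →ₗ[K] B}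
    {brace : B → List B → B} {mul' : B' →ₗ[K] B' →ₗ[K] B'} {brace' : B' → List B' → B'}
    (h : IsGV q mul' brace') (f : B →ₗ[K] B') (hf : Function.Injective f)
    (hmul : ∀ x y, f (mul x y) = mul' (f x) (f y))
    (hbrace : ∀ x l, f (brace x l) = brace' (f x) (l.map f)) : IsGV q mul brace := by
  have hfold : ∀ (l : List B) (x : B), f (l.foldl (fun a z => mul a z) x) =
      (l.map f).foldl (fun a z => mul' a z) (f x) := by
    intro l
    induction l with
    | nil => intro x; rfl
    | cons y l ih => intro x; simp [ih, hmul]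
  constructor
  · intro x x' ys; apply hf; simp [hbrace, h.brace_add_left]
  · intro c x ys; apply hf; simp [hbrace, h.brace_smul_left]
  · intro x l y y' r; apply hf; simp [hbrace, h.brace_add]
  · intro x l c y r; apply hf; simp [hbrace, h.brace_smul]
  · intro x; apply hf; simp [hbrace, h.brace_nil]
  · intro x ys zs
    apply hf
    rw [hbrace, hbrace, h.brace_brace]
    exact (map_braceSum f.toAddMonoidHom hbrace (hbrace x) ys zs).symm
  · intro x y z; apply hf; simp [hmul, h.mul_assoc]
  · intro x y zs
    apply hf
    rw [hbrace, hmul, h.brace_mul]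
    simp [hmul, hbrace, hfold, List.map_take, List.map_drop]

namespace TriOps

open TensorAlgebra Words

variable {K : Type*} {A : Type*} [Field K] [AddCommGroup A] [Module K A] {o : TriOps K A} {q : K}

theorem tensorOp_tmul (op : (A × K) →ₗ[K] (A × K) →ₗ[K] (A × K)) (a b c d : A × K) :
    o.tensorOp q op (a ⊗ₜ b) (c ⊗ₜ d) =
      o.plusStar q a c ⊗ₜ op b d + (b.2 * d.2) • (op a c ⊗ₜ one K A) := by
  have : augProd K A b d = (b.2 * d.2) • one K A := by ext <;> simp [augProd]
  simp [tensorOp, this]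

theorem tensorOp_tmul_one (op : (A × K) →ₗ[K] (A × K) →ₗ[K] (A × K))
    (hop : ∀ a, op a (one K A) = 0) (X : (A × K) ⊗[K] (A × K)) (h : A × K) :
    o.tensorOp q op X (h ⊗ₜ one K A) =
      op (TensorProduct.rid K _ ((aug K A).lTensor _ X)) h ⊗ₜ one K A := by
  induction X with
  | zero => simp
  | add a b ha hb => simp only [map_add, LinearMap.add_apply, ha, hb, TensorProduct.add_tmul]
  | tmul a b => simp [tensorOp_tmul, hop, aug, TensorProduct.smul_tmul']

theorem tensorOp_one_tmul (op : (A × K) →ₗ[K] (A × K) →ₗ[K] (A × K))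
    (X : (A × K) ⊗[K] (A × K)) (y : A) :
    o.tensorOp q op X (one K A ⊗ₜ incl K A y) = (op.flip (incl K A y)).lTensor _ X := by
  induction X with
  | zero => simp
  | add a b ha hb => simp only [map_add, LinearMap.add_apply, ha, hb]
  | tmul a b => simp [tensorOp_tmul]

theorem tensorOp_prec_tmul_one (h : A × K) (Y : (A × K) ⊗[K] (A × K)) :
    o.tensorOp q o.plusPrec (h ⊗ₜ one K A) Y =
      o.plusPrec h (TensorProduct.rid K _ ((aug K A).lTensor _ Y)) ⊗ₜ one K A := by
  induction Y with
  | zero => simp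
  | add a b ha hb => simp only [map_add, ha, hb, TensorProduct.add_tmul]
  | tmul a b => simp [tensorOp_tmul, aug, TensorProduct.smul_tmul']

theorem tensorOp_prec_one_tmul (x : A) (Y : (A × K) ⊗[K] (A × K)) :
    o.tensorOp q o.plusPrec (one K A ⊗ₜ incl K A x) Y =
      (o.plusPrec (incl K A x)).lTensor _ Y := by
  induction Y with
  | zero => simp
  | add a b ha hb => simp only [map_add, ha, hb]
  | tmul a b => simp [tensorOp_tmul]

theorem eq_incl_add (h : A × K) : h = incl K A h.1 + h.2 • one K A := by
  ext <;> simp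

section Bialgebra

variable {Δ : (A × K) →ₗ[K] (A × K) ⊗[K] (A × K)}

theorem comul_counit_right (hΔ : o.IsBialgebra q Δ) (h : A × K) :
    (aug K A).lTensor _ (Δ h) = h ⊗ₜ 1 := by
  rw [eq_incl_add h, map_add, map_add, hΔ.counit_right, map_smul, hΔ.comul_one]
  simp [aug, TensorProduct.add_tmul, TensorProduct.smul_tmul']

/-- The coproduct of `h · y` for a primitive element `y`. -/
theorem comul_plusDot_primitive (hΔ : o.IsBialgebra q Δ) {y : A}
    (hy : Δ (incl K A y) = incl K A y ⊗ₜ one K A + one K A ⊗ₜ incl K A y) (h : A × K) :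
    Δ (o.plusDot h (incl K A y)) = o.plusDot h (incl K A y) ⊗ₜ one K A +
      (o.plusDot.flip (incl K A y)).lTensor _ (Δ h) := by
  have h1 : ∀ a, Δ (o.plusDot (incl K A a) (incl K A y)) =
      o.plusDot (incl K A a) (incl K A y) ⊗ₜ one K A +
      (o.plusDot.flip (incl K A y)).lTensor _ (Δ (incl K A a)) := by
    intro a
    have := hΔ.comul_dot a y
    rw [hy, map_add, tensorOp_tmul_one _ plusDot_one_right, tensorOp_one_tmul,
      comul_counit_right hΔ] at this
    have h2 : incl K A (o.dot a y) = o.plusDot (incl K A a) (incl K A y) := rfl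
    rw [h2] at this
    simpa using this
  have h2 : o.plusDot (one K A) (incl K A y) = 0 := by ext <;> simp [plusDot_apply]
  rw [eq_incl_add h]
  simp only [map_add, map_smul, LinearMap.add_apply, LinearMap.smul_apply, h1, h2, hΔ.comul_one,
    LinearMap.lTensor_tmul, LinearMap.flip_apply, TensorProduct.tmul_zero, smul_zero,
    add_zero]

/-- The coproduct of `h ≻~ y` for a primitive element `y`. -/
theorem comul_plusTsucc_primitive (hΔ : o.IsBialgebra q Δ) {y : A}
    (hy : Δ (incl K A y) = incl K A y ⊗ₜ one K A + one K A ⊗ₜ incl K A y) (h : A × K) :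
    Δ (o.plusTsucc q h (incl K A y)) = o.plusTsucc q h (incl K A y) ⊗ₜ one K A +
      ((o.plusTsucc q).flip (incl K A y)).lTensor _ (Δ h) := by
  have h0 : ∀ a, o.plusSucc a (one K A) = 0 := by intro a; ext <;> simp [plusSucc_apply]
  have h1 : ∀ a, Δ (o.plusSucc (incl K A a) (incl K A y)) =
      o.plusSucc (incl K A a) (incl K A y) ⊗ₜ one K A +
      (o.plusSucc.flip (incl K A y)).lTensor _ (Δ (incl K A a)) := by
    intro a
    have := hΔ.comul_succ a y
    rw [hy, map_add, tensorOp_tmul_one _ h0, tensorOp_one_tmul,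
      comul_counit_right hΔ] at this
    have h2 : incl K A (o.succ a y) = o.plusSucc (incl K A a) (incl K A y) := by
      ext <;> simp [plusSucc_apply]
    rw [← h2]
    simpa [← h2] using this
  have h3 : o.plusSucc (one K A) (incl K A y) = incl K A y := by
    ext <;> simp [plusSucc_apply]
  have h4 : ∀ h, Δ (o.plusSucc h (incl K A y)) = o.plusSucc h (incl K A y) ⊗ₜ one K A +
      (o.plusSucc.flip (incl K A y)).lTensor _ (Δ h) := by
    intro h
    rw [eq_incl_add h]
    simp only [map_add, map_smul, LinearMap.add_apply, LinearMap.smul_apply, h1, h3, hΔ.comul_one,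
      LinearMap.lTensor_tmul, LinearMap.flip_apply, hy, TensorProduct.add_tmul, smul_add,
      TensorProduct.smul_tmul']
    abel
  have h5 : (o.plusTsucc q).flip (incl K A y) =
      q • o.plusDot.flip (incl K A y) + o.plusSucc.flip (incl K A y) := rfl
  have h6 : o.plusTsucc q h (incl K A y) =
      q • o.plusDot h (incl K A y) + o.plusSucc h (incl K A y) := rfl
  rw [h5, h6, map_add, map_smul, h4, comul_plusDot_primitive hΔ hy, LinearMap.lTensor_add,
    LinearMap.lTensor_smul, TensorProduct.add_tmul]
  simp only [LinearMap.add_apply, LinearMap.smul_apply, smul_add, TensorProduct.smul_tmul']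
  abel

/-- The coproduct of `x ≺ h` for a primitive element `x`. -/
theorem comul_plusPrec_primitive (hΔ : o.IsBialgebra q Δ) {x : A}
    (hx : Δ (incl K A x) = incl K A x ⊗ₜ one K A + one K A ⊗ₜ incl K A x) (h : A × K) :
    Δ (o.plusPrec (incl K A x) h) = o.plusPrec (incl K A x) h ⊗ₜ one K A +
      (o.plusPrec (incl K A x)).lTensor _ (Δ h) := by
  have h1 : ∀ a, Δ (o.plusPrec (incl K A x) (incl K A a)) =
      o.plusPrec (incl K A x) (incl K A a) ⊗ₜ one K A +
      (o.plusPrec (incl K A x)).lTensor _ (Δ (incl K A a)) := by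
    intro a
    have := hΔ.comul_prec x a
    rw [hx, map_add, LinearMap.add_apply, tensorOp_prec_tmul_one, tensorOp_prec_one_tmul,
      comul_counit_right hΔ] at this
    have h2 : incl K A (o.prec x a) = o.plusPrec (incl K A x) (incl K A a) := by
      ext <;> simp [plusPrec_apply]
    rw [← h2]
    simpa [← h2] using this
  rw [eq_incl_add h]
  simp only [map_add, map_smul, h1, hΔ.comul_one, plusPrec_one_right, hx, LinearMap.lTensor_tmul,
    TensorProduct.add_tmul, smul_add, TensorProduct.smul_tmul']
  abel

variable {B : Type*} [AddCommGroup B] [Module K B] {i : B →ₗ[K] A}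

/-- If the letters are sent to primitive elements, then `wordMap` is a morphism of coalgebras. -/
theorem comul_wordMap (hΔ : o.IsBialgebra q Δ)
    (hi : ∀ b, Δ (incl K A (i b)) = incl K A (i b) ⊗ₜ one K A + one K A ⊗ₜ incl K A (i b))
    (t : TensorAlgebra K B) :
    Δ (o.wordMap q i t) = TensorProduct.map (o.wordMap q i) (o.wordMap q i) (decon t) := by
  induction t using snoc_induction with
  | add a b ha hb => simp only [map_add, ha, hb]
  | smul c a ha => simp only [map_smul, ha]
  | one => simp [hΔ.comul_one]
  | snoc u y ih =>
    rw [wordMap_snoc, comul_plusTsucc_primitive hΔ (hi y), ih, decon_snoc', map_add,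
      TensorProduct.map_tmul, wordMap_snoc, wordMap_one]
    congr 1
    induction decon u with
    | zero => simp
    | add a b ha hb => simp only [map_add, LinearMap.add_apply, ha, hb]
    | tmul a b => simp

/-- The brace operations of primitive elements are primitive. By induction on the length of `l`, all
terms of the coproduct of `x ≺ ω(l) = ∑ ω(l₁) ≻~ M(x; l₂)` except for `M(x; l)` itself are known. -/
theorem comul_braceMap (ho : o.IsTridend q) (hΔ : o.IsBialgebra q Δ)
    (hi : ∀ b, Δ (incl K A (i b)) = incl K A (i b) ⊗ₜ one K A + one K A ⊗ₜ incl K A (i b))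
    (x : B) (l : List B) : Δ (incl K A (o.braceMap q i x (word l))) =
      incl K A (o.braceMap q i x (word l)) ⊗ₜ one K A +
        one K A ⊗ₜ incl K A (o.braceMap q i x (word l)) := by
  suffices H : ∀ n, ∀ l : List B, l.length = n →
      Δ (incl K A (o.braceMap q i x (word l))) =
      incl K A (o.braceMap q i x (word l)) ⊗ₜ one K A +
        one K A ⊗ₜ incl K A (o.braceMap q i x (word l)) from H _ l rfl
  clear l
  intro n
  induction n using Nat.strong_induction_on with
  | _ n ih =>
    intro l hl
    set M := o.braceMap q i with hM
    -- the value of the coproduct predicted for primitive braces, summed over all splittings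
    let γ : ((A × K) ⊗[K] (A × K)) →ₗ[K] (A × K) →ₗ[K] ((A × K) ⊗[K] (A × K)) :=
      (LinearMap.lTensorHom _ ∘ₗ (o.plusTsucc q).flip).flip
    have h1 : Δ (o.plusPrec (incl K A (i x)) (o.wordMap q i (word l))) =
        o.plusPrec (incl K A (i x)) (o.wordMap q i (word l)) ⊗ₜ one K A +
          conv γ (TensorProduct.map (o.wordMap q i) (o.wordMap q i) ∘ₗ decon)
            (incl K A ∘ₗ M x) (word l) := by
      rw [comul_plusPrec_primitive hΔ (hi x), comul_wordMap hΔ hi]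
      congr 1
      have h2 : TensorProduct.map (o.wordMap q i) (o.wordMap q i) ∘ₗ decon =
          conv (TensorProduct.mk K _ _) (o.wordMap q i) (o.wordMap q i) := by
        have h := TensorProduct.lift_mk (R := K) (M := A × K) (N := A × K)
        rw [conv, ← LinearMap.comp_assoc, h, LinearMap.id_comp]
      have h3 : conv γ (conv (TensorProduct.mk K _ _) (o.wordMap q i) (o.wordMap q i))
          (incl K A ∘ₗ M x) = conv (TensorProduct.mk K _ _) (o.wordMap q i)
            (conv (o.plusTsucc q) (o.wordMap q i) (incl K A ∘ₗ M x)) :=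
        conv_assoc (by intro a b c; simp [γ])
      have h4 : conv (o.plusTsucc q) (o.wordMap q i) (incl K A ∘ₗ M x) =
          o.plusPrec (incl K A (i x)) ∘ₗ o.wordMap q i :=
        (LinearMap.ext (plusPrec_wordMap i ho x)).symm
      rw [h2, h3, h4, conv_apply]
      induction decon (word (K := K) l) with
      | zero => simp
      | add a b ha hb => simp only [map_add, ha, hb]
      | tmul a b => rfl
    rw [plusPrec_wordMap i ho, conv_word, conv_word, map_sum, Finset.sum_range_succ',
      Finset.sum_range_succ' _ l.length, Finset.sum_range_succ' _ l.length,
      TensorProduct.add_tmul, TensorProduct.sum_tmul] at h1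
    have h5 : ∀ k ∈ Finset.range l.length,
        Δ (o.plusTsucc q (o.wordMap q i (word (l.take (k + 1))))
          ((incl K A ∘ₗ M x) (word (l.drop (k + 1))))) =
        o.plusTsucc q (o.wordMap q i (word (l.take (k + 1))))
          ((incl K A ∘ₗ M x) (word (l.drop (k + 1)))) ⊗ₜ one K A +
        γ ((TensorProduct.map (o.wordMap q i) (o.wordMap q i) ∘ₗ decon) (word (l.take (k + 1))))
          ((incl K A ∘ₗ M x) (word (l.drop (k + 1)))) := by
      intro k hk
      have hk' := Finset.mem_range.1 hk
      rw [LinearMap.comp_apply, comul_plusTsucc_primitive hΔ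
        (ih (l.length - (k + 1)) (by omega) (l.drop (k + 1)) (by simp)), comul_wordMap hΔ hi]
      rfl
    rw [Finset.sum_congr rfl h5, Finset.sum_add_distrib] at h1
    simp only [List.take_zero, List.drop_zero, word_nil, wordMap_one, LinearMap.comp_apply,
      plusTsucc_one_left, decon_one, TensorProduct.map_tmul] at h1
    have h6 : γ (one K A ⊗ₜ[K] one K A) (incl K A (M x (word l))) =
        one K A ⊗ₜ incl K A (M x (word l)) := by simp [γ]
    rw [h6] at h1
    refine add_left_cancel (h1.trans ?_)
    abel

end Bialgebra

end TriOps

namespace TriBialg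

variable {K : Type u} [Field K] {q : K}

/-- The primitive elements are closed under the operations, hence inherit the structure of a `GV_q`
algebra from `TriOps.isGV`. -/
theorem primIsGV (H : TriBialg.{u, v} K q) : H.PrimIsGV := by
  have hi : ∀ b : H.prim, H.comul (TriOps.incl K H (H.prim.subtype b)) =
      TriOps.incl K H (H.prim.subtype b) ⊗ₜ TriOps.one K H +
        TriOps.one K H ⊗ₜ TriOps.incl K H (H.prim.subtype b) := fun b => (H.mem_prim _).1 b.2
  have hc : H.PrimClosed := by
    refine ⟨fun x hx y hy => ?_, fun x hx ys hys => ?_⟩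
    · rw [mem_prim]
      have h := TriOps.comul_plusDot_primitive H.isBialgebra ((H.mem_prim y).1 hy)
        (TriOps.incl K H x)
      have h1 : H.ops.plusDot (TriOps.incl K H x) (TriOps.incl K H y) =
        TriOps.incl K H (H.ops.dot x y) := rfl
      have h2 : H.ops.plusDot (TriOps.one K H) (TriOps.incl K H y) = 0 := by
        ext <;> simp [TriOps.plusDot_apply]
      rw [(H.mem_prim x).1 hx, h1] at h
      simpa [h1, h2] using h
    · lift ys to List H.prim using hys
      have h := TriOps.comul_braceMap H.isTridend H.isBialgebra hi ⟨x, hx⟩ ys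
      rw [TriOps.braceMap_word] at h
      rw [mem_prim]
      exact h
  refine ⟨hc, (TriOps.isGV H.isTridend).of_injective H.prim.subtype Subtype.val_injective ?_ ?_⟩
  · intro x y; rfl
  · intro x l; rfl

end TriBialg

/-! ### The words over a `GV_q` algebra form a tridendriform algebra -/

namespace GVAlg

open TensorAlgebra Words

variable {K : Type u} [Field K] {q : K} (B : GVAlg.{u, v} K q)

theorem brace_mem_listMultilinear (x : B) : B.brace x ∈ listMultilinear K B B :=
  ⟨B.isGV.brace_add x, B.isGV.brace_smul x⟩

/-- The brace operations of a `GV_q` algebra, as a bilinear map on letters and words. -/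
def braceHom : B →ₗ[K] TensorAlgebra K B →ₗ[K] B where
  toFun x := ofList (B.brace x) (B.brace_mem_listMultilinear x)
  map_add' x x' := ext_word fun l => by simp [B.isGV.brace_add_left]
  map_smul' c x := ext_word fun l => by simp [B.isGV.brace_smul_left]

@[simp] theorem braceHom_word (x : B) (l : List B) : B.braceHom x (word l) = B.brace x l := by
  simp [braceHom]

theorem braceHom_one (x : B) : B.braceHom x 1 = x := by
  rw [← word_nil, braceHom_word, B.isGV.brace_nil]

/-- The brace identities, in terms of the product of words. -/
theorem braceHom_braceHom (x : B) (s t : TensorAlgebra K B) :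
    B.braceHom (B.braceHom x s) t = B.braceHom x (star B.braceHom s t) := by
  induction s using word_induction with
  | add a b ha hb => simp only [map_add, LinearMap.add_apply, ha, hb]
  | smul c a ha => simp only [map_smul, LinearMap.smul_apply, ha]
  | word ys =>
    induction t using word_induction with
    | add a b ha hb => simp only [map_add, ha, hb]
    | smul c a ha => simp only [map_smul, ha]
    | word zs =>
      rw [← braceSum_eq B.braceHom_word (B.braceHom x), braceHom_word, braceHom_word,
        B.isGV.brace_brace]
      simp only [braceHom_word]

/-- The distributive relation, as an identity between convolutions. -/
theorem braceHom_mul (x y : B) (t : TensorAlgebra K B) : B.braceHom (B.mul x y) t =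
    conv B.mul (conv (mulWord q B.mul) (B.braceHom x) LinearMap.id) (B.braceHom y) t := by
  induction t using word_induction with
  | add a b ha hb => simp only [map_add, ha, hb]
  | smul c a ha => simp only [map_smul, ha]
  | word zs => rw [conv_mulWord_word B.braceHom_word, braceHom_word, B.isGV.brace_mul]

/-- A linear map from a `GV_q` algebra to a tridendriform algebra that preserves the operations
of a `GV_q` algebra. -/
structure IsHomTo {A : Type*} [AddCommGroup A] [Module K A] (o : TriOps K A) (i : B →ₗ[K] A) :
    Prop where
  map_mul : ∀ x y, i (B.mul x y) = o.dot (i x) (i y)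
  map_brace : ∀ x l, i (B.brace x l) = o.brace q (i x) (l.map i)

variable {B}

theorem IsHomTo.braceMap {A : Type*} [AddCommGroup A] [Module K A] {o : TriOps K A}
    {i : B →ₗ[K] A} (h : B.IsHomTo o i) (x : B) (t : TensorAlgebra K B) :
    o.braceMap q i x t = i (B.braceHom x t) := by
  induction t using word_induction with
  | add a b ha hb => simp only [map_add, ha, hb]
  | smul c a ha => simp only [map_smul, ha]
  | word l => rw [o.braceMap_word, braceHom_word, h.map_brace]

variable (B)

/-- The words of positive length. -/
abbrev PosWords : Type (max u v) := LinearMap.ker (eps (K := K) (B := B))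

/-- A bilinear operation on words without constant term, as an operation on `PosWords`. -/
def posOp (f : TensorAlgebra K B →ₗ[K] TensorAlgebra K B →ₗ[K] TensorAlgebra K B)
    (hf : ∀ r s, eps (f r s) = 0) : B.PosWords →ₗ[K] B.PosWords →ₗ[K] B.PosWords :=
  LinearMap.mk₂ K (fun r s => ⟨f r s, hf r s⟩)
    (by intros; ext; simp) (by intros; ext; simp) (by intros; ext; simp) (by intros; ext; simp)

/-- The three operations on the words of positive length. -/
def posOps : TriOps K B.PosWords where
  prec := B.posOp (prec B.braceHom) (eps_prec _)
  dot := B.posOp (dot q B.mul B.braceHom) (eps_dot _ _ _)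
  succ := B.posOp (tsucc B.braceHom - q • dot q B.mul B.braceHom) (by intro r s; simp)

theorem posOps_prec (r s : B.PosWords) :
    (B.posOps.prec r s : TensorAlgebra K B) = prec B.braceHom r s := rfl

theorem posOps_dot (r s : B.PosWords) :
    (B.posOps.dot r s : TensorAlgebra K B) = dot q B.mul B.braceHom r s := rfl

theorem posOps_succ (r s : B.PosWords) : (B.posOps.succ r s : TensorAlgebra K B) =
    tsucc B.braceHom r s - q • dot q B.mul B.braceHom r s := rfl

/-- The words of positive length over a `GV_q` algebra form a tridendriform algebra. -/
theorem isTridend_posOps : B.posOps.IsTridend q := by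
  have hM := B.braceHom_one
  have hact := B.braceHom_braceHom
  have hmul := B.braceHom_mul
  have hstar : ∀ a b : B.PosWords,
      Words.star B.braceHom (a : TensorAlgebra K B) (b : TensorAlgebra K B) =
        prec B.braceHom (a : TensorAlgebra K B) (b : TensorAlgebra K B) +
          tsucc B.braceHom (a : TensorAlgebra K B) (b : TensorAlgebra K B) := by
    intro a b
    rw [star_eq, a.2, zero_mul, zero_smul, add_zero]
  constructor
  · intro a b c
    ext
    simp only [posOps_prec, posOps_succ, posOps_dot, Submodule.coe_add, Submodule.coe_smul,
      prec_prec hM hact]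
    rw [hstar]
    congr 1
    abel
  · intro a b c
    ext
    simp only [posOps_prec, posOps_succ, map_sub, map_smul, LinearMap.sub_apply,
      LinearMap.smul_apply, tsucc_prec hM hact, dot_prec hM hact hmul]
  · intro a b c
    ext
    have h1 : ((B.posOps.prec a b + B.posOps.succ a b + q • B.posOps.dot a b : B.PosWords) :
        TensorAlgebra K B) = star B.braceHom a b := by
      simp only [posOps_prec, posOps_succ, posOps_dot, Submodule.coe_add, Submodule.coe_smul,
        hstar]
      abel
    rw [posOps_succ, h1, tsucc_tsucc hM hact, posOps_succ, posOps_succ, hstar]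
    simp only [map_add, map_sub, map_smul, LinearMap.add_apply, tsucc_dot hM hact,
      dot_tsucc hM hact hmul, precT_apply, dot_dot hM hact hmul B.isGV.mul_assoc,
      LinearMap.smul_apply]
    module
  · intro a b c
    ext
    simp only [posOps_dot, dot_dot hM hact hmul B.isGV.mul_assoc]
  · intro a b c
    ext
    simp only [posOps_dot, posOps_succ, map_sub, map_smul, LinearMap.sub_apply,
      LinearMap.smul_apply, tsucc_dot hM hact, dot_dot hM hact hmul B.isGV.mul_assoc]
  · intro a b c
    ext
    simp only [posOps_dot, posOps_succ, posOps_prec, map_sub, map_smul, precT_apply,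
      dot_tsucc hM hact hmul, map_add, LinearMap.add_apply, LinearMap.smul_apply,
      dot_dot hM hact hmul B.isGV.mul_assoc, add_sub_cancel_right]
  · intro a b c
    ext
    simp only [posOps_dot, posOps_prec, dot_prec hM hact hmul]

/-- The letters as words. -/
def letter : B →ₗ[K] B.PosWords := (ι K).codRestrict _ (by
  intro y
  have := eps_snoc (K := K) 1 y
  rwa [one_mul] at this)

@[simp] theorem letter_val (y : B) : (B.letter y : TensorAlgebra K B) = ι K y := rfl

/-- The identification of `A₊`, for `A` the words of positive length, with all words. -/
def posAdd : B.PosWords × K →ₗ[K] TensorAlgebra K B :=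
  (Submodule.subtype _).coprod (LinearMap.toSpanSingleton K _ 1)

theorem posAdd_apply (a : B.PosWords × K) : B.posAdd a = a.1 + a.2 • 1 := rfl

theorem posAdd_injective : Function.Injective B.posAdd := by
  rw [← LinearMap.ker_eq_bot, LinearMap.ker_eq_bot']
  intro a ha
  have h1 : eps (B.posAdd a) = a.2 := by
    rw [posAdd_apply, map_add, a.1.2]; simp
  rw [ha, map_zero] at h1
  rw [posAdd_apply, ← h1, zero_smul, add_zero] at ha
  ext
  · simpa using ha
  · simpa using h1.symm

theorem posAdd_plusPrec (a b : B.PosWords × K) :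
    B.posAdd (B.posOps.plusPrec a b) = prec B.braceHom (B.posAdd a) (B.posAdd b) := by
  simp only [posAdd_apply, TriOps.plusPrec_apply, Submodule.coe_add, posOps_prec,
    Submodule.coe_smul, map_add, map_smul, LinearMap.add_apply, LinearMap.smul_apply,
    prec_one_left, prec_one_right B.braceHom_one]
  simp

theorem posAdd_plusTsucc (a b : B.PosWords × K) :
    B.posAdd (B.posOps.plusTsucc q a b) = tsucc B.braceHom (B.posAdd a) (B.posAdd b) := by
  have h : tsucc B.braceHom 1 (b.1 : TensorAlgebra K B) = b.1 := by
    have := star_eq B.braceHom 1 (b.1 : TensorAlgebra K B)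
    rw [b.1.2, mul_zero, zero_smul, add_zero, star_one_left, prec_one_left, zero_add] at this
    exact this.symm
  simp only [posAdd_apply, TriOps.plusTsucc_apply, Submodule.coe_add, posOps_succ, posOps_dot,
    Submodule.coe_smul, map_add, map_smul, LinearMap.add_apply, LinearMap.smul_apply,
    tsucc_one_right, h]
  simp only [smul_zero, add_zero, zero_smul]
  abel

/-- In the tridendriform algebra of words, a word is the iterated `≻~` of its letters. -/
theorem posAdd_wordMap (t : TensorAlgebra K B) : B.posAdd (B.posOps.wordMap q B.letter t) = t := by
  induction t using snoc_induction with
  | add a b ha hb => simp only [map_add, ha, hb]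
  | smul c a ha => simp only [map_smul, ha]
  | one => simp [posAdd_apply]
  | snoc u y ih =>
    rw [TriOps.wordMap_snoc, posAdd_plusTsucc, ih]
    have h : B.posAdd (TriOps.incl K B.PosWords (B.letter y)) = 1 * ι K y := by
      simp [posAdd_apply]
    rw [h, tsucc_snoc, star_one_right B.braceHom_one]

/-- The braces of letters in the tridendriform algebra of words are those of `B`. -/
theorem isHomTo_letter : B.IsHomTo B.posOps B.letter := by
  refine ⟨fun x y => ?_, fun x l => ?_⟩
  · ext
    have h : ∀ z : B, ι K z = 1 * ι K z := by simp
    rw [posOps_dot, letter_val, letter_val, letter_val, h y, dot_snoc,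
      precT_one_right B.braceHom_one, h x, eps_snoc, zero_smul, sub_zero, rmul_snoc, ← h]
  · rw [← TriOps.braceMap_word, ← braceHom_word]
    refine (TriOps.eq_of_conv_wordMap (o := B.posOps) (q := q)
      (E' := B.letter ∘ₗ B.braceHom x) B.letter (fun t => ?_) _).symm
    rw [← TriOps.plusPrec_wordMap _ B.isTridend_posOps]
    apply B.posAdd_injective
    have h : B.posAdd (TriOps.incl K B.PosWords (B.letter x)) = 1 * ι K x := by
      simp [posAdd_apply]
    rw [posAdd_plusPrec, posAdd_wordMap, h, prec_snoc, map_conv]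
    refine LinearMap.congr_fun (conv_congr fun a b => ?_) t
    have h : B.posAdd (TriOps.incl K B.PosWords (B.letter (B.braceHom x b))) =
        1 * ι K (B.braceHom x b) := by
      simp [posAdd_apply]
    simp only [LinearMap.compr₂_apply, posAdd_plusTsucc, LinearMap.comp_apply, h, posAdd_wordMap,
      tsucc_snoc, star_one_right B.braceHom_one, star_one_left, snoc_apply]

end GVAlg

/-! ### Morphisms of tridendriform algebras and the enveloping algebra -/

namespace TriOps

open TensorAlgebra Words

section Hom

variable {K : Type*} [Field K] {A A' : Type*} [AddCommGroup A] [Module K A]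
  [AddCommGroup A'] [Module K A']

/-- A linear map that preserves the three operations. -/
structure IsHom (o : TriOps K A) (o' : TriOps K A') (f : A →ₗ[K] A') : Prop where
  map_prec : ∀ x y, f (o.prec x y) = o'.prec (f x) (f y)
  map_dot : ∀ x y, f (o.dot x y) = o'.dot (f x) (f y)
  map_succ : ∀ x y, f (o.succ x y) = o'.succ (f x) (f y)

variable {o : TriOps K A} {o' : TriOps K A'} {q : K} {f : A →ₗ[K] A'}

/-- The unital extension `A₊ → A'₊` of a linear map `A → A'`. -/
abbrev plusMap (f : A →ₗ[K] A') : A × K →ₗ[K] A' × K := f.prodMap LinearMap.id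

@[simp] theorem plusMap_incl (f : A →ₗ[K] A') (a : A) :
    plusMap f (incl K A a) = incl K A' (f a) := by
  ext <;> simp

@[simp] theorem plusMap_one (f : A →ₗ[K] A') : plusMap f (one K A) = one K A' := by
  ext <;> simp

theorem IsHom.plusPrec (h : o.IsHom o' f) (a b : A × K) :
    plusMap f (o.plusPrec a b) = o'.plusPrec (plusMap f a) (plusMap f b) := by
  ext <;> simp [plusPrec_apply, h.map_prec]

theorem IsHom.plusTsucc (h : o.IsHom o' f) (a b : A × K) :
    plusMap f (o.plusTsucc q a b) = o'.plusTsucc q (plusMap f a) (plusMap f b) := by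
  ext <;> simp [plusTsucc_apply, h.map_succ, h.map_dot]

theorem IsHom.isIdeal_ker (h : o.IsHom o' f) : o.IsIdeal (LinearMap.ker f) := by
  intro x hx y
  rw [LinearMap.mem_ker] at hx
  simp [LinearMap.mem_ker, h.map_prec, h.map_dot, h.map_succ, hx]

theorem idealSpan_le {S : Set A} {I : Submodule K A} (hS : S ⊆ I) (hI : o.IsIdeal I) :
    o.idealSpan S ≤ I :=
  sInf_le ⟨hS, hI⟩

theorem IsHom.liftQ (h : o.IsHom o' f) {I : Submodule K A} (hI : o.IsIdeal I)
    (hf : I ≤ LinearMap.ker f) : (o.quot I hI).IsHom o' (I.liftQ f hf) := by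
  constructor <;> intro x y <;> obtain ⟨x, rfl⟩ := I.mkQ_surjective x <;>
    obtain ⟨y, rfl⟩ := I.mkQ_surjective y
  · rw [quot_prec]; simp [h.map_prec]
  · rw [quot_dot]; simp [h.map_dot]
  · rw [quot_succ]; simp [h.map_succ]

variable {B : Type*} [AddCommGroup B] [Module K B] {i : B →ₗ[K] A}

theorem IsHom.wordMap (h : o.IsHom o' f) (t : TensorAlgebra K B) :
    plusMap f (o.wordMap q i t) = o'.wordMap q (f ∘ₗ i) t := by
  induction t using snoc_induction with
  | add a b ha hb => simp only [map_add, ha, hb]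
  | smul c a ha => simp only [map_smul, ha]
  | one => rw [wordMap_one, wordMap_one, plusMap_one]
  | snoc u y ih => rw [wordMap_snoc, wordMap_snoc, h.plusTsucc, ih, plusMap_incl]; rfl

theorem IsHom.antiWordMap (h : o.IsHom o' f) (t : TensorAlgebra K B) :
    plusMap f (o.antiWordMap i t) = o'.antiWordMap (f ∘ₗ i) t := by
  induction t using cons_induction with
  | add a b ha hb => simp only [map_add, ha, hb]
  | smul c a ha => simp only [map_smul, ha]
  | one => rw [antiWordMap_one, antiWordMap_one, plusMap_one]
  | cons y u ih =>
    rw [antiWordMap_cons, antiWordMap_cons, map_neg, h.plusPrec, ih, plusMap_incl]; rfl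

theorem IsHom.map_brace (h : o.IsHom o' f) (x : A) (l : List A) :
    f (o.brace q x l) = o'.brace q (f x) (l.map f) := by
  have h1 := o.braceMap_word q LinearMap.id x l
  have h2 := o'.braceMap_word q f x l
  rw [← h2]
  have h3 : o.brace q x l = o.braceMap q LinearMap.id x (word l) := by simpa using h1.symm
  rw [h3]
  have h4 := congrArg (plusMap f) (o.incl_braceMap q LinearMap.id x (word l))
  rw [plusMap_incl, map_conv] at h4
  have h5 := o'.incl_braceMap q f x (word l)
  have h6 : incl K A' (f (o.braceMap q LinearMap.id x (word l))) =
      incl K A' (o'.braceMap q f x (word l)) := by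
    rw [h4, h5]
    refine LinearMap.congr_fun (conv_congr fun a b => ?_) _
    have h7 := h.antiWordMap (i := LinearMap.id) a
    have h8 := h.wordMap (q := q) (i := LinearMap.id) b
    rw [LinearMap.comp_id] at h7 h8
    simp only [LinearMap.compr₂_apply, LinearMap.comp_apply, LinearMap.flip_apply, h.plusPrec,
      h.plusTsucc, plusMap_incl, h7, h8, LinearMap.id_apply]
  simpa using congrArg Prod.fst h6

end Hom

end TriOps

/-! #### The free tridendriform algebra -/

section Free

variable {K : Type u} [Field K] {V : Type v} {A : Type w} [AddCommGroup A] [Module K A]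

@[simp] theorem freeOp_single {X : Type v} (m : X → X → X) (s t : X) (a b : K) :
    freeOp K m (Finsupp.single s a) (Finsupp.single t b) = Finsupp.single (m s t) (a * b) := by
  simp [freeOp, Finsupp.lift_apply, Finsupp.lmapDomain_apply, Finsupp.mapDomain_single]

/-- The value of a formal expression in a tridendriform algebra. -/
def TriTerm.eval (o : TriOps K A) (i : V → A) : TriTerm V → A
  | leaf v => i v
  | prec s t => o.prec (s.eval o i) (t.eval o i)
  | dot s t => o.dot (s.eval o i) (t.eval o i)
  | succ s t => o.succ (s.eval o i) (t.eval o i)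

theorem freeOp_hom {X : Type v} (m : X → X → X) (e : X → A) (f : A →ₗ[K] A →ₗ[K] A)
    (h : ∀ s t, e (m s t) = f (e s) (e t)) (a b : X →₀ K) :
    Finsupp.linearCombination K e (freeOp K m a b) =
      f (Finsupp.linearCombination K e a) (Finsupp.linearCombination K e b) := by
  induction a using Finsupp.induction_linear with
  | zero => simp
  | add a a' ha ha' => simp only [map_add, LinearMap.add_apply, ha, ha']
  | single s c =>
    induction b using Finsupp.induction_linear with
    | zero => simp
    | add a a' ha ha' => simp only [map_add, ha, ha']
    | single t d =>
      rw [freeOp_single, Finsupp.linearCombination_single, Finsupp.linearCombination_single,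
        Finsupp.linearCombination_single, h, map_smul, map_smul, LinearMap.smul_apply, smul_smul,
        mul_comm]

theorem isHom_eval (o : TriOps K A) (i : V → A) :
    (termOps K V).IsHom o (Finsupp.linearCombination K (TriTerm.eval o i)) :=
  ⟨freeOp_hom _ _ _ (fun _ _ => rfl), freeOp_hom _ _ _ (fun _ _ => rfl),
    freeOp_hom _ _ _ (fun _ _ => rfl)⟩

variable {q : K} [AddCommGroup V] [Module K V]

/-- A linear map to a tridendriform algebra satisfies the relations of the free one. -/
theorem tridendIdeal_le_ker {o : TriOps K A} (ho : o.IsTridend q) (i : V →ₗ[K] A) :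
    tridendIdeal q V ≤ LinearMap.ker (Finsupp.linearCombination K (TriTerm.eval o i)) := by
  have h := isHom_eval (V := V) o i
  refine TriOps.idealSpan_le ?_ h.isIdeal_ker
  rintro a (⟨v, w⟩ | ⟨c, v⟩ | ⟨a, b, c⟩ | ⟨a, b, c⟩ | ⟨a, b, c⟩ | ⟨a, b, c⟩ | ⟨a, b, c⟩ |
    ⟨a, b, c⟩ | ⟨a, b, c⟩) <;> rw [SetLike.mem_coe, LinearMap.mem_ker, map_sub, sub_eq_zero]
  · simp [TriTerm.eval]
  · simp [TriTerm.eval]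
  · simp only [h.map_prec, h.map_dot, h.map_succ, map_add, map_smul, ho.prec_prec]
  · simp only [h.map_prec, h.map_succ, ho.succ_prec]
  · rw [h.map_succ _ c, map_add (Finsupp.linearCombination K _),
      map_add (Finsupp.linearCombination K _), map_smul (Finsupp.linearCombination K _),
      h.map_prec, h.map_dot, h.map_succ a b, ho.succ_succ, h.map_succ a, h.map_succ b]
  · simp only [h.map_dot, ho.dot_dot]
  · simp only [h.map_dot, h.map_succ, ho.succ_dot]
  · simp only [h.map_dot, h.map_prec, h.map_succ, ho.prec_dot]
  · simp only [h.map_dot, h.map_prec, ho.dot_prec]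

/-- The extension of a linear map `V → A` to the free tridendriform algebra on `V`. -/
def tridendLift {o : TriOps K A} (ho : o.IsTridend q) (i : V →ₗ[K] A) :
    tridendFree q V →ₗ[K] A :=
  (tridendIdeal q V).liftQ _ (tridendIdeal_le_ker ho i)

theorem isHom_tridendLift {o : TriOps K A} (ho : o.IsTridend q) (i : V →ₗ[K] A) :
    (tridendFree q V).ops.IsHom o (tridendLift ho i) :=
  (isHom_eval o i).liftQ (TriOps.isIdeal_idealSpan _ _) _

theorem tridendLift_of {o : TriOps K A} (ho : o.IsTridend q) (i : V →ₗ[K] A) (v : V) :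
    tridendLift ho i (tridendOf q V v) = i v := by
  have : tridendLift ho i (tridendOf q V v) =
    Finsupp.linearCombination K (TriTerm.eval o i) (Finsupp.single (.leaf v) 1) := rfl
  rw [this]
  simp [TriTerm.eval]

/-- The free tridendriform algebra is generated by its letters. -/
theorem tridendFree_generated {P : Submodule K (tridendFree q V)}
    (hof : ∀ v, tridendOf q V v ∈ P)
    (hprec : ∀ x ∈ P, ∀ y ∈ P, (tridendFree q V).ops.prec x y ∈ P)
    (hdot : ∀ x ∈ P, ∀ y ∈ P, (tridendFree q V).ops.dot x y ∈ P)
    (hsucc : ∀ x ∈ P, ∀ y ∈ P, (tridendFree q V).ops.succ x y ∈ P)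
    (x : tridendFree q V) : x ∈ P := by
  have h : ∀ t : TriTerm V, (tridendIdeal q V).mkQ (Finsupp.single t 1) ∈ P := by
    intro t
    induction t with
    | leaf v => exact hof v
    | prec s t hs ht =>
      have := hprec _ hs _ ht
      rw [TriOps.quot_prec] at this
      simpa [termOps] using this
    | dot s t hs ht =>
      have := hdot _ hs _ ht
      rw [TriOps.quot_dot] at this
      simpa [termOps] using this
    | succ s t hs ht =>
      have := hsucc _ hs _ ht
      rw [TriOps.quot_succ] at this
      simpa [termOps] using this
  obtain ⟨x, rfl⟩ := (tridendIdeal q V).mkQ_surjective x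
  induction x using Finsupp.induction_linear with
  | zero => rw [map_zero]; exact zero_mem _
  | add a b ha hb => rw [map_add]; exact add_mem ha hb
  | single t c =>
    have : Finsupp.single t c = c • Finsupp.single t (1 : K) := by simp
    rw [this, map_smul]
    exact P.smul_mem c (h t)

end Free

/-! #### The enveloping algebra -/

section Env

variable {K : Type u} [Field K] {q : K} (B : GVAlg.{u, v} K q)

/-- By definition of the ideal, `B → U_qGV(B)` preserves the operations of a `GV_q` algebra. -/
theorem isHomTo_envOf : B.IsHomTo (env B).ops (envOf B) := by
  have hq : (tridendFree q B).ops.IsHom (env B).ops (envIdeal B).mkQ :=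
    ⟨fun _ _ => rfl, fun _ _ => rfl, fun _ _ => rfl⟩
  refine ⟨fun x y => ?_, fun x l => ?_⟩
  · have h : (envIdeal B).mkQ (tridendOf q B (B.mul x y)) =
        (envIdeal B).mkQ ((tridendFree q B).ops.dot (tridendOf q B x) (tridendOf q B y)) :=
      (Submodule.Quotient.eq _).2 (TriOps.subset_idealSpan _ _ (EnvRel.mul x y))
    exact h
  · have h : (envIdeal B).mkQ (tridendOf q B (B.brace x l)) =
        (envIdeal B).mkQ ((tridendFree q B).ops.brace q (tridendOf q B x)
          (l.map (tridendOf q B))) :=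
      (Submodule.Quotient.eq _).2 (TriOps.subset_idealSpan _ _ (EnvRel.brace x l))
    rw [hq.map_brace, List.map_map] at h
    exact h

variable {B} {A : Type w} [AddCommGroup A] [Module K A]

theorem envIdeal_le_ker {o : TriOps K A} (ho : o.IsTridend q) {i : B →ₗ[K] A}
    (hi : B.IsHomTo o i) : envIdeal B ≤ LinearMap.ker (tridendLift ho i) := by
  have h := isHom_tridendLift ho i
  refine TriOps.idealSpan_le ?_ h.isIdeal_ker
  rintro a (⟨x, ys⟩ | ⟨x, y⟩) <;> rw [SetLike.mem_coe, LinearMap.mem_ker, map_sub, sub_eq_zero]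
  · rw [h.map_brace, List.map_map, tridendLift_of, tridendLift_of, hi.map_brace]
    congr 2
    ext y
    exact (tridendLift_of ho i y).symm
  · rw [h.map_dot, tridendLift_of, tridendLift_of, tridendLift_of, hi.map_mul]

/-- The morphism from the enveloping algebra given by its universal property. -/
def envLift {o : TriOps K A} (ho : o.IsTridend q) {i : B →ₗ[K] A} (hi : B.IsHomTo o i) :
    env B →ₗ[K] A :=
  (envIdeal B).liftQ _ (envIdeal_le_ker ho hi)

theorem isHom_envLift {o : TriOps K A} (ho : o.IsTridend q) {i : B →ₗ[K] A}
    (hi : B.IsHomTo o i) : (env B).ops.IsHom o (envLift ho hi) :=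
  (isHom_tridendLift ho i).liftQ (TriOps.isIdeal_idealSpan _ _) _

@[simp] theorem envLift_of {o : TriOps K A} (ho : o.IsTridend q) {i : B →ₗ[K] A}
    (hi : B.IsHomTo o i) (b : B) : envLift ho hi (envOf B b) = i b :=
  tridendLift_of ho i b

theorem envLift_comp_of {o : TriOps K A} (ho : o.IsTridend q) {i : B →ₗ[K] A}
    (hi : B.IsHomTo o i) : envLift ho hi ∘ₗ envOf B = i :=
  LinearMap.ext (envLift_of ho hi)

/-- The enveloping algebra is generated by the image of `B`. -/
theorem env_generated {P : Submodule K (env B)} (hof : ∀ b, envOf B b ∈ P)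
    (hprec : ∀ x ∈ P, ∀ y ∈ P, (env B).ops.prec x y ∈ P)
    (hdot : ∀ x ∈ P, ∀ y ∈ P, (env B).ops.dot x y ∈ P)
    (hsucc : ∀ x ∈ P, ∀ y ∈ P, (env B).ops.succ x y ∈ P) (x : env B) : x ∈ P := by
  obtain ⟨x, rfl⟩ := (envIdeal B).mkQ_surjective x
  exact tridendFree_generated (P := P.comap (envIdeal B).mkQ) hof
    (fun x hx y hy => hprec _ hx _ hy) (fun x hx y hy => hdot _ hx _ hy)
    (fun x hx y hy => hsucc _ hx _ hy) x

variable (B)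

/-- The universal property gives a morphism to the tridendriform algebra of words that sends the
image of a word back to this word. -/
theorem env_wordMap_injective : Function.Injective ((env B).ops.wordMap q (envOf B)) := by
  have hi := B.isHomTo_letter
  have h := isHom_envLift B.isTridend_posOps hi
  intro s t hst
  have h1 := congrArg (TriOps.plusMap (envLift B.isTridend_posOps hi)) hst
  rw [h.wordMap, h.wordMap, envLift_comp_of] at h1
  rw [← B.posAdd_wordMap s, ← B.posAdd_wordMap t, h1]

/-- The image of the words is closed under the operations, hence everything. -/
theorem env_wordMap_surjective : Function.Surjective ((env B).ops.wordMap q (envOf B)) := by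
  have ho := (env B).isTridend
  have hi := isHomTo_envOf B
  have hM := hi.braceMap
  set W := LinearMap.range ((env B).ops.wordMap q (envOf B)) with hW
  have hdot : ∀ a ∈ W, ∀ b ∈ W, (env B).ops.plusDot a b ∈ W := by
    rintro _ ⟨r, rfl⟩ _ ⟨s, rfl⟩
    exact ⟨_, TriOps.wordMap_dot ho hM hi.map_mul r s⟩
  have key : ∀ x, TriOps.incl K (env B) x ∈ W := by
    intro x
    refine env_generated (P := W.comap (TriOps.incl K (env B))) ?_ ?_ ?_ ?_ x
    · intro b
      exact ⟨TensorAlgebra.ι K b, TriOps.wordMap_ι _ _ _ _⟩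
    · rintro x ⟨r, hr⟩ y ⟨s, hs⟩
      refine ⟨Words.prec B.braceHom r s, ?_⟩
      rw [TriOps.wordMap_prec ho hM, hr, hs]
      ext <;> simp [TriOps.plusPrec_apply]
    · intro x hx y hy
      exact hdot _ hx _ hy
    · intro x hx y hy
      have h1 := hdot _ hx _ hy
      obtain ⟨r, hr⟩ := hx
      obtain ⟨s, hs⟩ := hy
      have h2 : (env B).ops.plusTsucc q (TriOps.incl K (env B) x) (TriOps.incl K (env B) y) ∈ W :=
        ⟨Words.tsucc B.braceHom r s, by rw [TriOps.wordMap_tsucc ho hM, hr, hs]⟩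
      have h3 : TriOps.incl K (env B) ((env B).ops.succ x y) =
          (env B).ops.plusTsucc q (TriOps.incl K (env B) x) (TriOps.incl K (env B) y) -
          q • (env B).ops.plusDot (TriOps.incl K (env B) x) (TriOps.incl K (env B) y) := by
        ext <;> simp [TriOps.plusTsucc_apply, TriOps.plusDot_apply]
      rw [Submodule.mem_comap, h3]
      exact sub_mem h2 (W.smul_mem q h1)
  intro h
  have h1 : h ∈ W := by
    rw [TriOps.eq_incl_add h]
    exact add_mem (key _) (W.smul_mem _ ⟨1, TriOps.wordMap_one _ _ _⟩)
  exact h1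

end Env

/-! ### The coproduct of the enveloping algebra -/

namespace Words

open TensorAlgebra

variable {K : Type*} {B : Type*} [Field K] [AddCommGroup B] [Module K B]

/-- The projection of the words onto the letters. -/
def proj : TensorAlgebra K B →ₗ[K] B := onLast ((LinearMap.lsmul K B : K →ₗ[K] _) ∘ₗ eps)

@[simp] theorem proj_one : proj (1 : TensorAlgebra K B) = 0 := by simp [proj]

@[simp] theorem proj_snoc (u : TensorAlgebra K B) (y : B) : proj (u * ι K y) = eps u • y := by
  simp [proj]

/-- The last letter of a word, in terms of deconcatenation. -/
theorem last_eq (t : TensorAlgebra K B) : last t = proj.lTensor _ (decon t) := by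
  induction t using snoc_induction with
  | add a b ha hb => simp only [map_add, ha, hb]
  | smul c a ha => simp only [map_smul, ha]
  | one => simp
  | snoc u y _ =>
    have h : proj ∘ₗ LinearMap.mulRight K (ι K y) = LinearMap.toSpanSingleton K B y ∘ₗ eps := by
      ext v; simp
    rw [last_snoc, decon_snoc, map_add, LinearMap.lTensor_tmul, proj_one, TensorProduct.tmul_zero,
      zero_add, ← LinearMap.comp_apply (LinearMap.lTensor _ proj), ← LinearMap.lTensor_comp, h,
      LinearMap.lTensor_comp, LinearMap.comp_apply, decon_counit_right]
    simp

/-- The primitive words are the letters. -/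
theorem eq_ι_proj {t : TensorAlgebra K B} (ht : decon t = t ⊗ₜ 1 + 1 ⊗ₜ t) (h0 : eps t = 0) :
    t = ι K (proj t) := by
  have h := onLast_snoc_eq t
  rw [onLast, LinearMap.comp_apply, last_eq, ht, h0] at h
  simpa using h.symm

/-- A tensor `s` that satisfies the cocycle condition is the reduced coproduct of the element of the
tensor algebra obtained by joining the second factor of `s`, projected to the letters, to the first
factor. -/
theorem exists_decon_eq {s : TensorAlgebra K B ⊗[K] TensorAlgebra K B}
    (hs : TensorProduct.assoc K _ _ _ (s ⊗ₜ[K] (1 : TensorAlgebra K B)) +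
        TensorProduct.assoc K _ _ _ (decon.rTensor _ s) =
      (1 : TensorAlgebra K B) ⊗ₜ[K] s + decon.lTensor _ s)
    (h0 : eps.lTensor _ s = 0) :
    ∃ t, eps t = 0 ∧ decon t = t ⊗ₜ 1 + 1 ⊗ₜ t + s := by
  -- `J u v` joins the letter component of `v` to `u`
  set J : TensorAlgebra K B →ₗ[K] TensorAlgebra K B →ₗ[K] TensorAlgebra K B :=
    snoc.compl₂ proj with hJ
  have hJι : ∀ u v : TensorAlgebra K B, J u v = u * ι K (proj v) := fun u v => rfl
  have h1 : ∀ s, eps (TensorProduct.lift J s) = 0 := by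
    intro s
    induction s with
    | zero => simp
    | add a b ha hb => simp only [map_add, ha, hb, add_zero]
    | tmul a b => simp [hJι]
  have h2 : ∀ s, decon (TensorProduct.lift J s) = TensorProduct.lift J s ⊗ₜ 1 +
      (TensorProduct.lift J).lTensor _ (TensorProduct.assoc K _ _ _ (decon.rTensor _ s)) := by
    intro s
    induction s with
    | zero => simp
    | add a b ha hb =>
      simp only [map_add, TensorProduct.add_tmul, ha, hb]; abel
    | tmul a b =>
      rw [TensorProduct.lift.tmul, hJι, decon_snoc, LinearMap.rTensor_tmul]
      congr 1
      induction decon a with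
      | zero => simp
      | add c d hc hd => simp only [map_add, TensorProduct.add_tmul, hc, hd]
      | tmul c d => simp [hJι]
  have h3 : ∀ s : TensorAlgebra K B ⊗[K] TensorAlgebra K B,
      (TensorProduct.lift J).lTensor (TensorAlgebra K B)
        (TensorProduct.assoc K _ _ _ (s ⊗ₜ[K] (1 : TensorAlgebra K B))) = 0 := by
    intro s
    induction s with
    | zero => simp
    | add a b ha hb => simp only [map_add, TensorProduct.add_tmul, ha, hb, add_zero]
    | tmul a b => simp [hJι]
  have h4 : TensorProduct.lift J ∘ₗ decon =
      LinearMap.id - LinearMap.toSpanSingleton K (TensorAlgebra K B) 1 ∘ₗ eps := by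
    ext1 u
    have h := onLast_snoc_eq u
    rw [onLast, LinearMap.comp_apply, last_eq] at h
    simp only [LinearMap.comp_apply, LinearMap.sub_apply, LinearMap.id_apply,
      LinearMap.toSpanSingleton_apply, ← h]
    induction decon u with
    | zero => simp
    | add a b ha hb => simp only [map_add, ha, hb]
    | tmul a b => simp [hJι]
  have h5 := congrArg ((TensorProduct.lift J).lTensor (TensorAlgebra K B)) hs
  rw [map_add, map_add, h3, zero_add, LinearMap.lTensor_tmul,
    ← LinearMap.comp_apply (LinearMap.lTensor _ _), ← LinearMap.lTensor_comp, h4,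
    LinearMap.lTensor_sub, LinearMap.lTensor_comp] at h5
  refine ⟨TensorProduct.lift J s, h1 s, ?_⟩
  rw [h2, h5]
  simp [h0, add_assoc]

end Words

namespace TriOps

open TensorAlgebra Words

section Comul

variable {K : Type*} [Field K] {A B : Type*} [AddCommGroup A] [Module K A] [AddCommGroup B]
  [Module K B] {o : TriOps K A} {q : K} {i : B →ₗ[K] A}

/-- The deconcatenation coproduct, transported to `A₊` along a bijective `wordMap`. -/
def wordComul (h : Function.Bijective (o.wordMap q i)) : A × K →ₗ[K] (A × K) ⊗[K] (A × K) :=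
  TensorProduct.map (o.wordMap q i) (o.wordMap q i) ∘ₗ decon ∘ₗ
    (LinearEquiv.ofBijective (o.wordMap q i) h).symm.toLinearMap

theorem wordComul_wordMap (h : Function.Bijective (o.wordMap q i)) (t : TensorAlgebra K B) :
    wordComul h (o.wordMap q i t) =
      TensorProduct.map (o.wordMap q i) (o.wordMap q i) (decon t) := by
  simp only [wordComul, LinearMap.comp_apply, LinearEquiv.coe_coe]
  congr 2
  exact (LinearEquiv.ofBijective (o.wordMap q i) h).symm_apply_apply t

theorem assoc_map_rTensor {Δ : A × K →ₗ[K] (A × K) ⊗[K] (A × K)}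
    {f : TensorAlgebra K B →ₗ[K] A × K} (hf : ∀ t, Δ (f t) = TensorProduct.map f f (decon t))
    (s : TensorAlgebra K B ⊗[K] TensorAlgebra K B) :
    TensorProduct.assoc K _ _ _ (Δ.rTensor _ (TensorProduct.map f f s)) =
      TensorProduct.map f (TensorProduct.map f f)
        (TensorProduct.assoc K _ _ _ (decon.rTensor _ s)) := by
  induction s with
  | zero => simp
  | add a b ha hb => simp only [map_add, ha, hb]
  | tmul a b =>
    simp only [TensorProduct.map_tmul, LinearMap.rTensor_tmul, hf]
    induction decon a with
    | zero => simp
    | add c d hc hd => simp only [map_add, TensorProduct.add_tmul, hc, hd]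
    | tmul c d => simp

theorem map_lTensor {Δ : A × K →ₗ[K] (A × K) ⊗[K] (A × K)}
    {f : TensorAlgebra K B →ₗ[K] A × K} (hf : ∀ t, Δ (f t) = TensorProduct.map f f (decon t))
    (s : TensorAlgebra K B ⊗[K] TensorAlgebra K B) :
    Δ.lTensor _ (TensorProduct.map f f s) =
      TensorProduct.map f (TensorProduct.map f f) (decon.lTensor _ s) := by
  induction s with
  | zero => simp
  | add a b ha hb => simp only [map_add, ha, hb]
  | tmul a b => simp [hf]

variable {M : B →ₗ[K] TensorAlgebra K B →ₗ[K] B} {mul : B →ₗ[K] B →ₗ[K] B}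

/-- The operation on `A₊ ⊗ A₊` corresponding to an operation on words under `wordMap`. -/
theorem tensorOp_wordMap (ho : o.IsTridend q) (hM : ∀ x t, o.braceMap q i x t = i (M x t))
    {op : (A × K) →ₗ[K] (A × K) →ₗ[K] (A × K)}
    {op' : TensorAlgebra K B →ₗ[K] TensorAlgebra K B →ₗ[K] TensorAlgebra K B}
    (hop : ∀ r s, o.wordMap q i (op' r s) = op (o.wordMap q i r) (o.wordMap q i s))
    (r s : TensorAlgebra K B) :
    o.tensorOp q op (TensorProduct.map (o.wordMap q i) (o.wordMap q i) (decon r))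
        (TensorProduct.map (o.wordMap q i) (o.wordMap q i) (decon s)) =
      TensorProduct.map (o.wordMap q i) (o.wordMap q i)
        (op' r s ⊗ₜ 1 + TensorProduct.map₂ (Words.star M) op' (decon r) (decon s)) := by
  set e : TensorAlgebra K B →ₗ[K] TensorAlgebra K B →ₗ[K] TensorAlgebra K B :=
    ((LinearMap.mul K K).compl₁₂ eps eps).compr₂ (LinearMap.toSpanSingleton K _ 1) with he
  -- `e` corresponds to the summand of `tensorOp` for the convention on `1 ∘ 1`
  rw [← map₂_eps op' e (by intro a b; simp [he]) r s]
  induction decon r with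
  | zero => simp
  | add a b ha hb =>
    simp only [map_add, LinearMap.add_apply] at ha hb ⊢
    rw [ha, hb]; abel
  | tmul a b =>
    induction decon s with
    | zero => simp
    | add c d hc hd =>
      simp only [map_add] at hc hd ⊢
      rw [hc, hd]; abel
    | tmul c d =>
      simp [tensorOp_tmul, wordMap_star ho hM, hop, he, wordMap_snd, TensorProduct.smul_tmul',
        add_comm]

theorem tensorOp_plusTsucc (X Y : (A × K) ⊗[K] (A × K)) : o.tensorOp q (o.plusTsucc q) X Y =
    q • o.tensorOp q o.plusDot X Y + o.tensorOp q o.plusSucc X Y := by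
  have h : ∀ a b, o.plusTsucc q a b = q • o.plusDot a b + o.plusSucc a b := fun _ _ => rfl
  induction X with
  | zero => simp
  | add a b ha hb =>
    simp only [map_add, LinearMap.add_apply] at ha hb ⊢
    rw [ha, hb, smul_add]; abel
  | tmul a b =>
    induction Y with
    | zero => simp
    | add c d hc hd =>
      simp only [map_add] at hc hd ⊢
      rw [hc, hd, smul_add]; abel
    | tmul c d =>
      simp only [tensorOp_tmul, h, TensorProduct.tmul_add, TensorProduct.add_tmul,
        TensorProduct.tmul_smul, TensorProduct.smul_tmul', smul_add]
      rw [smul_comm q]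
      abel

/-- If `wordMap` is bijective, the transported coproduct defines a bialgebra. -/
theorem isBialgebra_wordComul (ho : o.IsTridend q)
    (hM : ∀ x t, o.braceMap q i x t = i (M x t))
    (hmul : ∀ x y, i (mul x y) = o.dot (i x) (i y))
    (h : Function.Bijective (o.wordMap q i)) : o.IsBialgebra q (wordComul h) := by
  have hf := wordComul_wordMap h
  have hone : o.wordMap q i 1 = one K A := wordMap_one _ _ _
  have haug : aug K A ∘ₗ o.wordMap q i = eps := LinearMap.ext (wordMap_snd o q i)
  -- compatibility with any operation that has a counterpart on words
  have key : ∀ {op : (A × K) →ₗ[K] (A × K) →ₗ[K] (A × K)}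
      {op' : TensorAlgebra K B →ₗ[K] TensorAlgebra K B →ₗ[K] TensorAlgebra K B},
      (∀ r s, o.wordMap q i (op' r s) = op (o.wordMap q i r) (o.wordMap q i s)) →
      (∀ r s, decon (op' r s) = op' r s ⊗ₜ 1 +
        TensorProduct.map₂ (Words.star M) op' (decon r) (decon s)) →
      ∀ a b, wordComul h (op a b) = o.tensorOp q op (wordComul h a) (wordComul h b) := by
    intro op op' hop hd a b
    obtain ⟨r, rfl⟩ := h.2 a
    obtain ⟨s, rfl⟩ := h.2 b
    rw [← hop, hf, hf, hf, tensorOp_wordMap ho hM hop, hd]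
  have hprec := key (wordMap_prec ho hM) (decon_prec M)
  have hdot := key (wordMap_dot ho hM hmul) (decon_dot q mul M)
  have htsucc := key (wordMap_tsucc ho hM) (decon_tsucc M)
  refine ⟨?_, ?_, ?_, ?_, ?_, ?_, ?_⟩
  · refine LinearMap.ext fun a => ?_
    obtain ⟨t, rfl⟩ := h.2 a
    have := decon_coassoc t
    simp only [LinearMap.comp_apply, LinearEquiv.coe_coe]
    rw [hf, assoc_map_rTensor hf, map_lTensor hf, this]
  · rw [← hone, hf, decon_one, TensorProduct.map_tmul]
  · intro x
    obtain ⟨t, ht⟩ := h.2 (incl K A x)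
    rw [← ht, hf, ← LinearMap.comp_apply, LinearMap.rTensor_comp_map, haug,
      ← LinearMap.lTensor_comp_rTensor, LinearMap.comp_apply, decon_counit_left,
      LinearMap.lTensor_tmul]
  · intro x
    obtain ⟨t, ht⟩ := h.2 (incl K A x)
    rw [← ht, hf, ← LinearMap.comp_apply, LinearMap.lTensor_comp_map, haug,
      ← LinearMap.rTensor_comp_lTensor, LinearMap.comp_apply, decon_counit_right,
      LinearMap.rTensor_tmul]
  · intro x y
    have h1 : incl K A (o.succ x y) = o.plusTsucc q (incl K A x) (incl K A y) -
        q • o.plusDot (incl K A x) (incl K A y) := by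
      ext <;> simp [plusTsucc_apply, plusDot_apply]
    rw [h1, map_sub, map_smul, htsucc, hdot, tensorOp_plusTsucc, add_sub_cancel_left]
  · intro x y
    rw [← hdot]
    rfl
  · intro x y
    have h1 : incl K A (o.prec x y) = o.plusPrec (incl K A x) (incl K A y) := by
      ext <;> simp [plusPrec_apply]
    rw [h1, hprec]

theorem wordComul_letter (h : Function.Bijective (o.wordMap q i)) (b : B) :
    wordComul h (incl K A (i b)) = incl K A (i b) ⊗ₜ one K A + one K A ⊗ₜ incl K A (i b) := by
  have h1 := wordComul_wordMap h (1 * ι K b)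
  rw [decon_snoc] at h1
  simpa using h1

end Comul

end TriOps

/-! ### The primitive filtration -/

namespace TriBialg

open TensorAlgebra Words TriOps

section Words

variable {K : Type u} [Field K] {q : K} {H : TriBialg.{u, v} K q} {B : Type w} [AddCommGroup B]
  [Module K B] {i : B →ₗ[K] H}

theorem redComul_apply (x : H) : H.redComul x =
    H.comul (incl K H x) - one K H ⊗ₜ incl K H x - incl K H x ⊗ₜ one K H := rfl

theorem comul_incl (x : H) : H.comul (incl K H x) =
    incl K H x ⊗ₜ one K H + one K H ⊗ₜ incl K H x + H.redComul x := by
  rw [redComul_apply]; abel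

theorem incl_wordMap_fst {t : TensorAlgebra K B} (ht : eps t = 0) :
    incl K H (H.ops.wordMap q i t).1 = H.ops.wordMap q i t := by
  ext
  · simp
  · rw [wordMap_snd, ht]; simp

/-- A word of length at most `n + 1` in primitive letters lies in the `(n + 1)`-st term of the
primitive filtration. -/
theorem wordMap_word_mem_filt (hi : ∀ b, i b ∈ H.prim) (n : ℕ) (l : List B)
    (hl : l.length ≤ n + 1) : (H.ops.wordMap q i (word l)).1 ∈ H.filt n := by
  have hi' := fun b => (H.mem_prim _).1 (hi b)
  induction n generalizing l with
  | zero =>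
    rcases l with _ | ⟨y, _ | ⟨z, l⟩⟩
    · simp
    · have h : (H.ops.wordMap q i (word [y])).1 = i y := by simp
      rw [h]
      exact hi y
    · simp at hl
  | succ n ih =>
    rcases l with _ | ⟨y, l⟩
    · simp
    · have h0 : eps (word (K := K) (y :: l)) = 0 := by simp
      have h1 := comul_wordMap H.isBialgebra hi' (word (K := K) (y :: l))
      rw [decon_word, Finset.sum_range_succ, List.length_cons, Finset.sum_range_succ',
        ← incl_wordMap_fst h0, comul_incl] at h1
      have htake : (y :: l).take (l.length + 1) = y :: l := List.take_length (l := y :: l)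
      have hdrop : (y :: l).drop (l.length + 1) = [] := List.drop_length (l := y :: l)
      simp only [htake, hdrop, List.take_zero, List.drop_zero, word_nil, map_add,
        TensorProduct.map_tmul, wordMap_one, map_sum] at h1
      rw [incl_wordMap_fst h0] at h1
      have h2 : H.redComul (H.ops.wordMap q i (word (y :: l))).1 =
          ∑ k ∈ Finset.range l.length, H.ops.wordMap q i (word ((y :: l).take (k + 1))) ⊗ₜ
            H.ops.wordMap q i (word ((y :: l).drop (k + 1))) := by
        rw [add_right_comm, add_comm, ← add_assoc] at h1
        rw [add_right_comm] at h1
        have h2 := add_right_cancel h1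
        rw [add_comm] at h2
        exact add_right_cancel h2
      rw [filt, Submodule.mem_comap, h2]
      refine Submodule.sum_mem _ fun k hk => ?_
      have hk' := Finset.mem_range.1 hk
      have h3 : eps (word (K := K) ((y :: l).take (k + 1))) = 0 := by simp
      have h4 : eps (word (K := K) ((y :: l).drop (k + 1))) = 0 := by
        rw [List.drop_succ_cons, List.drop_eq_getElem_cons hk', word_cons, eps_cons]
      refine ⟨⟨_, ih ((y :: l).take (k + 1)) (by simp at hl ⊢; omega)⟩ ⊗ₜ
        ⟨_, ih ((y :: l).drop (k + 1)) (by simp at hl ⊢; omega)⟩, ?_⟩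
      simp only [TensorProduct.map_tmul, LinearMap.comp_apply, Submodule.subtype_apply,
        incl_wordMap_fst h3, incl_wordMap_fst h4]

theorem connected_of_wordMap_surjective (hi : ∀ b, i b ∈ H.prim)
    (hs : Function.Surjective (H.ops.wordMap q i)) : H.Connected := by
  have key : ∀ t : TensorAlgebra K B, ∃ N, ∀ n ≥ N, (H.ops.wordMap q i t).1 ∈ H.filt n := by
    intro t
    induction t using word_induction with
    | add a b ha hb =>
      obtain ⟨m, hm⟩ := ha
      obtain ⟨n, hn⟩ := hb
      refine ⟨max m n, fun k hk => ?_⟩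
      rw [map_add]
      exact add_mem (hm k (le_trans (le_max_left _ _) hk)) (hn k (le_trans (le_max_right _ _) hk))
    | smul c a ha =>
      obtain ⟨m, hm⟩ := ha
      refine ⟨m, fun k hk => ?_⟩
      rw [map_smul]
      exact Submodule.smul_mem _ c (hm k hk)
    | word l => exact ⟨l.length, fun n hn => wordMap_word_mem_filt hi n l (by omega)⟩
  intro x
  obtain ⟨t, ht⟩ := hs (incl K H x)
  obtain ⟨N, hN⟩ := key t
  refine ⟨N, ?_⟩
  have := hN N le_rfl
  rw [ht] at this
  exact this

/-- If the words in primitive letters are linearly independent and span, then the letters are the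
only primitive elements. -/
theorem exists_eq_of_mem_prim (hi : ∀ b, i b ∈ H.prim)
    (h : Function.Bijective (H.ops.wordMap q i)) {x : H} (hx : x ∈ H.prim) : ∃ b, i b = x := by
  obtain ⟨t, ht⟩ := h.2 (incl K H x)
  have h0 : eps t = 0 := by
    rw [← wordMap_snd H.ops q i, ht]; simp
  have h1 := (H.mem_prim x).1 hx
  rw [← ht, comul_wordMap H.isBialgebra (fun b => (H.mem_prim _).1 (hi b))] at h1
  have h2 : decon t = t ⊗ₜ 1 + 1 ⊗ₜ t := by
    apply TensorProduct.map_injective_of_flat_flat _ _ h.1 h.1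
    rw [h1]; simp
  refine ⟨proj t, ?_⟩
  have h3 := congrArg (H.ops.wordMap q i) (eq_ι_proj h2 h0)
  rw [ht, wordMap_ι] at h3
  simpa using (congrArg Prod.fst h3).symm

/-- A connected bialgebra is spanned by the words in its primitive elements. -/
theorem wordMap_surjective (hH : H.Connected) (hi : ∀ x ∈ H.prim, ∃ b, i b = x)
    (hi' : ∀ b, i b ∈ H.prim) (hinj : Function.Injective (H.ops.wordMap q i)) :
    Function.Surjective (H.ops.wordMap q i) := by
  set f := H.ops.wordMap q i with hf
  have hΔ : ∀ t, H.comul (f t) = TensorProduct.map f f (decon t) :=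
    comul_wordMap H.isBialgebra (fun b => (H.mem_prim _).1 (hi' b))
  have haug : aug K H ∘ₗ f = eps := LinearMap.ext (wordMap_snd H.ops q i)
  have hone : f 1 = one K H := wordMap_one _ _ _
  have key : ∀ n, ∀ x ∈ H.filt n, incl K H x ∈ LinearMap.range f := by
    intro n
    induction n with
    | zero =>
      intro x hx
      obtain ⟨b, rfl⟩ := hi x hx
      exact ⟨ι K b, wordMap_ι _ _ _ _⟩
    | succ n ih =>
      intro x hx
      obtain ⟨r, hr⟩ := hx
      -- the reduced coproduct of `x` comes from a tensor `s` of words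
      obtain ⟨s, hs⟩ : ∃ s, TensorProduct.map f f s = H.redComul x := by
        rw [← hr]
        clear hr
        induction r with
        | zero => exact ⟨0, by simp⟩
        | add a b ha hb =>
          obtain ⟨a', ha⟩ := ha
          obtain ⟨b', hb⟩ := hb
          exact ⟨a' + b', by rw [map_add, map_add, ha, hb]⟩
        | tmul a b =>
          obtain ⟨a', ha⟩ := ih a a.2
          obtain ⟨b', hb⟩ := ih b b.2
          exact ⟨a' ⊗ₜ b', by simp [ha, hb]⟩
      have hs0 : eps.lTensor _ s = 0 := by
        apply Module.Flat.rTensor_preserves_injective_linearMap f hinj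
        rw [← LinearMap.comp_apply, LinearMap.rTensor_comp_lTensor, ← haug,
          ← LinearMap.lTensor_comp_map, LinearMap.comp_apply, hs, redComul_apply, map_sub, map_sub,
          H.isBialgebra.counit_right]
        simp [aug]
      have hcocycle : TensorProduct.assoc K _ _ _ (s ⊗ₜ[K] (1 : TensorAlgebra K B)) +
          TensorProduct.assoc K _ _ _ (decon.rTensor _ s) =
          (1 : TensorAlgebra K B) ⊗ₜ[K] s + decon.lTensor _ s := by
        apply TensorProduct.map_injective_of_flat_flat _ _ hinj
          (TensorProduct.map_injective_of_flat_flat _ _ hinj hinj)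
        have h1 := LinearMap.congr_fun H.isBialgebra.coassoc (incl K H x)
        have h2 : TensorProduct.map f (TensorProduct.map f f)
            (TensorProduct.assoc K _ _ _ (s ⊗ₜ[K] (1 : TensorAlgebra K B))) =
            TensorProduct.assoc K _ _ _ (TensorProduct.map f f s ⊗ₜ[K] one K H) := by
          rw [TensorProduct.map_map_assoc, TensorProduct.map_tmul, hone]
        simp only [LinearMap.comp_apply, LinearEquiv.coe_coe, comul_incl, map_add, ← hs,
          LinearMap.rTensor_tmul, LinearMap.lTensor_tmul, TensorProduct.add_tmul,
          TensorProduct.tmul_add, TensorProduct.assoc_tmul, H.isBialgebra.comul_one,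
          assoc_map_rTensor hΔ, map_lTensor hΔ] at h1
        rw [map_add, map_add, h2, TensorProduct.map_tmul, hone]
        rw [← sub_eq_zero] at h1 ⊢
        rw [← h1]
        abel
      obtain ⟨t, ht0, ht⟩ := exists_decon_eq hcocycle hs0
      have h1 := hΔ t
      rw [ht, map_add, map_add, hs, TensorProduct.map_tmul, TensorProduct.map_tmul, hone,
        ← incl_wordMap_fst ht0, comul_incl] at h1
      -- `x` and the image of `t` have the same reduced coproduct
      have h2 : x - (f t).1 ∈ H.prim := by
        rw [prim, LinearMap.mem_ker, map_sub, sub_eq_zero]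
        exact (add_left_cancel h1).symm
      obtain ⟨b, hb⟩ := hi _ h2
      have h3 : incl K H x = f (ι K b) + f t := by
        rw [hf, wordMap_ι, ← incl_wordMap_fst ht0, hb, ← map_add, sub_add_cancel]
      exact ⟨ι K b + t, by rw [map_add, h3]⟩
  intro h
  rw [eq_incl_add h]
  obtain ⟨n, hn⟩ := hH h.1
  exact add_mem (key n _ hn) ((LinearMap.range f).smul_mem _ ⟨1, hone⟩)

end Words

/-- A morphism from a connected bialgebra is injective if it is so on primitive elements. -/
theorem injective_of_prim {K : Type u} [Field K] {q : K} {H : TriBialg.{u, v} K q}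
    {H' : TriBialg.{u, w} K q} (hH : H.Connected) (f : H →ₗ[K] H')
    (hf : ∀ a, H'.comul (plusMap f a) = TensorProduct.map (plusMap f) (plusMap f) (H.comul a))
    (hinj : ∀ x ∈ H.prim, f x = 0 → x = 0) : Function.Injective f := by
  have hred : ∀ x, H'.redComul (f x) =
      TensorProduct.map (plusMap f) (plusMap f) (H.redComul x) := by
    intro x
    simp only [redComul_apply, map_sub, ← hf, TensorProduct.map_tmul, plusMap_incl, plusMap_one]
  have key : ∀ n, ∀ x ∈ H.filt n, f x = 0 → x = 0 := by
    intro n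
    induction n with
    | zero => exact hinj
    | succ n ih =>
      rintro x ⟨r, hr⟩ hx
      refine hinj x ?_ hx
      set j := plusMap f ∘ₗ incl K H ∘ₗ (H.filt n).subtype with hj
      have hj' : Function.Injective j := by
        rw [← LinearMap.ker_eq_bot, LinearMap.ker_eq_bot']
        intro y hy
        have h1 := congrArg Prod.fst hy
        exact Subtype.ext (ih y y.2 (by simpa [hj] using h1))
      have h1 := hred x
      rw [hx, map_zero, ← hr, ← LinearMap.comp_apply, ← TensorProduct.map_comp] at h1
      have h2 : r = 0 := by
        apply TensorProduct.map_injective_of_flat_flat _ _ hj' hj'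
        rw [← h1, map_zero]
      rw [h2, map_zero] at hr
      exact hr.symm
  rw [← LinearMap.ker_eq_bot, LinearMap.ker_eq_bot']
  intro x hx
  obtain ⟨n, hn⟩ := hH x
  exact key n x hn hx

/-- A morphism to a bialgebra is a morphism of coalgebras as soon as it sends the letters to
primitive elements. -/
theorem comul_of_map_letters {K : Type u} [Field K] {q : K} {A : Type w} [AddCommGroup A]
    [Module K A] {B : Type*} [AddCommGroup B] [Module K B] {o : TriOps K A} {i : B →ₗ[K] A}
    (h : Function.Bijective (o.wordMap q i)) {H : TriBialg.{u, v} K q} {f : A →ₗ[K] H}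
    (hf : o.IsHom H.ops f) (hprim : ∀ b, f (i b) ∈ H.prim) (a : A × K) :
    H.comul (plusMap f a) = TensorProduct.map (plusMap f) (plusMap f) (wordComul h a) := by
  obtain ⟨t, rfl⟩ := h.2 a
  have h1 : H.ops.wordMap q (f ∘ₗ i) = plusMap f ∘ₗ o.wordMap q i :=
    LinearMap.ext fun t => (hf.wordMap t).symm
  have h2 := comul_wordMap (i := f ∘ₗ i) H.isBialgebra
    (fun b => (H.mem_prim _).1 (hprim b)) t
  rw [h1, TensorProduct.map_comp] at h2
  rw [wordComul_wordMap]
  exact h2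

/-- A morphism from a bialgebra whose basis consists of the words in primitive letters to a
connected bialgebra is bijective if it identifies the letters with the primitive elements. -/
theorem bijective_of_map_letters {K : Type u} [Field K] {q : K} {B : Type*} [AddCommGroup B]
    [Module K B] {E : TriBialg.{u, w} K q} {H : TriBialg.{u, v} K q} {i : B →ₗ[K] E}
    (hi : ∀ b, i b ∈ E.prim) (hE : Function.Bijective (E.ops.wordMap q i)) (hH : H.Connected)
    {f : E →ₗ[K] H} (hf : E.ops.IsHom H.ops f)
    (hΔ : ∀ a, H.comul (plusMap f a) = TensorProduct.map (plusMap f) (plusMap f) (E.comul a))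
    (h0 : ∀ b, f (i b) = 0 → b = 0) (hprim : ∀ x ∈ H.prim, ∃ b, f (i b) = x)
    (hprim' : ∀ b, f (i b) ∈ H.prim) : Function.Bijective f := by
  have hinj : Function.Injective f := by
    refine injective_of_prim (connected_of_wordMap_surjective hi hE.2) f hΔ ?_
    intro x hx hx0
    obtain ⟨b, rfl⟩ := exists_eq_of_mem_prim hi hE hx
    exact (congrArg i (h0 b hx0)).trans (map_zero i)
  have h1 : H.ops.wordMap q (f ∘ₗ i) = plusMap f ∘ₗ E.ops.wordMap q i :=
    LinearMap.ext fun t => (hf.wordMap t).symm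
  have hplus : Function.Injective (plusMap f) := Function.Injective.prodMap hinj fun _ _ h => h
  have hinj' : Function.Injective (H.ops.wordMap q (f ∘ₗ i)) := by
    rw [h1]
    exact hplus.comp hE.1
  have hs : Function.Surjective (plusMap f) := by
    have hs : Function.Surjective (plusMap f ∘ₗ E.ops.wordMap q i) := by
      rw [← h1]
      exact wordMap_surjective hH hprim hprim' hinj'
    exact Function.Surjective.of_comp hs
  refine ⟨hinj, fun x => ?_⟩
  obtain ⟨a, ha⟩ := hs (incl K H x)
  exact ⟨a.1, congrArg Prod.fst ha⟩

end TriBialg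

/-! ### The enveloping bialgebra and its primitive elements -/

open TriOps Words

section EnvBialgebra

variable {K : Type u} [Field K] {q : K} (B : GVAlg.{u, v} K q)

theorem env_wordMap_bijective : Function.Bijective ((env B).ops.wordMap q (envOf B)) :=
  ⟨env_wordMap_injective B, env_wordMap_surjective B⟩

/-- The coproduct of the enveloping algebra: deconcatenation of words. -/
def envComul : env B × K →ₗ[K] (env B × K) ⊗[K] (env B × K) :=
  wordComul (env_wordMap_bijective B)

theorem isEnvCoproduct_envComul : IsEnvCoproduct B (envComul B) :=
  ⟨isBialgebra_wordComul (env B).isTridend (isHomTo_envOf B).braceMap (isHomTo_envOf B).map_mul _,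
    wordComul_letter _⟩

/-- Uniqueness: `wordMap` is a morphism of coalgebras for any coproduct with primitive letters. -/
theorem IsEnvCoproduct.eq_envComul {Δ : env B × K →ₗ[K] (env B × K) ⊗[K] (env B × K)}
    (h : IsEnvCoproduct B Δ) : Δ = envComul B := by
  refine LinearMap.ext fun a => ?_
  obtain ⟨t, rfl⟩ := env_wordMap_surjective B a
  rw [comul_wordMap h.isBialgebra h.primitive, envComul, wordComul_wordMap]

/-- The enveloping algebra, as a bialgebra. -/
abbrev envBialgebra : TriBialg.{u, max u v} K q :=
  envBialg B (envComul B) (isEnvCoproduct_envComul B)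

theorem envOf_mem_prim (b : B) : envOf B b ∈ (envBialgebra B).prim :=
  ((envBialgebra B).mem_prim _).2 ((isEnvCoproduct_envComul B).primitive b)

theorem connected_envBialgebra : (envBialgebra B).Connected :=
  TriBialg.connected_of_wordMap_surjective (envOf_mem_prim B) (env_wordMap_surjective B)

theorem envOf_injective : Function.Injective (envOf B) := by
  intro b b' h
  rw [← TensorAlgebra.ι_inj K]
  apply env_wordMap_injective B
  rw [wordMap_ι, wordMap_ι, h]

theorem exists_envOf_eq {x : env B} (hx : x ∈ (envBialgebra B).prim) : ∃ b, envOf B b = x :=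
  TriBialg.exists_eq_of_mem_prim (envOf_mem_prim B) (env_wordMap_bijective B) hx

variable {B}

/-- Morphisms from the enveloping algebra agree if they agree on the generators. -/
theorem env_hom_ext {A : Type w} [AddCommGroup A] [Module K A] {o : TriOps K A}
    {f g : env B →ₗ[K] A} (hf : (env B).ops.IsHom o f) (hg : (env B).ops.IsHom o g)
    (h : ∀ b, f (envOf B b) = g (envOf B b)) : f = g := by
  refine LinearMap.ext fun x => env_generated (P := LinearMap.eqLocus f g) h ?_ ?_ ?_ x
  · intro x hx y hy
    rw [LinearMap.mem_eqLocus] at *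
    rw [hf.map_prec, hg.map_prec, hx, hy]
  · intro x hx y hy
    rw [LinearMap.mem_eqLocus] at *
    rw [hf.map_dot, hg.map_dot, hx, hy]
  · intro x hx y hy
    rw [LinearMap.mem_eqLocus] at *
    rw [hf.map_succ, hg.map_succ, hx, hy]

end EnvBialgebra

/-! ### The equivalence of categories -/

section Isomorphisms

variable {K : Type u} [Field K] {q : K}

/-- A bijective morphism of `GV_q` algebras is an isomorphism. -/
def GVAlg.isoOfBijective {B B' : GVAlg.{u, v} K q} (f : GVAlg.Hom B B')
    (h : Function.Bijective f.toLin) : B ≅ B' :=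
  let e := LinearEquiv.ofBijective f.toLin h
  have he : ∀ x, f.toLin (e.symm x) = x := e.apply_symm_apply
  have he' : ∀ x, e.symm (f.toLin x) = x := e.symm_apply_apply
  { hom := f
    inv := GVAlg.Hom.mk e.symm.toLinearMap
      (fun x y => h.1 (by simp [he, f.map_mul]))
      (fun x l => h.1 (by
        simp only [LinearEquiv.coe_coe, he, f.map_brace, List.map_map]
        congr 1
        refine (List.map_id l).symm.trans (List.map_congr_left fun y _ => ?_)
        exact (he y).symm))
    hom_inv_id := GVAlg.Hom.ext (LinearMap.ext he')
    inv_hom_id := GVAlg.Hom.ext (LinearMap.ext he) }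

/-- A bijective morphism of bialgebras is an isomorphism. -/
def TriBialg.isoOfBijective {H H' : TriBialg.{u, v} K q} (f : TriBialg.Hom H H')
    (h : Function.Bijective f.toLin) : H ≅ H' :=
  let e := LinearEquiv.ofBijective f.toLin h
  have he : ∀ x, f.toLin (e.symm x) = x := e.apply_symm_apply
  have he' : ∀ x, e.symm (f.toLin x) = x := e.symm_apply_apply
  have hc : plusMap e.symm.toLinearMap ∘ₗ plusMap f.toLin = LinearMap.id :=
    LinearMap.ext fun x => Prod.ext (he' x.1) rfl
  have hc' : ∀ x, plusMap f.toLin (plusMap e.symm.toLinearMap x) = x :=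
    fun x => Prod.ext (he x.1) rfl
  { hom := f
    inv := TriBialg.Hom.mk e.symm.toLinearMap
      (fun x y => h.1 (by simp [he, f.map_prec]))
      (fun x y => h.1 (by simp [he, f.map_dot]))
      (fun x y => h.1 (by simp [he, f.map_succ]))
      (fun x => by
        have h1 := f.map_comul (plusMap e.symm.toLinearMap x)
        have h2 : f.toLin.prodMap LinearMap.id (plusMap e.symm.toLinearMap x) = x := hc' x
        rw [h2] at h1
        have h3 := LinearMap.congr_fun (TensorProduct.map_comp (plusMap e.symm.toLinearMap)
          (plusMap e.symm.toLinearMap) (plusMap f.toLin) (plusMap f.toLin))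
          (H.comul (plusMap e.symm.toLinearMap x))
        rw [hc, TensorProduct.map_id] at h3
        rw [h1]
        exact h3)
    hom_inv_id := TriBialg.Hom.ext (LinearMap.ext he')
    inv_hom_id := TriBialg.Hom.ext (LinearMap.ext he) }

theorem TriBialg.Hom.isHom {H H' : TriBialg.{u, v} K q} (f : TriBialg.Hom H H') :
    H.ops.IsHom H'.ops f.toLin :=
  ⟨f.map_prec, f.map_dot, f.map_succ⟩

end Isomorphisms

section Equivalence

variable {K : Type u} [Field K] {q : K}

/-- The canonical map `B → Prim(U_qGV(B))`. -/
def toPrimEnv (B : GVAlg.{u, max u v} K q) :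
    GVAlg.Hom B ((envBialgebra B).primGV (envBialgebra B).primIsGV) where
  toLin := (envOf B).codRestrict _ (envOf_mem_prim B)
  map_mul x y := Subtype.ext ((isHomTo_envOf B).map_mul x y)
  map_brace x l := by
    refine Subtype.ext (((isHomTo_envOf B).map_brace x l).trans ?_)
    refine congrArg ((env B).ops.brace q (envOf B x)) ?_
    rw [List.map_map]
    rfl

theorem toPrimEnv_bijective (B : GVAlg.{u, max u v} K q) :
    Function.Bijective (toPrimEnv.{u, v} B).toLin := by
  refine ⟨fun b b' h => envOf_injective B (congrArg Subtype.val h), fun x => ?_⟩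
  obtain ⟨b, hb⟩ := exists_envOf_eq B x.2
  exact ⟨b, Subtype.ext hb⟩

theorem isHomTo_prim (H : TriBialg.{u, v} K q) :
    (H.primGV H.primIsGV).IsHomTo H.ops H.prim.subtype :=
  ⟨fun _ _ => rfl, fun _ _ => rfl⟩

/-- The canonical morphism `U_qGV(Prim(H)) → H`. -/
def fromEnvPrim (H : TriBialg.{u, max u v} K q) :
    TriBialg.Hom (envBialgebra (H.primGV H.primIsGV)) H :=
  have h := isHom_envLift H.isTridend (isHomTo_prim H)
  { toLin := envLift H.isTridend (isHomTo_prim H)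
    map_prec := h.map_prec
    map_dot := h.map_dot
    map_succ := h.map_succ
    map_comul := TriBialg.comul_of_map_letters (env_wordMap_bijective _) h
      (fun b => by rw [envLift_of]; exact b.2) }

theorem fromEnvPrim_of (H : TriBialg.{u, max u v} K q) (x : H.prim) :
    (fromEnvPrim.{u, v} H).toLin (envOf (H.primGV H.primIsGV) x) = x :=
  envLift_of _ (isHomTo_prim H) x

theorem fromEnvPrim_bijective {H : TriBialg.{u, max u v} K q} (hH : H.Connected) :
    Function.Bijective (fromEnvPrim.{u, v} H).toLin := by
  have h := fromEnvPrim_of.{u, v} H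
  refine TriBialg.bijective_of_map_letters (envOf_mem_prim (H.primGV H.primIsGV))
    (env_wordMap_bijective (H.primGV H.primIsGV)) hH (fromEnvPrim.{u, v} H).isHom
    (fromEnvPrim.{u, v} H).map_comul ?_ ?_ ?_
  · intro b hb
    exact Subtype.ext ((h b).symm.trans hb)
  · intro x hx
    exact ⟨⟨x, hx⟩, h _⟩
  · intro b
    rw [h]
    exact b.2

/-- A connected bialgebra is isomorphic to the enveloping algebra of its primitive elements. -/
def envPrimIso {H : TriBialg.{u, max u v} K q} (hH : H.Connected) :
    envBialgebra (H.primGV H.primIsGV) ≅ H :=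
  TriBialg.isoOfBijective (fromEnvPrim.{u, v} H) (fromEnvPrim_bijective.{u, v} hH)

theorem envPrimIso_inv {H : TriBialg.{u, max u v} K q} (hH : H.Connected) (x : H.prim) :
    TriBialg.Hom.toLin (envPrimIso.{u, v} hH).inv (x : H) = envOf (H.primGV H.primIsGV) x := by
  apply (fromEnvPrim_bijective.{u, v} hH).1
  rw [fromEnvPrim_of.{u, v}]
  exact LinearMap.congr_fun (congrArg TriBialg.Hom.toLin (envPrimIso.{u, v} hH).inv_hom_id) (x : H)

theorem GVAlg.Hom.isHomTo_envOf {B B' : GVAlg.{u, v} K q} (f : GVAlg.Hom B B') :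
    B.IsHomTo (env B').ops (envOf B' ∘ₗ f.toLin) :=
  ⟨fun x y => by
    simp only [LinearMap.comp_apply, f.map_mul, (_root_.isHomTo_envOf B').map_mul],
  fun x l => by
    simp only [LinearMap.comp_apply, f.map_brace, (_root_.isHomTo_envOf B').map_brace,
      List.map_map]
    rfl⟩

/-- The morphism of enveloping bialgebras induced by a morphism of `GV_q` algebras. -/
def envMap {B B' : GVAlg.{u, max u v} K q} (f : GVAlg.Hom B B') :
    TriBialg.Hom (envBialgebra B) (envBialgebra B') :=
  have hi := f.isHomTo_envOf
  have h := isHom_envLift (env B').isTridend hi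
  { toLin := envLift (env B').isTridend hi
    map_prec := h.map_prec
    map_dot := h.map_dot
    map_succ := h.map_succ
    map_comul := TriBialg.comul_of_map_letters (H := envBialgebra B') (env_wordMap_bijective _) h
      (fun b => by rw [envLift_of]; exact envOf_mem_prim B' _) }

theorem envMap_of {B B' : GVAlg.{u, max u v} K q} (f : GVAlg.Hom B B') (b : B) :
    (envMap.{u, v} f).toLin (envOf B b) = envOf B' (f.toLin b) :=
  envLift_of _ f.isHomTo_envOf b

theorem envBialgebra_hom_ext {B : GVAlg.{u, max u v} K q} {H : TriBialg.{u, max u v} K q}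
    {f g : TriBialg.Hom (envBialgebra B) H}
    (h : ∀ b, f.toLin (envOf B b) = g.toLin (envOf B b)) : f = g :=
  TriBialg.Hom.ext (env_hom_ext f.isHom g.isHom h)

/-- The functor sending a `GV_q` algebra to its enveloping bialgebra. -/
def envFunctor (K : Type u) [Field K] (q : K) :
    GVAlg.{u, max u v} K q ⥤ ConnTriBialg.{u, max u v} K q where
  obj B := ConnTriBialg.mk (envBialgebra B) (connected_envBialgebra B)
  map f := envMap.{u, v} f
  map_id B := envBialgebra_hom_ext.{u, v} fun b => envMap_of.{u, v} _ b
  map_comp f g := envBialgebra_hom_ext.{u, v} fun b => by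
    rw [envMap_of.{u, v}]
    exact ((congrArg _ (envMap_of.{u, v} f b)).trans (envMap_of.{u, v} g _)).symm

/-- The enveloping bialgebra and the primitive elements define an equivalence of categories. -/
def envEquivalence (K : Type u) [Field K] (q : K) :
    GVAlg.{u, max u v} K q ≌ ConnTriBialg.{u, max u v} K q :=
  CategoryTheory.Equivalence.mk (envFunctor.{u, v} K q) (primFunctor fun H => H.primIsGV)
    (NatIso.ofComponents
      (fun B => GVAlg.isoOfBijective (toPrimEnv.{u, v} B) (toPrimEnv_bijective.{u, v} B))
      (fun f => GVAlg.Hom.ext (LinearMap.ext fun b => Subtype.ext (envMap_of.{u, v} f b).symm)))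
    (NatIso.ofComponents
      (fun H =>
        { hom := (envPrimIso.{u, v} H.connected).hom
          inv := (envPrimIso.{u, v} H.connected).inv
          hom_inv_id := (envPrimIso.{u, v} H.connected).hom_inv_id
          inv_hom_id := (envPrimIso.{u, v} H.connected).inv_hom_id })
      (fun {H H'} f => envBialgebra_hom_ext.{u, v} fun b =>
        ((congrArg _ (envMap_of.{u, v} ((primFunctor fun H => H.primIsGV).map f) b)).trans
          (fromEnvPrim_of.{u, v} H'.toTriBialg _)).trans
          (congrArg (TriBialg.Hom.toLin f) (fromEnvPrim_of.{u, v} H.toTriBialg b)).symm))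

end Equivalence

end

theorem mainTheorem1 {K : Type u} [Field K] (q : K) :
    ∃ (hP : ∀ H : TriBialg.{u, max u v} K q, H.PrimIsGV)
      (Δ : ∀ B : GVAlg.{u, max u v} K q,
        (env B × K) →ₗ[K] (env B × K) ⊗[K] (env B × K))
      (hΔ : ∀ B : GVAlg.{u, max u v} K q, IsEnvCoproduct B (Δ B))
      (hconn : ∀ B : GVAlg.{u, max u v} K q, (envBialg B (Δ B) (hΔ B)).Connected),
      -- the coproduct on `U_qGV(B)` is the only one for which `B` is primitive
      (∀ (B : GVAlg.{u, max u v} K q) (Δ' : (env B × K) →ₗ[K] (env B × K) ⊗[K] (env B × K)),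
        IsEnvCoproduct B Δ' → Δ' = Δ B) ∧
      -- a connected `H` is isomorphic, as a bialgebra, to `U_qGV(Prim(H))`
      (∀ H : TriBialg.{u, max u v} K q, H.Connected →
        ∃ Φ : H ≅ envBialg (H.primGV (hP H)) (Δ (H.primGV (hP H))) (hΔ (H.primGV (hP H))),
          ∀ x : H.prim, TriBialg.Hom.toLin Φ.hom (x : H) = envOf (H.primGV (hP H)) x) ∧
      -- a `GV_q` algebra `B` is isomorphic to `Prim(U_qGV(B))`
      (∀ B : GVAlg.{u, max u v} K q,
        ∃ Φ : B ≅ (envBialg B (Δ B) (hΔ B)).primGV (hP (envBialg B (Δ B) (hΔ B))),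
          ∀ b : B, Subtype.val (GVAlg.Hom.toLin Φ.hom b) = envOf B b) ∧
      -- `U_qGV` and `Prim` are mutually inverse equivalences of categories
      (∃ e : GVAlg.{u, max u v} K q ≌ ConnTriBialg.{u, max u v} K q,
        e.inverse = primFunctor hP ∧
        ∃ α : ∀ B : GVAlg.{u, max u v} K q,
          e.functor.obj B ≅ ConnTriBialg.mk (envBialg B (Δ B) (hΔ B)) (hconn B),
          ∀ (B B' : GVAlg.{u, max u v} K q) (f : B ⟶ B') (b : B),
            TriBialg.Hom.toLin ((α B).inv ≫ e.functor.map f ≫ (α B').hom) (envOf B b) =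
              envOf B' (GVAlg.Hom.toLin f b)) :=
  ⟨fun H => H.primIsGV, envComul, isEnvCoproduct_envComul, connected_envBialgebra,
    fun B _ h => h.eq_envComul B,
    fun _ hH => ⟨(envPrimIso.{u, v} hH).symm, envPrimIso_inv.{u, v} hH⟩,
    fun B => ⟨GVAlg.isoOfBijective (toPrimEnv.{u, v} B) (toPrimEnv_bijective.{u, v} B),
      fun _ => rfl⟩,
    envEquivalence.{u, v} K q, rfl, fun _ => Iso.refl _, fun _ _ f b => envMap_of.{u, v} f b⟩
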